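/- **Setting.** Consider the equation $$y'=Q_1(y,1/x)=P_0(y)+Q(y,1/x)=\sum_{k\ge 0}P_k(y)x^{-k},$$ where $P_0\not\equiv 0$ is a polynomial with simple roots $p_1,\dots,p_m$, and $Q(y,z)$ is entire in $y$ and analytic in $z$ for $|z|<r$, with $Q(y,0)=0$. Let $\pi:\mathcal R_y\to Y=\mathbb C\setminus\{p_1,\dots,p_m\}$ be the universal covering, and let $\alpha$ be an element of the fundamental group of $Y$, regarded as a deck transformation of $\mathcal R_y$. A *$y$-path of type $\alpha$* is a curve $\eta:[0,\infty)\to\mathcal R_y$ with $\eta(N+1)=\alpha\,\eta(N)$ for all integers $N\ge0$. An *$R$-domain of type $\alpha$* is an open set $\mathcal S_y\subset\mathcal R_y$ that is a union of images of $y$-paths of type $\alpha$ lying in it, and whose only direction to infinity is that of $\alpha$: for each compact $Z\subset Y$ there is a compact $B\subset\mathcal R_y$ with $\mathcal S_y\cap\pi^{-1}(Z)\subset\bigcup_{N\ge0}\alpha^N B$. The variable $x$ lives on the Riemann surface of $\log x$. For $M_0,\epsilon>0$ and $R_0\ge 1/r$ put $$\mathcal D_1=\{(x,y): |x|>R_0,\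 y\in\mathcal S_y,\ |\pi(y)|<M_0,\ |\pi(y)-p_k|>\epsilon\ \text{for all } k\}.$$ **Formal constants of motion.** Write $D_xG=G_x+G_y\,Q_1(y,1/x)$, and for a series $\tilde C=-x+a\log x+F_0(y)+\sum_{k\ge1}F_k(y)x^{-k}$ let $C_n=-x+a\log x+F_0(y)+\sum_{k=1}^nF_k(y)x^{-k}$. The series $\tilde C$ is a *formal constant of motion* in an open set $\mathcal D$ if the $F_k$ are holomorphic functions of $y$ for $(x,y)\in\mathcal D$, all coefficients of the formal series $D_x\tilde C$ in powers of $1/x$ vanish there, and the functions $F_k$ ($k\ge1$) and $H_{n+1}:=x^{n+1}D_xC_n$ ($n\ge 0$) are each bounded in $\mathcal D$. **The region.** Let $\mathcal D\subset\mathcal D_1$ be an open set filled by curves in the following sense, with constants $b,L>0$: for each $(x_0,y_0)\in\mathcal D$ and each $n\in\{0,1\}$ there are a piecewise $C^1$ curve $x=\gamma(t)$ and a continuous curve $y=y_n(\gamma(t))$, $t\ge0$, starting at $x_0$ and $y_0$, such that $(\gamma(t),y_n(\gamma(t)))\in\mathcal D$ and $C_n(\gamma(t),y_n(\gamma(t)))$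 is constant in $t$, $|\gamma(t)|\to\infty$ as $t\to\infty$, and for all $t_1<t_2$ $$\left|\mathrm{Re}\int_{t_1}^{t_2}\frac{\partial Q_1}{\partial y}\big(y_n(\gamma(t)),1/\gamma(t)\big)\gamma'(t)\,dt\right|\le b\log\left(\left|\frac{\gamma(t_2)}{\gamma(t_1)}\right|+1\right),\qquad \int_{t_1}^{t_2}\frac{|\gamma'(t)|}{|\gamma(t)|}\,dt\le L\log\left(\left|\frac{\gamma(t_2)}{\gamma(t_1)}\right|+1\right).$$ **Theorem.** If $\tilde C$ is a formal constant of motion in such a region $\mathcal D$, then, after increasing $R_0$ if necessary (that is, on $\mathcal D\cap\{|x|>R_1\}$ for some $R_1\ge R_0$), there is an actual constant of motion $C(x,y)$: a function that is holomorphic in $(x,y)$ there, satisfies $D_xC=0$, so that $C$ is constant along the solutions of the equation, and satisfies $C\sim\tilde C$ as $x\to\infty$, i.e. for each $n\ge0$ $$C(x,y)-C_n(x,y)=O(x^{-n-1})$$ uniformly in the region. -/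

import Mathlib

open Set Filter Topology

namespace FormalMotion

/-- The right-hand side `Q₁(y, z) = P₀(y) + Q(y, z)` of the equation `y' = Q₁(y, 1/x)`. -/
noncomputable def rhs (P₀ : Polynomial ℂ) (Q : ℂ → ℂ → ℂ) (y z : ℂ) : ℂ :=
  P₀.eval y + Q y z

/-- The coefficient `P_k(y)` of `z ^ k` in the Taylor expansion of `Q₁(y, z)` at `z = 0`. -/
noncomputable def rhsCoeff (P₀ : Polynomial ℂ) (Q : ℂ → ℂ → ℂ) (k : ℕ) (y : ℂ) : ℂ :=
  iteratedDeriv k (rhs P₀ Q y) 0 / (k.factorial : ℂ)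

/-- The standing assumptions on the equation: `P₀` is a nonzero polynomial with simple roots, and
`Q(y, z)` is entire in `y`, analytic in `z` for `|z| < r`, and vanishes at `z = 0`. -/
structure IsNormalForm (P₀ : Polynomial ℂ) (Q : ℂ → ℂ → ℂ) (r : ℝ) : Prop where
  ne_zero : P₀ ≠ 0
  simple_roots : P₀.roots.Nodup
  r_pos : 0 < r
  holomorphic : DifferentiableOn ℂ (fun q : ℂ × ℂ => Q q.1 q.2) (univ ×ˢ Metric.ball (0 : ℂ) r)
  vanish : ∀ y, Q y 0 = 0

/-- The plane without the roots of `P₀`. -/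
abbrev Punctured (P₀ : Polynomial ℂ) : Type := {y : ℂ // P₀.eval y ≠ 0}

section Surface

/- Throughout, `p : E → Punctured P₀` is a covering map (the universal one in the theorem). A point
of the Riemann surface of `log x` is given by the number `ξ = log x ∈ ℂ`, so that `x = exp ξ`;
points `(x, y)` of the phase space are pairs `q : ℂ × E`, with `x = exp q.1`, `y = p q.2`. -/

variable {P₀ : Polynomial ℂ} {E : Type*} [TopologicalSpace E]

/-- `f` has derivative `f'` with respect to `y` at the point `w` of the covering surface. -/
def HasCoverDerivAt (p : E → Punctured P₀) (f : E → ℂ) (f' : ℂ) (w : E) : Prop :=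
  (fun v => f v - f w - f' * ((p v : ℂ) - (p w : ℂ))) =o[𝓝 w] fun v => (p v : ℂ) - (p w : ℂ)

/-- `C` is complex (totally) differentiable at `q` as a function of `(x, y)`, with partial
derivatives `C_x = cx` and `C_y = cy`. -/
def HasPartialsAt (p : E → Punctured P₀) (C : ℂ × E → ℂ) (cx cy : ℂ) (q : ℂ × E) : Prop :=
  (fun v : ℂ × E => C v - C q - cx * (Complex.exp v.1 - Complex.exp q.1)
      - cy * ((p v.2 : ℂ) - (p q.2 : ℂ)))
    =o[𝓝 q] fun v : ℂ × E => (Complex.exp v.1 - Complex.exp q.1, (p v.2 : ℂ) - (p q.2 : ℂ))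

/-- A path of type `g` in the covering surface: each piece on `[N, N + 1]` projects to a closed
loop whose homotopy class is the one of the deck transformation `g`. -/
def IsYPath (g : E ≃ₜ E) (η : ℝ → E) : Prop :=
  ContinuousOn η (Ici 0) ∧ ∀ N : ℕ, η (N + 1) = g (η N)

/-- A regular domain of type `g`: an open set that consists of images of paths of type `g` and in
which the only way to infinity, over compact sets of `y`, is in the direction of `g`: over a
compact set of `y` it is covered by the forward translates of a compact set. -/
structure IsRegularDomain (p : E → Punctured P₀) (g : E ≃ₜ E) (S : Set E) : Prop where
  isOpen : IsOpen S
  paths : ∀ w ∈ S, ∃ η : ℝ → E, IsYPath g η ∧ (∀ t, 0 ≤ t → η t ∈ S) ∧ ∃ t, 0 ≤ t ∧ η t = w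
  forward : ∀ Z : Set (Punctured P₀), IsCompact Z →
    ∃ B : Set E, IsCompact B ∧ S ∩ p ⁻¹' Z ⊆ ⋃ N : ℕ, (g^[N]) '' B

/-- The domain of all `(x, y)` with `|x| > R₀` and `y ∈ S`, `|y| < M₀`, `y` at distance more than
`ε` from every root of `P₀`. -/
def domainOne (p : E → Punctured P₀) (S : Set E) (M₀ ε R₀ : ℝ) : Set (ℂ × E) :=
  {q | R₀ < ‖Complex.exp q.1‖ ∧ q.2 ∈ S ∧ ‖(p q.2 : ℂ)‖ < M₀ ∧
    ∀ c : ℂ, P₀.IsRoot c → ε < ‖(p q.2 : ℂ) - c‖}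

/-- The truncation `C_n = -x + a log x + F₀(y) + F₁(y) / x + ⋯ + F_n(y) / x ^ n` of the formal
series `-x + a log x + F₀(y) + F₁(y) / x + ⋯`. -/
noncomputable def truncation (a : ℂ) (F : ℕ → E → ℂ) (n : ℕ) (q : ℂ × E) : ℂ :=
  -Complex.exp q.1 + a * q.1 + F 0 q.2 + ∑ k ∈ Finset.Icc 1 n, F k q.2 / Complex.exp q.1 ^ k

/-- The derivative `D_x C_n = ∂C_n/∂x + ∂C_n/∂y · Q₁(y, 1/x)` of the truncation along the field,
where `dF k` is the derivative of `F k`. -/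
noncomputable def truncationDx (Q : ℂ → ℂ → ℂ) (p : E → Punctured P₀) (a : ℂ)
    (F dF : ℕ → E → ℂ) (n : ℕ) (q : ℂ × E) : ℂ :=
  (-1 + a / Complex.exp q.1) + ∑ k ∈ Finset.range (n + 1),
    (dF k q.2 * rhs P₀ Q (p q.2) (Complex.exp q.1)⁻¹ / Complex.exp q.1 ^ k
      - k * F k q.2 / Complex.exp q.1 ^ (k + 1))

/-- The coefficient of `x ^ (-k)` in the formal series `D_x (-x + a log x + ∑ F_j(y) x ^ (-j))`.
The factor `k - 1` is truncated, so that the last term is absent for `k = 0` and `k = 1`. -/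
noncomputable def formalDxCoeff (Q : ℂ → ℂ → ℂ) (p : E → Punctured P₀) (a : ℂ)
    (F dF : ℕ → E → ℂ) (k : ℕ) (w : E) : ℂ :=
  (if k = 0 then -1 else if k = 1 then a else 0)
    + ∑ j ∈ Finset.range (k + 1), rhsCoeff P₀ Q (k - j) (p w) * dF j w
    - ((k - 1 : ℕ) : ℂ) * F (k - 1) w

/-- The series `-x + a log x + F₀(y) + F₁(y) / x + ⋯` is a formal constant of motion in `D`: the
`F_k` are holomorphic functions of `y`, all coefficients of its formal derivative along the field
vanish, and the `F_k`, `k ≥ 1`, and `H_{n+1} = x ^ (n + 1) D_x C_n`, `n ≥ 0`, are bounded in `D`.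
(`F₀` is not asked to be bounded: it balances `-x + a log x` on every trajectory.) -/
def IsFormalConstant (Q : ℂ → ℂ → ℂ) (p : E → Punctured P₀) (a : ℂ) (F : ℕ → E → ℂ)
    (D : Set (ℂ × E)) : Prop :=
  ∃ dF : ℕ → E → ℂ,
    (∀ k, ∀ q ∈ D, HasCoverDerivAt p (F k) (dF k q.2) q.2) ∧
    (∀ k, ∀ q ∈ D, formalDxCoeff Q p a F dF k q.2 = 0) ∧
    (∀ k, 1 ≤ k → ∃ M : ℝ, ∀ q ∈ D, ‖F k q.2‖ ≤ M) ∧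
    (∀ n : ℕ, ∃ M : ℝ, ∀ q ∈ D,
      ‖Complex.exp q.1 ^ (n + 1) * truncationDx Q p a F dF n q‖ ≤ M)

/-- `x(t) = exp (γ t)` is an admissible curve in `D`, along which `y = η t` is the approximate
solution `y_n`, that is, `C_n(x, y)` is constant. -/
structure IsAdmissibleCurve (Q : ℂ → ℂ → ℂ) (p : E → Punctured P₀) (a : ℂ) (F : ℕ → E → ℂ)
    (D : Set (ℂ × E)) (b L : ℝ) (n : ℕ) (γ : ℝ → ℂ) (η : ℝ → E) : Prop where
  /-- the curve is piecewise continuously differentiable -/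
  piecewise : ∃ τ : ℕ → ℝ, StrictMono τ ∧ τ 0 = 0 ∧ Tendsto τ atTop atTop ∧
    ∀ i, ContDiffOn ℝ 1 γ (Icc (τ i) (τ (i + 1)))
  continuous_y : ContinuousOn η (Ici 0)
  mem : ∀ t, 0 ≤ t → (γ t, η t) ∈ D
  level : ∀ t, 0 ≤ t → truncation a F n (γ t, η t) = truncation a F n (γ 0, η 0)
  escape : Tendsto (fun t => ‖Complex.exp (γ t)‖) atTop atTop
  /-- the bound on the real part of `∫ ∂_y Q₁ dx` along the curve; note `x' = γ' exp γ` -/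
  growth : ∀ t₁ t₂, 0 ≤ t₁ → t₁ < t₂ →
    |(∫ t in t₁..t₂, deriv (fun w => rhs P₀ Q w (Complex.exp (γ t))⁻¹) (p (η t))
        * (deriv γ t * Complex.exp (γ t))).re|
      ≤ b * Real.log (‖Complex.exp (γ t₂) / Complex.exp (γ t₁)‖ + 1)
  /-- the bound on `∫ |dx| / |x|` along the curve; note `|x'| / |x| = |γ'|` -/
  length : ∀ t₁ t₂, 0 ≤ t₁ → t₁ < t₂ →
    ∫ t in t₁..t₂, ‖deriv γ t‖
      ≤ L * Real.log (‖Complex.exp (γ t₂) / Complex.exp (γ t₁)‖ + 1)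

/-- `C` is an actual constant of motion in `D` associated to the formal series: it is holomorphic
in `(x, y)`, its derivative `C_x + C_y Q₁(y, 1/x)` along the field vanishes, and it is asymptotic
to the series as `x → ∞`, uniformly in `D`. -/
def IsActualConstant (Q : ℂ → ℂ → ℂ) (p : E → Punctured P₀) (a : ℂ) (F : ℕ → E → ℂ)
    (D : Set (ℂ × E)) (C : ℂ × E → ℂ) : Prop :=
  (∀ q ∈ D, ∃ cx cy : ℂ, HasPartialsAt p C cx cy q ∧
    cx + cy * rhs P₀ Q (p q.2) (Complex.exp q.1)⁻¹ = 0) ∧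
  ∀ n : ℕ, ∃ M : ℝ, ∀ q ∈ D, ‖C q - truncation a F n q‖ ≤ M / ‖Complex.exp q.1‖ ^ (n + 1)

end Surface

end FormalMotion

/-! Put `z = 1/x` and `ξ = log x`. The line `z = 0` is a leaf of the foliation, and it is regular
over the punctured plane because `Q₁(y, 0) = P₀(y) ≠ 0` there. Nearby leaves can therefore be
followed along paths in the covering surface. Transporting `log x` along the leaf to a base point
`w₀` gives an exact first integral, the clock `log x + ∑ S_k(y) x ^ (-k)` with `S_k(w₀) = 0`. Unlike
the given formal constant, this series converges, locally uniformly on the covering surface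
(`IsFormalSolution.exists_nhds_bound`, `IsFormalSolution.clock_relation`).

What remains is the dynamics of the holonomy. A deck transformation changes the clock by a map of
its value alone (`IsClock.clock_deck`); for `g⁻¹` this return map is `Λ ξ = clock S ξ (g⁻¹ w₀)`. In
the variable `s = exp ξ` it is a parabolic germ `s ↦ s + κ + O(1/s)`.

The formal constant `F` extends, up to locally constant functions in `F₀`, to a formal solution `Φ`
on the whole covering surface with `Φ₀ ∘ g = Φ₀ + κ` and `Φ_k ∘ g = Φ_k` for `k ≥ 1`
(`exists_invariant_solution`). Here `κ ≠ 0` because `F₀` is unbounded along the admissible curves.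
The boundedness of `F_k` for `k ≥ 1` excludes both additive periods of `Φ_k` and stray constants in
other components. The truncations of `Φ` at `w₀` then solve the Abel equation `c(Λ ξ) = c(ξ) - κ` up
to errors of any order, so they are asymptotic Fatou coordinates.

In a sector that avoids the direction `-κ`, orbits of `Λ` escape linearly and the limit of `c 1 (Λ^N
ξ) + N κ` is an exact Fatou coordinate `f` (`FatouData.exists_sector`). The region lies in such a
sector for large `|x|`: along an admissible curve `x/κ` equals a natural number plus logarithmic and
bounded terms, because `y` can go to infinity only by forward translates. The curve thus ends in the
right half-plane and cannot come from a neighbourhood of the negative axis without passing too close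
to `0` (`exists_mem_sector_of_curves`).

The constant of motion at `y = g^m b`, with `b` in a fixed compact set, is `f(clock(ξ, b)) + m κ`
plus the locally constant `F₀ - Φ₀`. The Abel equation makes it independent of the choice of `m` and
`b`. -/

namespace FormalMotion

/-! ### Gluing local functions on a simply connected space -/

section Monodromy

/-- The product of `X` with `ℂ`, to be given the topology whose sheets are the graphs of the local
functions `Ψ w`. -/
structure SheetSpace {X : Type*} (Ψ : X → X → ℂ) where
  /-- the base point -/
  pt : X
  /-- the value on the sheet -/
  val : ℂ

variable {X : Type*} [TopologicalSpace X] {Ψ : X → X → ℂ}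

/-- As in the étalé space of a sheaf, a continuous section has to follow the vertical translates of
the graphs, so it is a global function with the prescribed local increments. -/
instance : TopologicalSpace (SheetSpace Ψ) where
  IsOpen O := ∀ w c, ⟨w, c⟩ ∈ O → ∀ᶠ v in 𝓝 w, ⟨v, c + (Ψ w v - Ψ w w)⟩ ∈ O
  isOpen_univ := fun w c _ => Eventually.of_forall fun _ => trivial
  isOpen_inter := fun s t hs ht w c h => (hs w c h.1).and (ht w c h.2)
  isOpen_sUnion := fun S hS w c h => by
    obtain ⟨t, ht, hm⟩ := h
    exact (hS t ht w c hm).mono fun v hv => ⟨t, ht, hv⟩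

lemma SheetSpace.isOpen_iff {O : Set (SheetSpace Ψ)} : IsOpen O ↔ ∀ w c, ⟨w, c⟩ ∈ O →
    ∀ᶠ v in 𝓝 w, ⟨v, c + (Ψ w v - Ψ w w)⟩ ∈ O := Iff.rfl

/-- The complex numbers with the discrete topology. -/
@[ext] structure DiscreteComplex where
  /-- the underlying complex number -/
  val : ℂ

instance : TopologicalSpace DiscreteComplex := ⊥
instance : DiscreteTopology DiscreteComplex := ⟨rfl⟩

/-- Near `w` every germ is that of `Ψ w` up to a constant, so `val - Ψ w pt` is locally constant and
labels the sheets. This is why the fibre is `ℂ` with the discrete topology. -/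
lemma SheetSpace.isCoveringMap_pt
    (h : ∀ w, ∀ᶠ v in 𝓝 w, ∀ᶠ u in 𝓝 v, Ψ v u - Ψ v v = Ψ w u - Ψ w v) :
    IsCoveringMap (SheetSpace.pt : SheetSpace Ψ → X) := by
  have hproj : Continuous (SheetSpace.pt : SheetSpace Ψ → X) := by
    refine ⟨fun U hU => ?_⟩
    rw [SheetSpace.isOpen_iff]
    intro w c hw
    exact hU.mem_nhds hw
  intro w
  obtain ⟨U, hU, hUo, hwU⟩ := mem_nhds_iff.1 (h w)
  suffices H : IsEvenlyCovered (SheetSpace.pt : SheetSpace Ψ → X) w DiscreteComplex from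
    H.to_isEvenlyCovered_preimage
  refine ⟨inferInstance, U, hwU, hUo, hUo.preimage hproj, ?_⟩
  let toF : SheetSpace.pt (Ψ := Ψ) ⁻¹' U → U × DiscreteComplex :=
    fun q => (⟨q.1.pt, q.2⟩, ⟨q.1.val - Ψ w q.1.pt⟩)
  let invF : U × DiscreteComplex → SheetSpace.pt (Ψ := Ψ) ⁻¹' U :=
    fun x => ⟨⟨x.1.1, x.2.val + Ψ w x.1.1⟩, x.1.2⟩
  refine ⟨⟨⟨toF, invF, ?_, ?_⟩, ?_, ?_⟩, fun x => rfl⟩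
  · rintro ⟨⟨v, c⟩, hv⟩
    simp [toF, invF]
  · rintro ⟨⟨v, hv⟩, c⟩
    simp [toF, invF]
  · refine Continuous.prodMk ?_ ?_
    · exact Continuous.subtype_mk (hproj.comp continuous_subtype_val) _
    · rw [continuous_discrete_rng]
      intro k
      have : IsOpen {q : SheetSpace Ψ | q.pt ∈ U ∧ q.val - Ψ w q.pt = k.val} := by
        rw [SheetSpace.isOpen_iff]
        rintro v c ⟨hv, hc⟩
        filter_upwards [hU hv, hUo.mem_nhds hv] with u hu hu'
        refine ⟨hu', ?_⟩
        simp only at hc ⊢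
        rw [hu, ← hc]; ring
      convert this.preimage
        (continuous_subtype_val (p := fun q => q ∈ SheetSpace.pt (Ψ := Ψ) ⁻¹' U)) using 1
      ext q
      exact ⟨fun hq => ⟨q.2, congrArg DiscreteComplex.val hq⟩, fun hq => DiscreteComplex.ext hq.2⟩
  · rw [continuous_prod_of_discrete_right]
    intro k
    refine Continuous.subtype_mk ?_ _
    refine ⟨fun O hO => ?_⟩
    rw [isOpen_iff_mem_nhds]
    rintro ⟨u, hu⟩ huO
    have h1 := SheetSpace.isOpen_iff.1 hO u _ huO
    have h2 : ∀ᶠ v in 𝓝 u, (⟨v, k.val + Ψ w v⟩ : SheetSpace Ψ) ∈ O := by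
      filter_upwards [h1, hU hu] with v hv hv'
      convert hv using 2
      rw [hv']; ring
    exact (continuous_subtype_val.tendsto (⟨u, hu⟩ : U)).eventually h2

/-- Compatible local functions on a simply connected space come from a global function. -/
lemma exists_global_of_local [SimplyConnectedSpace X] [LocallyPathConnectedSpace X]
    (h : ∀ w, ∀ᶠ v in 𝓝 w, ∀ᶠ u in 𝓝 v, Ψ v u - Ψ v v = Ψ w u - Ψ w v) (x₀ : X) (c₀ : ℂ) :
    ∃ Φ : X → ℂ, Φ x₀ = c₀ ∧ ∀ w, ∀ᶠ v in 𝓝 w, Φ v - Φ w = Ψ w v - Ψ w w := by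
  -- The identity map lifts through the covering, and the lift is a global section.
  obtain ⟨s, ⟨hs0, hs⟩, -⟩ := (SheetSpace.isCoveringMap_pt h).existsUnique_continuousMap_lifts
    (ContinuousMap.id X) x₀ ⟨x₀, c₀⟩ rfl
  have hfst : ∀ w, (s w).pt = w := fun w => congrFun hs w
  refine ⟨fun w => (s w).val, congrArg SheetSpace.val hs0, fun w => ?_⟩
  -- This is the sheet of `Ψ w` through `s w`. It is open, so the section stays on it near `w`.
  have hO : IsOpen {q : SheetSpace Ψ | ∀ᶠ u in 𝓝 q.pt,
      Ψ q.pt u - Ψ q.pt q.pt = Ψ w u - Ψ w q.pt ∧ q.val - (s w).val = Ψ w q.pt - Ψ w w} := by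
    rw [SheetSpace.isOpen_iff]
    intro v c hv
    have hv' : ∀ᶠ u in 𝓝 v, Ψ v u - Ψ v v = Ψ w u - Ψ w v ∧
      c - (s w).val = Ψ w v - Ψ w w := hv
    have hc := hv'.self_of_nhds.2
    filter_upwards [hv'.eventually_nhds, h v] with u hu hu2
    change ∀ᶠ x in 𝓝 u, Ψ u x - Ψ u u = Ψ w x - Ψ w u ∧
      c + (Ψ v u - Ψ v v) - (s w).val = Ψ w u - Ψ w w
    filter_upwards [hu, hu2] with x hx hx2
    have h3 := hu.self_of_nhds.1
    refine ⟨?_, ?_⟩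
    · rw [hx2]; linear_combination hx.1 - h3
    · rw [h3]; linear_combination hc
  have hmem : ∀ᶠ v in 𝓝 w, s v ∈ {q : SheetSpace Ψ | ∀ᶠ u in 𝓝 q.pt,
      Ψ q.pt u - Ψ q.pt q.pt = Ψ w u - Ψ w q.pt ∧ q.val - (s w).val = Ψ w q.pt - Ψ w w} := by
    refine s.continuous.continuousAt.eventually (hO.mem_nhds ?_)
    simp only [mem_ofPred_eq, hfst, sub_self, and_true]
    exact Eventually.of_forall fun _ => trivial
  filter_upwards [hmem] with v hv
  have := hv.self_of_nhds.2
  rwa [hfst] at this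

end Monodromy

/-! ### Calculus on the covering surface, with `y` as local coordinate -/

section Charts

variable {P₀ : Polynomial ℂ} {E : Type*} [TopologicalSpace E] {p : E → Punctured P₀}

lemma isLocalHomeomorph_coe (hp : IsCoveringMap p) : IsLocalHomeomorph fun w => (p w : ℂ) := by
  have h : IsOpen {y : ℂ | P₀.eval y ≠ 0} := isOpen_ne_fun P₀.continuous continuous_const
  exact h.isOpenEmbedding_subtypeVal.isLocalHomeomorph.comp hp.isLocalHomeomorph

lemma exists_chart (hp : IsCoveringMap p) (w : E) :
    ∃ e : OpenPartialHomeomorph E ℂ, w ∈ e.source ∧ ∀ v, e v = p v := by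
  obtain ⟨e, he, h⟩ := isLocalHomeomorph_coe hp w
  exact ⟨e, he, fun v => (congrFun h v).symm⟩

lemma hasCoverDerivAt_iff {f : E → ℂ} {f' : ℂ} {w : E} {e : OpenPartialHomeomorph E ℂ}
    (hw : w ∈ e.source) (he : ∀ v, e v = p v) :
    HasCoverDerivAt p f f' w ↔ HasDerivAt (f ∘ e.symm) f' (p w) := by
  rw [hasDerivAt_iff_isLittleO, HasCoverDerivAt, ← he w, ← e.map_nhds_eq hw,
    Asymptotics.isLittleO_map]
  refine Asymptotics.isLittleO_congr ?_ ?_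
  · filter_upwards [e.open_source.mem_nhds hw] with v hv
    simp only [Function.comp_apply, e.left_inv hv, e.left_inv hw, smul_eq_mul, ← he]
    ring
  · filter_upwards with v
    simp [he]

lemma hasCoverDerivAt_iff_symm {f : E → ℂ} {f' : ℂ} {y : ℂ} {e : OpenPartialHomeomorph E ℂ}
    (hy : y ∈ e.target) (he : ∀ v, e v = p v) :
    HasCoverDerivAt p f f' (e.symm y) ↔ HasDerivAt (f ∘ e.symm) f' y := by
  rw [hasCoverDerivAt_iff (e.map_target hy) he, ← he, e.right_inv hy]

lemma coe_symm_of_mem_target {y : ℂ} {e : OpenPartialHomeomorph E ℂ}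
    (hy : y ∈ e.target) (he : ∀ v, e v = p v) : (p (e.symm y) : ℂ) = y := by
  rw [← he, e.right_inv hy]

lemma locallyPathConnectedSpace_of_isCoveringMap (hp : IsCoveringMap p) :
    LocallyPathConnectedSpace E := by
  choose e he _ using fun w => exists_chart hp w
  let _ : ChartedSpace ℂ E :=
    { atlas := range e
      chartAt := e
      mem_chart_source := he
      chart_mem_atlas := fun w => mem_range_self w }
  exact ChartedSpace.locallyPathConnectedSpace ℂ E

lemma continuous_coe (hp : IsCoveringMap p) : Continuous fun w => (p w : ℂ) :=
  (isLocalHomeomorph_coe hp).continuous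

lemma HasCoverDerivAt.continuousAt (hp : IsCoveringMap p) {f : E → ℂ} {f' : ℂ} {w : E}
    (h : HasCoverDerivAt p f f' w) : ContinuousAt f w := by
  obtain ⟨e, hw, he⟩ := exists_chart hp w
  have h1 := ((hasCoverDerivAt_iff hw he).1 h).continuousAt
  rw [← he w] at h1
  refine (h1.comp (e.continuousAt hw)).congr ?_
  filter_upwards [e.open_source.mem_nhds hw] with v hv
  simp [e.left_inv hv]

lemma HasCoverDerivAt.sub (hp : IsCoveringMap p) {f₁ f₂ : E → ℂ} {f₁' f₂' : ℂ} {w : E}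
    (h₁ : HasCoverDerivAt p f₁ f₁' w) (h₂ : HasCoverDerivAt p f₂ f₂' w) :
    HasCoverDerivAt p (fun v => f₁ v - f₂ v) (f₁' - f₂') w := by
  obtain ⟨e, hw, he⟩ := exists_chart hp w
  rw [hasCoverDerivAt_iff hw he] at *
  exact h₁.sub h₂

lemma HasCoverDerivAt.add (hp : IsCoveringMap p) {f₁ f₂ : E → ℂ} {f₁' f₂' : ℂ} {w : E}
    (h₁ : HasCoverDerivAt p f₁ f₁' w) (h₂ : HasCoverDerivAt p f₂ f₂' w) :
    HasCoverDerivAt p (fun v => f₁ v + f₂ v) (f₁' + f₂') w := by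
  obtain ⟨e, hw, he⟩ := exists_chart hp w
  rw [hasCoverDerivAt_iff hw he] at *
  exact h₁.add h₂

lemma HasCoverDerivAt.const_mul (hp : IsCoveringMap p) {f : E → ℂ} {f' : ℂ} {w : E} (c : ℂ)
    (h : HasCoverDerivAt p f f' w) : HasCoverDerivAt p (fun v => c * f v) (c * f') w := by
  obtain ⟨e, hw, he⟩ := exists_chart hp w
  rw [hasCoverDerivAt_iff hw he] at *
  exact h.const_mul c

lemma HasCoverDerivAt.mul (hp : IsCoveringMap p) {f₁ f₂ : E → ℂ} {f₁' f₂' : ℂ} {w : E}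
    (h₁ : HasCoverDerivAt p f₁ f₁' w) (h₂ : HasCoverDerivAt p f₂ f₂' w) :
    HasCoverDerivAt p (fun v => f₁ v * f₂ v) (f₁' * f₂ w + f₁ w * f₂') w := by
  obtain ⟨e, hw, he⟩ := exists_chart hp w
  rw [hasCoverDerivAt_iff hw he] at *
  have h := h₁.fun_mul h₂
  simp only [Function.comp_apply, ← he, e.left_inv hw] at h ⊢
  exact h

lemma hasCoverDerivAt_const (c : ℂ) (w : E) :
    HasCoverDerivAt p (fun _ => c) 0 w := by
  simp [HasCoverDerivAt]

lemma hasCoverDerivAt_comp_coe (hp : IsCoveringMap p) {h : ℂ → ℂ} {h' : ℂ} {w : E}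
    (hh : HasDerivAt h h' (p w)) : HasCoverDerivAt p (fun v => h (p v)) h' w := by
  obtain ⟨e, hw, he⟩ := exists_chart hp w
  rw [hasCoverDerivAt_iff hw he]
  refine hh.congr_of_eventuallyEq ?_
  have : e.target ∈ 𝓝 (p w : ℂ) := by rw [← he]; exact e.open_target.mem_nhds (e.map_source hw)
  filter_upwards [this] with y hy
  simp [coe_symm_of_mem_target hy he]

lemma HasCoverDerivAt.comp_deck {g : E ≃ₜ E} (hg : ∀ w, p (g w) = p w) {f : E → ℂ} {f' : ℂ} {w : E}
    (h : HasCoverDerivAt p f f' (g w)) : HasCoverDerivAt p (fun v => f (g v)) f' w := by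
  have := h.comp_tendsto (g.continuous.continuousAt (x := w))
  refine this.congr (fun v => ?_) (fun v => ?_)
  · simp [hg]
  · simp [hg]

lemma HasCoverDerivAt.congr_of_eventuallyEq {f₁ f₂ : E → ℂ} {f' : ℂ} {w : E}
    (h : HasCoverDerivAt p f₁ f' w) (hf : f₂ =ᶠ[𝓝 w] f₁) : HasCoverDerivAt p f₂ f' w := by
  refine h.congr' ?_ (EventuallyEq.refl _ _)
  filter_upwards [hf] with v hv
  rw [hv, hf.self_of_nhds]

/-- Balls around the image of a point, small enough for a local section into a neighbourhood. -/
lemma exists_ball_chart (hp : IsCoveringMap p) {w : E} {V : Set E} (hV : V ∈ 𝓝 w) :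
    ∃ (e : OpenPartialHomeomorph E ℂ) (r : ℝ), 0 < r ∧ w ∈ e.source ∧ (∀ v, e v = p v) ∧
      Metric.ball (p w : ℂ) r ⊆ e.target ∧ (∀ y ∈ Metric.ball (p w : ℂ) r, e.symm y ∈ V) ∧
      e.symm '' Metric.ball (p w : ℂ) r ∈ 𝓝 w := by
  obtain ⟨e, hw, he⟩ := exists_chart hp w
  have h1 : e.target ∈ 𝓝 (p w : ℂ) := by rw [← he]; exact e.open_target.mem_nhds (e.map_source hw)
  have h2 : e.symm ⁻¹' V ∈ 𝓝 (p w : ℂ) := by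
    rw [← he]
    apply e.continuousAt_symm (e.map_source hw)
    rwa [e.left_inv hw]
  obtain ⟨r, hr, hb⟩ := Metric.mem_nhds_iff.1 (inter_mem h1 h2)
  refine ⟨e, r, hr, hw, he, fun y hy => (hb hy).1, fun y hy => (hb hy).2, ?_⟩
  filter_upwards [e.open_source.mem_nhds hw,
    (continuous_coe hp).continuousAt.preimage_mem_nhds (Metric.ball_mem_nhds (p w : ℂ) hr)]
    with v hv hv'
  exact ⟨p v, hv', by rw [← he, e.left_inv hv]⟩

lemma eventually_eq_of_hasCoverDerivAt_zero (hp : IsCoveringMap p) {f : E → ℂ} {w : E}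
    (h : ∀ᶠ v in 𝓝 w, HasCoverDerivAt p f 0 v) : ∀ᶠ v in 𝓝 w, f v = f w := by
  obtain ⟨e₀, hw₀, he₀⟩ := exists_chart hp w
  have hU : {y | y ∈ e₀.target ∧ HasCoverDerivAt p f 0 (e₀.symm y)} ∈ 𝓝 (p w : ℂ) := by
    rw [← he₀]
    have := (e₀.continuousAt_symm (e₀.map_source hw₀))
    rw [ContinuousAt, e₀.left_inv hw₀] at this
    exact inter_mem (e₀.open_target.mem_nhds (e₀.map_source hw₀)) (this.eventually h)
  obtain ⟨r, hr, hb⟩ := Metric.mem_nhds_iff.1 hU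
  filter_upwards [e₀.open_source.mem_nhds hw₀,
    (continuous_coe hp).continuousAt.preimage_mem_nhds (Metric.ball_mem_nhds (p w : ℂ) hr)]
    with v hv hv'
  have h0 : ∀ y ∈ Metric.ball (p w : ℂ) r, HasDerivAt (f ∘ e₀.symm) 0 y := fun y hy =>
    (hasCoverDerivAt_iff_symm (hb hy).1 he₀).1 (hb hy).2
  have := (convex_ball (p w : ℂ) r).norm_image_sub_le_of_norm_hasDerivWithin_le (C := 0)
    (fun y hy => (h0 y hy).hasDerivWithinAt) (by simp) (Metric.mem_ball_self hr) hv'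
  simp only [Function.comp_apply, ← he₀, e₀.left_inv hv, e₀.left_inv hw₀, zero_mul, norm_le_zero_iff]
    at this
  exact sub_eq_zero.1 this

lemma eq_of_hasCoverDerivAt_zero [PreconnectedSpace E] (hp : IsCoveringMap p) {f : E → ℂ}
    (h : ∀ v, HasCoverDerivAt p f 0 v) (v w : E) : f v = f w := by
  have : IsLocallyConstant f := (IsLocallyConstant.iff_eventually_eq f).2 fun w =>
    eventually_eq_of_hasCoverDerivAt_zero hp (Eventually.of_forall h)
  exact this.apply_eq_of_isPreconnected isPreconnected_univ trivial trivial

/-- Every holomorphic function on the universal cover has a primitive. -/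
lemma exists_primitive [SimplyConnectedSpace E] (hp : IsCoveringMap p) {f : E → ℂ}
    (hf : ∀ w, ∃ f', HasCoverDerivAt p f f' w) (w₀ : E) (c : ℂ) :
    ∃ Φ : E → ℂ, Φ w₀ = c ∧ ∀ w, HasCoverDerivAt p Φ (f w) w := by
  have := locallyPathConnectedSpace_of_isCoveringMap hp
  have hloc : ∀ w, ∃ ψ : E → ℂ, ∀ᶠ v in 𝓝 w, HasCoverDerivAt p ψ (f v) v := by
    intro w
    obtain ⟨e, r, hr, hw, he, hb, -, hV⟩ := exists_ball_chart hp (univ_mem : _ ∈ 𝓝 w)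
    have hd : DifferentiableOn ℂ (f ∘ e.symm) (Metric.ball (p w : ℂ) r) := fun y hy => by
      obtain ⟨f', hf'⟩ := hf (e.symm y)
      exact ((hasCoverDerivAt_iff_symm (hb hy) he).1
        hf').differentiableAt.differentiableWithinAt
    obtain ⟨G, hG⟩ := hd.isExactOn_ball
    refine ⟨fun v => G (p v), ?_⟩
    filter_upwards [hV] with v hv
    obtain ⟨y, hy, rfl⟩ := hv
    have h1 := coe_symm_of_mem_target (hb hy) he
    apply hasCoverDerivAt_comp_coe hp
    rw [h1]
    exact hG y hy
  choose Ψ hΨ using hloc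
  obtain ⟨Φ, h0, hΦ⟩ := exists_global_of_local (Ψ := Ψ) (fun w => by
    filter_upwards [(hΨ w).eventually_nhds] with v hv
    -- Local primitives of the same function differ by constants, which is the compatibility needed
    -- for gluing.
    have : ∀ᶠ u in 𝓝 v, HasCoverDerivAt p (fun x => Ψ v x - Ψ w x) 0 u := by
      filter_upwards [hv, hΨ v] with u h1 h2
      simpa using h2.sub hp h1
    filter_upwards [eventually_eq_of_hasCoverDerivAt_zero hp this] with u hu
    linear_combination hu) w₀ c
  refine ⟨Φ, h0, fun w => ?_⟩
  have h1 := ((hΨ w).self_of_nhds).add hp (hasCoverDerivAt_const (Φ w - Ψ w w) w)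
  rw [add_zero] at h1
  refine h1.congr_of_eventuallyEq ?_
  filter_upwards [hΦ w] with v hv
  linear_combination hv

end Charts

/-! ### Taylor coefficients of the right-hand side -/

section Series

lemma norm_sub_sum_le_of_hasSum {c : ℕ → ℂ} {z S : ℂ} {M A : ℝ} (hA : 0 ≤ A)
    (hc : ∀ k, ‖c k‖ ≤ M * A ^ k) (hz : A * ‖z‖ ≤ 1 / 2) (h : HasSum (fun k => c k * z ^ k) S)
    (n : ℕ) : ‖S - ∑ k ∈ Finset.range n, c k * z ^ k‖ ≤ 2 * M * (A * ‖z‖) ^ n := by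
  have hM : 0 ≤ M := by simpa using (norm_nonneg _).trans (hc 0)
  have h0 : 0 ≤ A * ‖z‖ := by positivity
  have h1 := (hasSum_nat_add_iff' n).2 h
  have hg : HasSum (fun k : ℕ => M * (A * ‖z‖) ^ n * (1 / 2 : ℝ) ^ k) (M * (A * ‖z‖) ^ n * 2) :=
    hasSum_geometric_two.mul_left _
  have h2 := tsum_of_norm_bounded hg (f := fun k => c (k + n) * z ^ (k + n)) (fun k => by
    rw [norm_mul, norm_pow]
    calc ‖c (k + n)‖ * ‖z‖ ^ (k + n) ≤ M * A ^ (k + n) * ‖z‖ ^ (k + n) := by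
          gcongr; exact hc _
      _ = M * (A * ‖z‖) ^ n * (A * ‖z‖) ^ k := by rw [mul_pow, mul_pow]; ring
      _ ≤ _ := by gcongr)
  rw [h1.tsum_eq] at h2
  linarith

end Series

section Rhs

variable {P₀ : Polynomial ℂ} {Q : ℂ → ℂ → ℂ} {r : ℝ}

lemma IsNormalForm.differentiableAt (hform : IsNormalForm P₀ Q r) (y : ℂ) {z : ℂ} (hz : ‖z‖ < r) :
    DifferentiableAt ℂ (fun q : ℂ × ℂ => rhs P₀ Q q.1 q.2) (y, z) := by
  have h : DifferentiableAt ℂ (fun q : ℂ × ℂ => Q q.1 q.2) (y, z) :=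
    hform.holomorphic.differentiableAt
      ((isOpen_univ.prod Metric.isOpen_ball).mem_nhds ⟨trivial, by simpa using hz⟩)
  have h2 : DifferentiableAt ℂ (fun q : ℂ × ℂ => P₀.eval q.1) (y, z) :=
    P₀.differentiable.differentiableAt.comp (y, z) differentiableAt_fst
  exact h2.add h

lemma IsNormalForm.differentiableAt_right (hform : IsNormalForm P₀ Q r) (y : ℂ) {z : ℂ}
    (hz : ‖z‖ < r) : DifferentiableAt ℂ (rhs P₀ Q y) z :=
  (hform.differentiableAt y hz).comp z ((differentiableAt_const y).prodMk differentiableAt_id)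

lemma IsNormalForm.differentiableAt_left (hform : IsNormalForm P₀ Q r) (y : ℂ) {z : ℂ}
    (hz : ‖z‖ < r) : DifferentiableAt ℂ (fun y => rhs P₀ Q y z) y :=
  (hform.differentiableAt y hz).comp (f := fun y => (y, z)) y
    (differentiableAt_id.prodMk (differentiableAt_const z))

lemma rhsCoeff_zero (hform : IsNormalForm P₀ Q r) (y : ℂ) : rhsCoeff P₀ Q 0 y = P₀.eval y := by
  simp [rhsCoeff, rhs, hform.vanish]

lemma hasSum_rhsCoeff (hform : IsNormalForm P₀ Q r) (y : ℂ) {z : ℂ} (hz : ‖z‖ < r) :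
    HasSum (fun k => rhsCoeff P₀ Q k y * z ^ k) (rhs P₀ Q y z) := by
  have hd : DifferentiableOn ℂ (rhs P₀ Q y) (Metric.ball 0 r) := fun x hx =>
    (hform.differentiableAt_right y (by simpa using hx)).differentiableWithinAt
  have := Complex.hasSum_taylorSeries_on_ball hd (z := z) (by simpa using hz)
  refine this.congr_fun fun k => ?_
  simp only [rhsCoeff, smul_eq_mul, sub_zero]
  ring

/-- Cauchy's estimate on the circle `|z| = r / 2`, uniformly for `y` in a disc. -/
lemma exists_bound_rhsCoeff (hform : IsNormalForm P₀ Q r) (Y : ℝ) :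
    ∃ M : ℝ, 0 < M ∧ ∀ y : ℂ, ‖y‖ ≤ Y → ∀ k, ‖rhsCoeff P₀ Q k y‖ ≤ M * (2 / r) ^ k := by
  have hr := hform.r_pos
  have hK : IsCompact (Metric.closedBall (0 : ℂ) Y ×ˢ Metric.closedBall (0 : ℂ) (r / 2)) :=
    (isCompact_closedBall _ _).prod (isCompact_closedBall _ _)
  obtain ⟨M, hM⟩ := hK.exists_bound_of_continuousOn
    (f := fun q : ℂ × ℂ => rhs P₀ Q q.1 q.2) (fun q hq => by
      refine (hform.differentiableAt q.1 (z := q.2) ?_).continuousAt.continuousWithinAt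
      have := hq.2
      rw [mem_closedBall_zero_iff] at this
      linarith)
  refine ⟨max M 1, by positivity, fun y hy k => ?_⟩
  have hd : DiffContOnCl ℂ (rhs P₀ Q y) (Metric.ball 0 (r / 2)) := by
    apply DifferentiableOn.diffContOnCl
    intro z hz
    refine (hform.differentiableAt_right y ?_).differentiableWithinAt
    have := Metric.closure_ball_subset_closedBall hz
    rw [mem_closedBall_zero_iff] at this
    linarith
  have h := Complex.norm_iteratedDeriv_le_of_forall_mem_sphere_norm_le k (by positivity) hd
    (C := max M 1) (fun z hz => (hM (y, z) ⟨by simpa using hy, Metric.sphere_subset_closedBall hz⟩).trans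
      (le_max_left _ _))
  rw [rhsCoeff, norm_div, div_le_iff₀ (by simp; positivity)]
  refine h.trans (le_of_eq ?_)
  have : ((k.factorial : ℂ)).re = k.factorial := by simp
  rw [Complex.norm_natCast, div_pow, div_pow]
  field_simp

lemma norm_rhs_sub_sum_le (hform : IsNormalForm P₀ Q r) (Y : ℝ) :
    ∃ M : ℝ, 0 < M ∧ ∀ y : ℂ, ‖y‖ ≤ Y → ∀ z : ℂ, ‖z‖ ≤ r / 4 → ∀ n,
      ‖rhs P₀ Q y z - ∑ k ∈ Finset.range n, rhsCoeff P₀ Q k y * z ^ k‖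
        ≤ M * (2 / r * ‖z‖) ^ n := by
  have hr := hform.r_pos
  obtain ⟨M, hM, h⟩ := exists_bound_rhsCoeff hform Y
  refine ⟨2 * M, by positivity, fun y hy z hz n => ?_⟩
  refine norm_sub_sum_le_of_hasSum (by positivity) (h y hy) ?_ (hasSum_rhsCoeff hform y ?_) n
  · rw [div_mul_eq_mul_div, div_le_iff₀ hr]; linarith
  · linarith

/-- By induction, `P_k` is the locally uniform limit of the Taylor remainders of order `k` divided
by `z ^ k`, along a sequence `z → 0`; such limits of entire functions are entire. -/
lemma differentiable_rhsCoeff (hform : IsNormalForm P₀ Q r) (k : ℕ) :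
    Differentiable ℂ (rhsCoeff P₀ Q k) := by
  have hr := hform.r_pos
  induction k using Nat.strong_induction_on with
  | _ k ih =>
    let z : ℕ → ℂ := fun n => ((r / 4 / ((n : ℝ) + 1) : ℝ) : ℂ)
    have hz0 : ∀ n, z n ≠ 0 := fun n => by
      simp only [z, ne_eq, Complex.ofReal_eq_zero]; positivity
    have hzn : ∀ n, ‖z n‖ = r / 4 / ((n : ℝ) + 1) := fun n => by
      simp only [z, Complex.norm_real]
      exact abs_of_pos (by positivity)
    have hz : ∀ n, ‖z n‖ ≤ r / 4 := fun n => by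
      rw [hzn]
      exact div_le_self (by positivity) (by linarith [n.cast_nonneg (α := ℝ)])
    have hlim : Tendsto (fun n => ‖z n‖) atTop (𝓝 0) := by
      simp only [hzn]
      exact tendsto_const_nhds.div_atTop
        (tendsto_atTop_add_const_right _ _ tendsto_natCast_atTop_atTop)
    have hT : TendstoLocallyUniformlyOn
        (fun n y => (rhs P₀ Q y (z n) - ∑ j ∈ Finset.range k, rhsCoeff P₀ Q j y * z n ^ j) / z n ^ k)
        (rhsCoeff P₀ Q k) atTop univ := by
      rw [tendstoLocallyUniformlyOn_iff_forall_isCompact isOpen_univ]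
      intro K _ hK
      obtain ⟨Y, hY⟩ := hK.isBounded.exists_norm_le
      obtain ⟨M, hM, h⟩ := norm_rhs_sub_sum_le hform Y
      rw [Metric.tendstoUniformlyOn_iff]
      intro ε hε
      have hl : Tendsto (fun n => M * (2 / r) ^ (k + 1) * ‖z n‖) atTop (𝓝 0) := by
        simpa using hlim.const_mul (M * (2 / r) ^ (k + 1))
      filter_upwards [hl.eventually_lt_const hε] with n hn y hy
      have h1 := h y (hY y hy) (z n) (hz n) (k + 1)
      rw [Finset.sum_range_succ] at h1
      rw [dist_comm, dist_eq_norm]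
      refine lt_of_le_of_lt ?_ hn
      have h2 : (rhs P₀ Q y (z n) - ∑ j ∈ Finset.range k, rhsCoeff P₀ Q j y * z n ^ j) / z n ^ k
          - rhsCoeff P₀ Q k y = (rhs P₀ Q y (z n) - (∑ j ∈ Finset.range k,
            rhsCoeff P₀ Q j y * z n ^ j + rhsCoeff P₀ Q k y * z n ^ k)) / z n ^ k := by
        field_simp [hz0 n]
        ring
      rw [h2, norm_div, norm_pow, div_le_iff₀ (by have := norm_pos_iff.2 (hz0 n); positivity)]
      refine h1.trans (le_of_eq ?_)
      rw [mul_pow]; ring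
    have hd := hT.differentiableOn (Eventually.of_forall fun n y _ => by
      refine DifferentiableAt.differentiableWithinAt ?_
      refine DifferentiableAt.div_const (DifferentiableAt.sub ?_ ?_) _
      · exact hform.differentiableAt_left y ((hz n).trans_lt (by linarith))
      · exact DifferentiableAt.fun_sum fun j hj =>
          ((ih j (Finset.mem_range.1 hj)) y).mul_const _) isOpen_univ
    exact fun y => hd.differentiableAt univ_mem

end Rhs

/-! ### Formal solutions on the universal cover -/

section FormalSolutions

/-- The sequence given by recursion over all earlier terms. -/
noncomputable def strongSeq {X : Type*} (next : (k : ℕ) → ((j : ℕ) → j < k → X) → X) (k : ℕ) : X :=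
  next k fun j _ => strongSeq next j

lemma eval_coe_ne_zero {P₀ : Polynomial ℂ} {E : Type*} {p : E → Punctured P₀} (w : E) :
    P₀.eval (p w : ℂ) ≠ 0 := (p w).2

/-- The recursion for the derivatives of the coefficients of a formal solution. -/
lemma deriv_eq_of_coeff {P₀ : Polynomial ℂ} {E : Type*} {p : E → Punctured P₀} {Q : ℂ → ℂ → ℂ}
    {r : ℝ} (hform : IsNormalForm P₀ Q r) {s : ℂ} {Φ dΦ : ℕ → E → ℂ} {k : ℕ} {w : E}
    (h : s + ∑ j ∈ Finset.range (k + 1), rhsCoeff P₀ Q (k - j) (p w) * dΦ j w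
      - ((k - 1 : ℕ) : ℂ) * Φ (k - 1) w = 0) :
    dΦ k w = (((k - 1 : ℕ) : ℂ) * Φ (k - 1) w - s
      - ∑ j ∈ Finset.range k, rhsCoeff P₀ Q (k - j) (p w) * dΦ j w) / P₀.eval (p w : ℂ) := by
  rw [Finset.sum_range_succ, Nat.sub_self, rhsCoeff_zero hform] at h
  rw [eq_div_iff (eval_coe_ne_zero w)]
  linear_combination h

variable {P₀ : Polynomial ℂ} {E : Type*} [TopologicalSpace E] {p : E → Punctured P₀}
  {Q : ℂ → ℂ → ℂ} {r : ℝ}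

/-- `∑ Φ_k(y) x ^ (-k)` satisfies the formal equation `D_x (∑ Φ_k(y) x ^ (-k)) = -∑ s_k x ^ (-k)`,
and `dΦ k` is the derivative of `Φ k`. -/
structure IsFormalSolution (Q : ℂ → ℂ → ℂ) (p : E → Punctured P₀) (s : ℕ → ℂ)
    (Φ dΦ : ℕ → E → ℂ) : Prop where
  hasDeriv : ∀ k w, HasCoverDerivAt p (Φ k) (dΦ k w) w
  coeff : ∀ k w, s k + ∑ j ∈ Finset.range (k + 1), rhsCoeff P₀ Q (k - j) (p w) * dΦ j w
    - ((k - 1 : ℕ) : ℂ) * Φ (k - 1) w = 0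

/-- The equation of order `k` determines `dΦ k` from earlier terms, since `P₀` has no zero on the
punctured plane. Simple connectedness gives a primitive, and its integration constant is free to
match `v k`. -/
lemma exists_isFormalSolution [SimplyConnectedSpace E] (hform : IsNormalForm P₀ Q r)
    (hp : IsCoveringMap p) (w₀ : E) (s v : ℕ → ℂ) :
    ∃ Φ dΦ : ℕ → E → ℂ, IsFormalSolution Q p s Φ dΦ ∧ ∀ k, Φ k w₀ = v k := by
  classical
  -- A primitive as a total function, with default `0`: the recursion can then be written down
  -- before the holomorphy of its terms is known.
  let prim : ℂ → (E → ℂ) → E → ℂ := fun c f =>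
    if h : ∃ Φ : E → ℂ, Φ w₀ = c ∧ ∀ w, HasCoverDerivAt p Φ (f w) w then h.choose else 0
  have hprim : ∀ c f, (∀ w, ∃ f', HasCoverDerivAt p f f' w) →
      prim c f w₀ = c ∧ ∀ w, HasCoverDerivAt p (prim c f) (f w) w := fun c f hf => by
    have h := exists_primitive hp hf w₀ c
    simp only [prim, dif_pos h]
    exact h.choose_spec
  let next : (k : ℕ) → ((j : ℕ) → j < k → (E → ℂ) × (E → ℂ)) → (E → ℂ) × (E → ℂ) := fun k prev =>
    -- For `k = 0` there is no earlier term; the default `0` agrees with the vanishing factor `k -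
    -- 1`.
    let d : E → ℂ := fun w => ((if h : k - 1 < k then ((k - 1 : ℕ) : ℂ) * (prev (k - 1) h).1 w else 0)
      - s k - ∑ j : Fin k, rhsCoeff P₀ Q (k - j) (p w) * (prev j j.2).2 w) / P₀.eval (p w : ℂ)
    (prim (v k) d, d)
  let u := strongSeq next
  have hu1 : ∀ k, (u k).1 = prim (v k) (u k).2 := fun k => by
    simp only [u]; rw [strongSeq]
  have hu2 : ∀ k w, (u k).2 w = (((k - 1 : ℕ) : ℂ) * (u (k - 1)).1 w - s k
      - ∑ j ∈ Finset.range k, rhsCoeff P₀ Q (k - j) (p w) * (u j).2 w) / P₀.eval (p w : ℂ) :=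
      fun k w => by
    simp only [u]; conv_lhs => rw [strongSeq]
    simp only [next]
    rw [Finset.sum_range (fun j => rhsCoeff P₀ Q (k - j) (p w) * (strongSeq next j).2 w)]
    rcases Nat.eq_zero_or_pos k with rfl | hk
    · simp
    · rw [dif_pos (by omega)]
  have hol : ∀ k w, ∃ f', HasCoverDerivAt p (u k).2 f' w := by
    intro k
    induction k using Nat.strong_induction_on with
    | _ k ih =>
      intro w
      have h1 : ∃ f', HasCoverDerivAt p (fun w => ((k - 1 : ℕ) : ℂ) * (u (k - 1)).1 w) f' w := by
        rcases Nat.eq_zero_or_pos k with rfl | hk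
        · exact ⟨0, by simpa using hasCoverDerivAt_const (0 : ℂ) w⟩
        · refine ⟨_, HasCoverDerivAt.const_mul hp (f' := (u (k - 1)).2 w) _ ?_⟩
          rw [hu1]
          exact (hprim _ _ (ih (k - 1) (by omega))).2 w
      have h2 : ∀ n, n ≤ k → ∃ f', HasCoverDerivAt p
          (fun w => ∑ j ∈ Finset.range n, rhsCoeff P₀ Q (k - j) (p w) * (u j).2 w) f' w := by
        intro n hn
        induction n with
        | zero => exact ⟨0, by simpa using hasCoverDerivAt_const (0 : ℂ) w⟩
        | succ n ihn =>
          obtain ⟨f', hf'⟩ := ihn (by omega)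
          obtain ⟨g', hg'⟩ := ih n (by omega) w
          simp only [Finset.sum_range_succ]
          exact ⟨_, hf'.add hp ((hasCoverDerivAt_comp_coe hp
            (differentiable_rhsCoeff hform _ _).hasDerivAt).mul hp hg')⟩
      obtain ⟨a, ha⟩ := h1
      obtain ⟨b, hb⟩ := h2 k le_rfl
      have hinv := hasCoverDerivAt_comp_coe hp
        ((P₀.differentiable (p w : ℂ)).hasDerivAt.fun_inv (eval_coe_ne_zero w))
      have := (((ha.sub hp (hasCoverDerivAt_const (s k) w)).sub hp hb).mul hp hinv)
      refine ⟨_, this.congr_of_eventuallyEq (Eventually.of_forall fun x => ?_)⟩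
      simp only [hu2 k x, div_eq_mul_inv]
  refine ⟨fun k => (u k).1, fun k => (u k).2, ⟨fun k w => ?_, fun k w => ?_⟩, fun k => ?_⟩
  · simp only [hu1 k]
    exact (hprim _ _ (hol k)).2 w
  · have h := hu2 k w
    rw [eq_div_iff (eval_coe_ne_zero w)] at h
    rw [Finset.sum_range_succ, Nat.sub_self, rhsCoeff_zero hform]
    linear_combination h
  · simp only [hu1 k]
    exact (hprim _ _ (hol k)).1

end FormalSolutions

/-! ### Convergence of formal solutions with source of order `1/x` -/

lemma forall_mem_of_local_propagation {X : Type*} [TopologicalSpace X] [PreconnectedSpace X]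
    {T : Set X} (h : ∀ w, ∃ V ∈ 𝓝 w, ∀ v ∈ V, v ∈ T → V ⊆ T) {w₀ : X} (h₀ : w₀ ∈ T) (w : X) :
    w ∈ T := by
  have hT : IsClopen T := by
    refine ⟨isClosed_of_closure_subset fun x hx => ?_, isOpen_iff_mem_nhds.2 fun x hx => ?_⟩
    · obtain ⟨V, hV, hVT⟩ := h x
      obtain ⟨v, hv, hvT⟩ := mem_closure_iff_nhds.1 hx V hV
      exact hVT v hv hvT (mem_of_mem_nhds hV)
    · obtain ⟨V, hV, hVT⟩ := h x
      exact mem_of_superset hV (hVT x (mem_of_mem_nhds hV) hx)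
  rw [hT.eq_univ ⟨w₀, h₀⟩]
  trivial

/-- Read from the top, the sum is dominated by a geometric one of ratio `α / c ≤ 1 / 2`. It controls
the convolution of the Taylor bounds with the inductive bounds. -/
lemma sum_pow_mul_pow_le {α c : ℝ} (hα : 0 ≤ α) (hc : 2 * α ≤ c) (k : ℕ) :
    (∑ j ∈ Finset.range k, α ^ (k - j) * c ^ j) * c ≤ 2 * α * c ^ k := by
  have hc0 : 0 ≤ c := by linarith
  induction k with
  | zero => simp; positivity
  | succ k ih =>
    have h1 : ∑ j ∈ Finset.range (k + 1), α ^ (k + 1 - j) * c ^ j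
        = α * (∑ j ∈ Finset.range k, α ^ (k - j) * c ^ j + c ^ k) := by
      rw [Finset.sum_range_succ, mul_add, Finset.mul_sum]
      congr 1
      · refine Finset.sum_congr rfl fun j hj => ?_
        have := Finset.mem_range.1 hj
        rw [show k + 1 - j = (k - j) + 1 by omega]; ring
      · simp
    rw [h1]
    have h2 : 0 ≤ c ^ k := by positivity
    calc α * (∑ j ∈ Finset.range k, α ^ (k - j) * c ^ j + c ^ k) * c
        = α * ((∑ j ∈ Finset.range k, α ^ (k - j) * c ^ j) * c + c * c ^ k) := by ring
      _ ≤ α * (2 * α * c ^ k + c * c ^ k) := by gcongr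
      _ ≤ α * (c * c ^ k + c * c ^ k) := by gcongr
      _ = _ := by ring

section Convergence

variable {P₀ : Polynomial ℂ} {E : Type*} [TopologicalSpace E] {p : E → Punctured P₀}
  {Q : ℂ → ℂ → ℂ} {r : ℝ}

/-- Integration along a segment in a chart. -/
lemma norm_le_of_chart_deriv_le {e : OpenPartialHomeomorph E ℂ} (he : ∀ v, e v = p v) {y₁ : ℂ}
    {r₀ : ℝ} (hb : Metric.ball y₁ r₀ ⊆ e.target) {f f' : E → ℂ}
    (hf : ∀ y ∈ Metric.ball y₁ r₀, HasCoverDerivAt p f (f' (e.symm y)) (e.symm y)) {y y₂ : ℂ}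
    (hy : y ∈ Metric.ball y₁ r₀) (hy₂ : y₂ ∈ Metric.ball y₁ r₀) {B B' : ℝ → ℝ}
    (h₂ : ‖f (e.symm y₂)‖ ≤ B 0) (hB : ∀ t, HasDerivAt B (B' t) t)
    (h' : ∀ x ∈ Metric.ball y₁ r₀, ‖f' (e.symm x)‖ ≤ B' ‖x - y₂‖) :
    ‖f (e.symm y)‖ ≤ B ‖y - y₂‖ := by
  let γ : ℝ → ℂ := fun t => y₂ + t * (y - y₂)
  have hγ : ∀ t ∈ Icc (0 : ℝ) 1, γ t ∈ Metric.ball y₁ r₀ := fun t ht => by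
    have := (convex_ball y₁ r₀).add_smul_sub_mem hy₂ hy ht
    simpa [γ] using this
  have hγd : ∀ t, HasDerivAt γ (y - y₂) t := fun t => by
    have := (Complex.ofRealCLM.hasDerivAt (x := t)).mul_const (y - y₂)
    simpa [γ] using this.const_add y₂
  have hd : ∀ t ∈ Icc (0 : ℝ) 1,
      HasDerivAt (fun t => f (e.symm (γ t))) (f' (e.symm (γ t)) * (y - y₂)) t := fun t ht =>
    HasDerivAt.comp t ((hasCoverDerivAt_iff_symm (hb (hγ t ht)) he).1 (hf _ (hγ t ht))) (hγd t)
  have := image_norm_le_of_norm_deriv_right_le_deriv_boundary (a := 0) (b := 1)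
    (f := fun t => f (e.symm (γ t))) (B := fun t => B (t * ‖y - y₂‖))
    (B' := fun t => B' (t * ‖y - y₂‖) * ‖y - y₂‖)
    (fun t ht => (hd t ht).continuousAt.continuousWithinAt)
    (fun t ht => (hd t ⟨ht.1, ht.2.le⟩).hasDerivWithinAt) (by simpa [γ] using h₂)
    (fun t => HasDerivAt.comp t (hB _) (hasDerivAt_mul_const _)) (fun t ht => by
      rw [norm_mul]
      refine mul_le_mul_of_nonneg_right ?_ (norm_nonneg _)
      have h := h' _ (hγ t ⟨ht.1, ht.2.le⟩)
      rwa [show γ t - y₂ = t * (y - y₂) by simp [γ], norm_mul, Complex.norm_real,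
        Real.norm_of_nonneg ht.1] at h) (right_mem_Icc.2 zero_le_one)
  simpa [γ] using this

/-- A geometric bound for a formal solution with source `x⁻¹` spreads from a point of a small disc
to the disc. -/
lemma IsFormalSolution.exists_nhds_bound (hform : IsNormalForm P₀ Q r) (hp : IsCoveringMap p)
    {s : ℕ → ℂ} (hs0 : s 0 = 0) (hs1 : ‖s 1‖ ≤ 1) (hs : ∀ k, 2 ≤ k → s k = 0)
    {Φ dΦ : ℕ → E → ℂ} (h : IsFormalSolution Q p s Φ dΦ) (w : E) :
    ∃ V ∈ 𝓝 w, ∀ v ∈ V, (∃ A : ℝ, ∀ k, ‖Φ k v‖ ≤ A ^ k) →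
      ∃ A : ℝ, 1 ≤ A ∧ ∀ x ∈ V, ∀ k, ‖Φ k x‖ ≤ A ^ k ∧ ‖dΦ k x‖ ≤ k * A ^ (k + 1) := by
  have hr := hform.r_pos
  set m : ℝ := ‖P₀.eval (p w : ℂ)‖ / 2 with hm
  have hm0 : 0 < m := by have := norm_pos_iff.2 (eval_coe_ne_zero (p := p) w); positivity
  have hU : {v | m < ‖P₀.eval (p v : ℂ)‖ ∧ ‖(p v : ℂ)‖ < ‖(p w : ℂ)‖ + 1} ∈ 𝓝 w := by
    have hc := continuous_coe hp
    refine (IsOpen.mem_nhds ?_ ?_)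
    · exact (isOpen_lt continuous_const (P₀.continuous.comp hc).norm).inter
        (isOpen_lt hc.norm continuous_const)
    · exact ⟨by rw [hm]; linarith, by linarith⟩
  obtain ⟨e, r₀, hr₀, hw, he, hb, hbU, hV⟩ := exists_ball_chart hp hU
  obtain ⟨M, hM, hMb⟩ := exists_bound_rhsCoeff hform (‖(p w : ℂ)‖ + 1)
  refine ⟨_, hV, ?_⟩
  rintro _ ⟨y₂, hy₂, rfl⟩ ⟨A₂, hA₂⟩
  set α := 2 / r with hα
  have hα0 : 0 < α := by positivity
  -- `|A₂|` is the bound at the starting point; the last two conditions make the convolution with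
  -- earlier derivatives at most `k C ^ k`.
  obtain ⟨A, hA1, hA2, hA3, hA4⟩ : ∃ A : ℝ, 1 ≤ A ∧ |A₂| ≤ A ∧ 2 * α ≤ A ∧ 4 * M * α / m ≤ A :=
    ⟨max (max 1 |A₂|) (max (2 * α) (4 * M * α / m)), by simp, by simp, by simp, by simp⟩
  set K : ℝ := 2 / m with hK
  have hK0 : 0 < K := by positivity
  -- The base of the geometric bound grows linearly with the distance from `y₂`. The derivative of
  -- `c ^ k` is `k K c ^ (k - 1)`, exactly the bound that the recursion gives for `dΦ k`; `K = 2 /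
  -- m` accounts for two contributions of size `k C ^ k` divided by `P₀`.
  let c : ℝ → ℝ := fun t => A + K * t
  have hcA : ∀ t, 0 ≤ t → A ≤ c t := fun t ht => by simp only [c]; nlinarith
  have key : ∀ k, ∀ y ∈ Metric.ball (p w : ℂ) r₀, ‖Φ k (e.symm y)‖ ≤ c ‖y - y₂‖ ^ k ∧
      ‖dΦ k (e.symm y)‖ * c ‖y - y₂‖ ≤ k * K * c ‖y - y₂‖ ^ k := by
    intro k
    induction k using Nat.strong_induction_on with
    | _ k ih =>
      have hd : ∀ y ∈ Metric.ball (p w : ℂ) r₀,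
          ‖dΦ k (e.symm y)‖ * c ‖y - y₂‖ ≤ k * K * c ‖y - y₂‖ ^ k := by
        intro y hy
        have hPy := hbU y hy
        rw [deriv_eq_of_coeff hform (h.coeff k (e.symm y)), norm_div]
        set C := c ‖y - y₂‖ with hC
        have hCA : A ≤ C := hcA _ (norm_nonneg _)
        have hC0 : 0 < C := by linarith
        have h1 : ‖((k - 1 : ℕ) : ℂ) * Φ (k - 1) (e.symm y) - s k‖ * C ≤ k * C ^ k := by
          rcases Nat.lt_trichotomy k 1 with hk | rfl | hk
          · obtain rfl : k = 0 := by omega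
            simp [hs0]
          · simp only [Nat.sub_self, Nat.cast_zero, zero_mul, zero_sub, norm_neg, Nat.cast_one,
              one_mul, pow_one]
            nlinarith
          · rw [hs k hk, sub_zero, norm_mul, Complex.norm_natCast]
            have h2 := (ih (k - 1) (by omega) y hy).1
            obtain ⟨j, rfl⟩ : ∃ j, k = j + 1 := ⟨k - 1, by omega⟩
            simp only [Nat.add_sub_cancel] at h2 ⊢
            push_cast
            calc (j : ℝ) * ‖Φ j (e.symm y)‖ * C ≤ j * C ^ j * C := by gcongr
              _ = j * C ^ (j + 1) := by ring
              _ ≤ _ := by gcongr; linarith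
        have h2 : ‖∑ j ∈ Finset.range k, rhsCoeff P₀ Q (k - j) (p (e.symm y)) * dΦ j (e.symm y)‖ * C
            ≤ k * C ^ k := by
          calc ‖∑ j ∈ Finset.range k, rhsCoeff P₀ Q (k - j) (p (e.symm y)) * dΦ j (e.symm y)‖ * C
              ≤ (∑ j ∈ Finset.range k, M * K * k / C * (α ^ (k - j) * C ^ j)) * C := by
                refine mul_le_mul_of_nonneg_right (norm_sum_le_of_le _ fun j hj => ?_) hC0.le
                have hjk := Finset.mem_range.1 hj
                rw [norm_mul]
                have h3 := (ih j hjk y hy).2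
                have h4 : ‖dΦ j (e.symm y)‖ ≤ k * K * C ^ j / C := by
                  rw [le_div_iff₀ hC0]
                  refine h3.trans ?_
                  have : (j : ℝ) ≤ k := by exact_mod_cast hjk.le
                  gcongr
                calc _ ≤ (M * α ^ (k - j)) * (k * K * C ^ j / C) := by
                      gcongr; exact hMb _ hPy.2.le _
                  _ = _ := by ring
            _ = M * K * k / C * ((∑ j ∈ Finset.range k, α ^ (k - j) * C ^ j) * C) := by
                rw [← Finset.mul_sum]; ring
            _ ≤ M * K * k / C * (2 * α * C ^ k) := by
                exact mul_le_mul_of_nonneg_left (sum_pow_mul_pow_le hα0.le (hA3.trans hCA) k)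
                  (by positivity)
            _ = (4 * M * α / m) / C * (k * C ^ k) := by rw [hK]; ring
            _ ≤ 1 * (k * C ^ k) := by
                gcongr
                rw [div_le_one hC0]; exact hA4.trans hCA
            _ = _ := one_mul _
        rw [div_mul_eq_mul_div, div_le_iff₀ (hm0.trans hPy.1)]
        calc _ ≤ (‖((k - 1 : ℕ) : ℂ) * Φ (k - 1) (e.symm y) - s k‖ +
              ‖∑ j ∈ Finset.range k, rhsCoeff P₀ Q (k - j) (p (e.symm y)) * dΦ j (e.symm y)‖) * C := by
              gcongr; exact norm_sub_le _ _
          _ ≤ 2 * (k * C ^ k) := by linarith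
          _ = k * K * C ^ k * m := by rw [hK]; field_simp
          _ ≤ _ := by gcongr; exact hPy.1.le
      intro y hy
      refine ⟨?_, hd y hy⟩
      refine norm_le_of_chart_deriv_le he hb (fun y _ => h.hasDeriv k _) hy hy₂
        (B := fun t => c t ^ k) (B' := fun t => k * c t ^ (k - 1) * K) ?_ ?_ ?_
      · simp only [c, mul_zero, add_zero]
        refine (hA₂ k).trans ((le_abs_self _).trans ?_)
        rw [abs_pow]; gcongr
      · intro t
        have : HasDerivAt c K t := by
          simpa [c] using ((hasDerivAt_id t).const_mul K).const_add A
        exact this.fun_pow k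
      · intro x hx
        have h1 := hd x hx
        have hc0 : 0 < c ‖x - y₂‖ := by linarith [hcA _ (norm_nonneg (x - y₂))]
        refine le_of_mul_le_mul_right (h1.trans (le_of_eq ?_)) hc0
        rcases k with _ | k
        · simp
        · simp only [Nat.add_sub_cancel]; ring
  refine ⟨max (A + K * (2 * r₀)) K, le_max_of_le_left (by nlinarith), ?_⟩
  rintro _ ⟨y, hy, rfl⟩ k
  obtain ⟨k1, k2⟩ := key k y hy
  have hdist : ‖y - y₂‖ ≤ 2 * r₀ := by
    rw [← dist_eq_norm]
    linarith [dist_triangle_right y y₂ (p w : ℂ), Metric.mem_ball.1 hy, Metric.mem_ball.1 hy₂]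
  have hcA' := hcA _ (norm_nonneg (y - y₂))
  have hc1 : c ‖y - y₂‖ ≤ max (A + K * (2 * r₀)) K := le_max_of_le_left (by
    simp only [c]; gcongr)
  have hc0 : 0 ≤ c ‖y - y₂‖ := by linarith
  refine ⟨k1.trans (by gcongr), ?_⟩
  calc ‖dΦ k (e.symm y)‖ ≤ ‖dΦ k (e.symm y)‖ * c ‖y - y₂‖ :=
        le_mul_of_one_le_right (norm_nonneg _) (by linarith)
    _ ≤ k * (K * c ‖y - y₂‖ ^ k) := by rw [← mul_assoc]; exact k2
    _ ≤ k * (max (A + K * (2 * r₀)) K * max (A + K * (2 * r₀)) K ^ k) := by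
        gcongr; exact le_max_right _ _
    _ = _ := by rw [pow_succ']

/-- All coefficients vanish at `w₀`, and the existence of some geometric bound is an open and closed
condition. The base `A` may deteriorate from place to place. -/
lemma IsFormalSolution.exists_local_bound [PreconnectedSpace E] (hform : IsNormalForm P₀ Q r)
    (hp : IsCoveringMap p) {s : ℕ → ℂ} (hs0 : s 0 = 0) (hs1 : ‖s 1‖ ≤ 1)
    (hs : ∀ k, 2 ≤ k → s k = 0) {Φ dΦ : ℕ → E → ℂ} (h : IsFormalSolution Q p s Φ dΦ) {w₀ : E}
    (h₀ : ∀ k, Φ k w₀ = 0) (w : E) :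
    ∃ V ∈ 𝓝 w, ∃ A : ℝ, 1 ≤ A ∧ ∀ x ∈ V, ∀ k, ‖Φ k x‖ ≤ A ^ k ∧ ‖dΦ k x‖ ≤ k * A ^ (k + 1) := by
  have hT : w ∈ {w | ∃ A : ℝ, ∀ k, ‖Φ k w‖ ≤ A ^ k} := by
    refine forall_mem_of_local_propagation (T := {w | ∃ A : ℝ, ∀ k, ‖Φ k w‖ ≤ A ^ k})
      (fun x => ?_) (w₀ := w₀) ⟨1, fun k => by simp [h₀]⟩ w
    obtain ⟨V, hV, hVb⟩ := h.exists_nhds_bound hform hp hs0 hs1 hs x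
    refine ⟨V, hV, fun v hv hvT x hx => ?_⟩
    obtain ⟨A, -, hA⟩ := hVb v hv hvT
    exact ⟨A, fun k => (hA x hx k).1⟩
  obtain ⟨V, hV, hVb⟩ := h.exists_nhds_bound hform hp hs0 hs1 hs w
  exact ⟨V, hV, hVb w (mem_of_mem_nhds hV) hT⟩

end Convergence

/-! ### Partial derivatives in `(log x, y)` -/

section Partials

variable {P₀ : Polynomial ℂ} {E : Type*} [TopologicalSpace E] {p : E → Punctured P₀}

/-- `u` is differentiable at `q`, with partial derivatives `a` in the first variable and `b` with
respect to `y`. -/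
def HasPD (p : E → Punctured P₀) (u : ℂ × E → ℂ) (a b : ℂ) (q : ℂ × E) : Prop :=
  (fun v : ℂ × E => u v - u q - a * (v.1 - q.1) - b * ((p v.2 : ℂ) - (p q.2 : ℂ)))
    =o[𝓝 q] fun v : ℂ × E => (v.1 - q.1, (p v.2 : ℂ) - (p q.2 : ℂ))

lemma hasPD_iff {u : ℂ × E → ℂ} {a b : ℂ} {q : ℂ × E} {e : OpenPartialHomeomorph E ℂ}
    (hw : q.2 ∈ e.source) (he : ∀ v, e v = p v) :
    HasPD p u a b q ↔ HasFDerivAt (fun x : ℂ × ℂ => u (x.1, e.symm x.2))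
      (a • ContinuousLinearMap.fst ℂ ℂ ℂ + b • ContinuousLinearMap.snd ℂ ℂ ℂ) (q.1, (p q.2 : ℂ)) := by
  have hmap : map (fun v : ℂ × E => (v.1, e v.2)) (𝓝 q) = 𝓝 (q.1, e q.2) := by
    have h1 := Filter.prod_map_map_eq' (id : ℂ → ℂ) e (𝓝 q.1) (𝓝 q.2)
    rw [e.map_nhds_eq hw, Filter.map_id, ← nhds_prod_eq, ← nhds_prod_eq] at h1
    exact h1.symm
  rw [hasFDerivAt_iff_isLittleO, HasPD, ← he q.2, ← hmap, Asymptotics.isLittleO_map]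
  refine Asymptotics.isLittleO_congr ?_ ?_
  · have : ∀ᶠ v : ℂ × E in 𝓝 q, v.2 ∈ e.source :=
      continuous_snd.continuousAt.eventually (e.open_source.mem_nhds hw)
    filter_upwards [this] with v hv
    simp only [Function.comp_apply, e.left_inv hv, e.left_inv hw, smul_eq_mul, ← he,
      add_apply, smul_apply,
      ContinuousLinearMap.coe_fst', ContinuousLinearMap.coe_snd', Prod.mk_sub_mk]
    ring
  · filter_upwards with v
    simp [he]

lemma HasPD.congr_of_eventuallyEq {u₁ u₂ : ℂ × E → ℂ} {a b : ℂ} {q : ℂ × E}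
    (h : HasPD p u₁ a b q) (hf : u₂ =ᶠ[𝓝 q] u₁) : HasPD p u₂ a b q := by
  refine h.congr' ?_ (EventuallyEq.refl _ _)
  filter_upwards [hf] with v hv
  rw [hv, hf.self_of_nhds]

lemma HasPD.add {u₁ u₂ : ℂ × E → ℂ} {a₁ b₁ a₂ b₂ : ℂ} {q : ℂ × E} (h₁ : HasPD p u₁ a₁ b₁ q)
    (h₂ : HasPD p u₂ a₂ b₂ q) : HasPD p (fun v => u₁ v + u₂ v) (a₁ + a₂) (b₁ + b₂) q := by
  have := Asymptotics.IsLittleO.add h₁ h₂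
  refine this.congr_left fun v => ?_
  ring

lemma hasPD_fst (q : ℂ × E) : HasPD p (fun v => v.1) 1 0 q := by
  simp [HasPD]

lemma HasPD.of_snd {f : E → ℂ} {f' : ℂ} {q : ℂ × E} (h : HasCoverDerivAt p f f' q.2) :
    HasPD p (fun v => f v.2) 0 f' q := by
  have h1 := Asymptotics.IsLittleO.comp_tendsto h (continuous_snd.tendsto q)
  have h2 : (fun v : ℂ × E => (p v.2 : ℂ) - (p q.2 : ℂ))
      =O[𝓝 q] fun v : ℂ × E => (v.1 - q.1, (p v.2 : ℂ) - (p q.2 : ℂ)) :=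
    Asymptotics.isBigO_snd_prod
  refine (h1.trans_isBigO h2).congr_left fun v => ?_
  simp

lemma HasPD.comp_left (hp : IsCoveringMap p) {u : ℂ × E → ℂ} {a b : ℂ} {φ : ℂ → ℂ} {φ' ξ : ℂ}
    {w : E} (h : HasPD p u a b (φ ξ, w)) (hφ : HasDerivAt φ φ' ξ) :
    HasPD p (fun v => u (φ v.1, v.2)) (a * φ') b (ξ, w) := by
  obtain ⟨e, hw, he⟩ := exists_chart hp w
  rw [hasPD_iff (q := (_, w)) hw he] at h ⊢
  have h1 : HasFDerivAt (fun x : ℂ × ℂ => (φ x.1, x.2))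
      ((φ' • ContinuousLinearMap.fst ℂ ℂ ℂ).prod (ContinuousLinearMap.snd ℂ ℂ ℂ)) (ξ, (p w : ℂ)) := by
    refine HasFDerivAt.prodMk ?_ hasFDerivAt_snd
    exact hφ.comp_hasFDerivAt (ξ, (p w : ℂ)) hasFDerivAt_fst
  have h2 := HasFDerivAt.comp (ξ, (p w : ℂ)) h h1
  refine h2.congr_fderiv ?_
  ext <;> simp

lemma HasPD.comp_deriv (hp : IsCoveringMap p) {u : ℂ × E → ℂ} {a b : ℂ} {h : ℂ → ℂ} {h' : ℂ}
    {q : ℂ × E} (hh : HasDerivAt h h' (u q)) (hu : HasPD p u a b q) :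
    HasPD p (fun v => h (u v)) (h' * a) (h' * b) q := by
  obtain ⟨e, hw, he⟩ := exists_chart hp q.2
  rw [hasPD_iff hw he] at hu ⊢
  have h1 : HasDerivAt h h' (u (q.1, e.symm (p q.2))) := by
    rwa [← he, e.left_inv hw]
  have h2 := h1.comp_hasFDerivAt (q.1, (p q.2 : ℂ)) hu
  refine h2.congr_fderiv ?_
  ext <;> simp

lemma HasPD.hasDerivAt (hp : IsCoveringMap p) {u : ℂ × E → ℂ} {a b ξ : ℂ} {w : E}
    (h : HasPD p u a b (ξ, w)) : HasDerivAt (fun x => u (x, w)) a ξ := by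
  obtain ⟨e, hw, he⟩ := exists_chart hp w
  rw [hasPD_iff (q := (_, w)) hw he] at h
  have h1 : HasFDerivAt (fun x : ℂ => (x, (p w : ℂ))) (ContinuousLinearMap.inl ℂ ℂ ℂ) ξ :=
    hasFDerivAt_prodMk_left ξ _
  have h2 := (HasFDerivAt.comp ξ h h1).hasDerivAt
  simp only [Function.comp_def, ← he, e.left_inv hw] at h2
  simpa using h2

lemma HasPD.hasCoverDerivAt (hp : IsCoveringMap p) {u : ℂ × E → ℂ} {a b ξ : ℂ} {w : E}
    (h : HasPD p u a b (ξ, w)) : HasCoverDerivAt p (fun v => u (ξ, v)) b w := by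
  obtain ⟨e, hw, he⟩ := exists_chart hp w
  rw [hasPD_iff (q := (_, w)) hw he] at h
  rw [hasCoverDerivAt_iff hw he]
  have h1 : HasFDerivAt (fun x : ℂ => (ξ, x)) (ContinuousLinearMap.inr ℂ ℂ ℂ) (p w : ℂ) :=
    hasFDerivAt_prodMk_right ξ _
  have h2 := (HasFDerivAt.comp (p w : ℂ) h h1).hasDerivAt
  simpa [Function.comp_def] using h2

/-- The exponential has nonzero derivative, so small increments of `log x` and of `x` are
comparable. -/
lemma HasPD.hasPartialsAt {u : ℂ × E → ℂ} {a b : ℂ} {q : ℂ × E}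
    (h : HasPD p u a b q) : HasPartialsAt p u (a / Complex.exp q.1) b q := by
  have hexp : (fun v : ℂ × E => Complex.exp v.1 - Complex.exp q.1 - Complex.exp q.1 * (v.1 - q.1))
      =o[𝓝 q] fun v : ℂ × E => v.1 - q.1 := by
    have := (hasDerivAt_iff_isLittleO.1 (Complex.hasDerivAt_exp q.1)).comp_tendsto
      (continuous_fst.tendsto q)
    refine this.congr_left fun v => ?_
    simp [mul_comm]
  have hO : (fun v : ℂ × E => v.1 - q.1) =O[𝓝 q]
      fun v : ℂ × E => Complex.exp v.1 - Complex.exp q.1 := by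
    have h1 := (hexp.const_mul_right (Complex.exp_ne_zero q.1)).right_isBigO_add
    refine ((h1.const_mul_left (Complex.exp q.1)⁻¹).congr_left fun v => ?_).congr_right fun v => ?_
    · rw [← mul_assoc, inv_mul_cancel₀ (Complex.exp_ne_zero _), one_mul]
    · ring
  have hprod : (fun v : ℂ × E => (v.1 - q.1, (p v.2 : ℂ) - (p q.2 : ℂ))) =O[𝓝 q]
      fun v : ℂ × E => (Complex.exp v.1 - Complex.exp q.1, (p v.2 : ℂ) - (p q.2 : ℂ)) :=
    (hO.trans Asymptotics.isBigO_fst_prod).prod_left Asymptotics.isBigO_snd_prod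
  have h1 := h.trans_isBigO hprod
  have h2 := ((hexp.trans_isBigO hO).trans_isBigO (Asymptotics.isBigO_fst_prod
    (g' := fun v : ℂ × E => (p v.2 : ℂ) - (p q.2 : ℂ)))).const_mul_left (a / Complex.exp q.1)
  refine (h1.sub h2).congr_left fun v => ?_
  have := Complex.exp_ne_zero q.1
  field_simp
  ring

end Partials

/-! ### The clock as a convergent first integral -/

section Clock

variable {P₀ : Polynomial ℂ} {E : Type*} [TopologicalSpace E] {p : E → Punctured P₀}
  {Q : ℂ → ℂ → ℂ} {r : ℝ}

/-- The sum of the power series in `z` with coefficients `Φ k w`. -/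
noncomputable def seriesSum (Φ : ℕ → E → ℂ) (z : ℂ) (w : E) : ℂ := ∑' k, Φ k w * z ^ k

lemma summable_mul_half_pow (K : ℝ) : Summable fun k : ℕ => K * (k * (1 / 2 : ℝ) ^ k) := by
  have := summable_pow_mul_geometric_of_norm_lt_one 1 (r := (1 / 2 : ℝ)) (by norm_num)
  simpa using this.mul_left K

lemma norm_coeff_mul_pow_le {c z : ℂ} {A K : ℝ} {k : ℕ} (hA : 0 ≤ A) (hK : 0 ≤ K)
    (hc : ‖c‖ ≤ K * A ^ k) (hz : A * ‖z‖ ≤ 1 / 2) : ‖c * z ^ k‖ ≤ K * (1 / 2) ^ k := by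
  rw [norm_mul, norm_pow]
  calc ‖c‖ * ‖z‖ ^ k ≤ K * A ^ k * ‖z‖ ^ k := by gcongr
    _ = K * (A * ‖z‖) ^ k := by rw [mul_pow]; ring
    _ ≤ _ := by gcongr

lemma summable_norm_coeff_mul_pow {c : ℕ → ℂ} {z : ℂ} {A K : ℝ} (hA : 0 ≤ A) (hK : 0 ≤ K)
    (hc : ∀ k, ‖c k‖ ≤ K * A ^ k) (hz : A * ‖z‖ ≤ 1 / 2) : Summable fun k => ‖c k * z ^ k‖ :=
  Summable.of_nonneg_of_le (fun _ => norm_nonneg _)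
    (fun k => norm_coeff_mul_pow_le hA hK (hc k) hz)
    ((summable_geometric_of_lt_one (by norm_num) (by norm_num : (1 / 2 : ℝ) < 1)).mul_left K)

lemma norm_natCast_mul_coeff_mul_pow_le {c z : ℂ} {A : ℝ} {k : ℕ} (hA : 1 ≤ A)
    (hc : ‖c‖ ≤ A ^ k) (hz : A * ‖z‖ ≤ 1 / 2) :
    ‖(k : ℂ) * c * z ^ (k - 1)‖ ≤ 2 * A * (k * (1 / 2) ^ k) := by
  rcases k with _ | k
  · simp
  · rw [norm_mul, norm_mul, norm_pow, Complex.norm_natCast, Nat.add_sub_cancel]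
    calc ((k + 1 : ℕ) : ℝ) * ‖c‖ * ‖z‖ ^ k ≤ (k + 1 : ℕ) * A ^ (k + 1) * ‖z‖ ^ k := by gcongr
      _ = (k + 1 : ℕ) * (A * (A * ‖z‖) ^ k) := by rw [mul_pow]; ring
      _ ≤ (k + 1 : ℕ) * (A * (1 / 2) ^ k) := by gcongr
      _ = _ := by rw [pow_succ]; ring

/-- For `|z| < 1 / (2 A)` both families of differentiated terms are dominated by multiples of `k 2 ^
(-k)`, so the series may be differentiated term by term. -/
lemma hasPD_seriesSum (hp : IsCoveringMap p) {Φ dΦ : ℕ → E → ℂ}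
    (hd : ∀ k w, HasCoverDerivAt p (Φ k) (dΦ k w) w) {V : Set E} {A : ℝ} (hA : 1 ≤ A)
    (hb : ∀ x ∈ V, ∀ k, ‖Φ k x‖ ≤ A ^ k ∧ ‖dΦ k x‖ ≤ k * A ^ (k + 1)) {w : E} (hw : V ∈ 𝓝 w)
    {z : ℂ} (hz : ‖z‖ < 1 / (2 * A)) :
    HasPD p (fun q => seriesSum Φ q.1 q.2) (∑' k : ℕ, k * Φ k w * z ^ (k - 1))
      (∑' k, dΦ k w * z ^ k) (z, w) := by
  obtain ⟨e, r₀, hr₀, hwe, he, hbe, hbV, -⟩ := exists_ball_chart hp hw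
  rw [hasPD_iff (q := (z, w)) hwe he]
  set S : Set (ℂ × ℂ) := Metric.ball 0 (1 / (2 * A)) ×ˢ Metric.ball (p w : ℂ) r₀ with hS
  let f' : ℕ → ℂ × ℂ → (ℂ × ℂ →L[ℂ] ℂ) := fun k x =>
    (k * Φ k (e.symm x.2) * x.1 ^ (k - 1)) • ContinuousLinearMap.fst ℂ ℂ ℂ
      + (dΦ k (e.symm x.2) * x.1 ^ k) • ContinuousLinearMap.snd ℂ ℂ ℂ
  have hAz : ∀ x : ℂ, ‖x‖ < 1 / (2 * A) → A * ‖x‖ ≤ 1 / 2 := fun x hx => by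
    rw [lt_div_iff₀ (by positivity)] at hx; linarith
  have hn1 : ∀ k : ℕ, ∀ x ∈ S, ‖(k : ℂ) * Φ k (e.symm x.2) * x.1 ^ (k - 1)‖
      ≤ 2 * A * (k * (1 / 2) ^ k) := fun k x hx =>
    norm_natCast_mul_coeff_mul_pow_le hA (hb _ (hbV _ hx.2) k).1 (hAz _ (by simpa using hx.1))
  have hn2 : ∀ k : ℕ, ∀ x ∈ S, ‖dΦ k (e.symm x.2) * x.1 ^ k‖ ≤ 2 * A * (k * (1 / 2) ^ k) :=
      fun k x hx => by
    have := norm_coeff_mul_pow_le (K := k * A) (by positivity) (by positivity)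
      ((hb _ (hbV _ hx.2) k).2.trans (le_of_eq (by ring))) (hAz _ (by simpa using hx.1))
    refine this.trans ?_
    have h0 : 0 ≤ A * (k * (1 / 2 : ℝ) ^ k) := by positivity
    linarith
  have hmem : (z, (p w : ℂ)) ∈ S := ⟨by simpa using hz, Metric.mem_ball_self hr₀⟩
  have hsymm : e.symm (p w : ℂ) = w := by rw [← he, e.left_inv hwe]
  have hsumm := summable_mul_half_pow (2 * A)
  have key := hasFDerivAt_tsum_of_isPreconnected
    (f := fun k (x : ℂ × ℂ) => Φ k (e.symm x.2) * x.1 ^ k) (f' := f')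
    (u := fun k : ℕ => 2 * A * (k * (1 / 2 : ℝ) ^ k) + 2 * A * (k * (1 / 2 : ℝ) ^ k))
    (hsumm.add hsumm) (Metric.isOpen_ball.prod Metric.isOpen_ball)
    ((convex_ball (0 : ℂ) (1 / (2 * A))).prod (convex_ball (p w : ℂ) r₀)).isPreconnected
    (fun k x hx => by
      have h1 := (hasCoverDerivAt_iff_symm (hbe hx.2) he).1 (hd k (e.symm x.2))
      have h2 := h1.comp_hasFDerivAt x (hasFDerivAt_snd (𝕜 := ℂ) (p := x))
      have h3 := (hasDerivAt_pow k x.1).comp_hasFDerivAt x (hasFDerivAt_fst (𝕜 := ℂ) (p := x))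
      refine (h2.mul h3).congr_fderiv ?_
      ext <;> simp [f'] <;> ring)
    (fun k x hx => by
      refine (norm_add_le _ _).trans (add_le_add ?_ ?_)
      · rw [norm_smul]
        exact (mul_le_of_le_one_right (norm_nonneg _)
          (ContinuousLinearMap.norm_fst_le ℂ ℂ ℂ)).trans (hn1 k x hx)
      · rw [norm_smul]
        exact (mul_le_of_le_one_right (norm_nonneg _)
          (ContinuousLinearMap.norm_snd_le ℂ ℂ ℂ)).trans (hn2 k x hx))
    hmem (by
      refine Summable.of_norm (summable_norm_coeff_mul_pow (A := A) (K := 1) (by positivity)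
        zero_le_one (fun k => ?_) (hAz z hz))
      rw [one_mul]; exact (hb _ (hbV _ hmem.2) k).1) hmem
  refine key.congr_fderiv ?_
  have hs1 : Summable fun k : ℕ => (k : ℂ) * Φ k w * z ^ (k - 1) :=
    Summable.of_norm_bounded hsumm fun k => by simpa [hsymm] using hn1 k _ hmem
  have hs2 : Summable fun k : ℕ => dΦ k w * z ^ k :=
    Summable.of_norm_bounded hsumm fun k => by simpa [hsymm] using hn2 k _ hmem
  have h1 := (hs1.hasSum.smul_const (ContinuousLinearMap.fst ℂ ℂ ℂ)).add
    (hs2.hasSum.smul_const (ContinuousLinearMap.snd ℂ ℂ ℂ))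
  simp only [f', hsymm]
  exact h1.tsum_eq

/-- The function `log x + ∑ Φ_k(y) x ^ (-k)`, with `ξ = log x`. -/
noncomputable def clock (Φ : ℕ → E → ℂ) (ξ : ℂ) (w : E) : ℂ := ξ + seriesSum Φ (Complex.exp (-ξ)) w

/-- If `∑ Φ_k(y) x ^ (-k)` solves the formal equation with source `x⁻¹` and converges, then
`log x + ∑ Φ_k(y) x ^ (-k)` is a first integral. -/
lemma IsFormalSolution.clock_relation (hform : IsNormalForm P₀ Q r) {Φ dΦ : ℕ → E → ℂ}
    (h : IsFormalSolution Q p (Pi.single 1 1) Φ dΦ) {w : E} {A : ℝ} (hA : 1 ≤ A)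
    (hb : ∀ k, ‖Φ k w‖ ≤ A ^ k ∧ ‖dΦ k w‖ ≤ k * A ^ (k + 1))
    {z : ℂ} (hz : ‖z‖ < 1 / (2 * A)) (hzr : ‖z‖ ≤ r / 4) :
    z * (1 - z * ∑' k : ℕ, k * Φ k w * z ^ (k - 1))
      + rhs P₀ Q (p w) z * ∑' k, dΦ k w * z ^ k = 0 := by
  have hr := hform.r_pos
  have hAz : A * ‖z‖ ≤ 1 / 2 := by rw [lt_div_iff₀ (by positivity)] at hz; linarith
  obtain ⟨M, hM, hMb⟩ := exists_bound_rhsCoeff hform ‖(p w : ℂ)‖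
  have hsP : Summable fun k => ‖rhsCoeff P₀ Q k (p w) * z ^ k‖ := by
    refine summable_norm_coeff_mul_pow (by positivity) hM.le (hMb _ le_rfl) ?_
    rw [div_mul_eq_mul_div, div_le_iff₀ hr]; linarith
  have hsd : Summable fun k => ‖dΦ k w * z ^ k‖ := by
    refine Summable.of_nonneg_of_le (fun _ => norm_nonneg _) (fun k => ?_) (summable_mul_half_pow A)
    have := norm_coeff_mul_pow_le (K := k * A) (by positivity) (by positivity)
      ((hb k).2.trans (le_of_eq (by ring))) hAz
    linarith
  have hs1 : Summable fun k : ℕ => (k : ℂ) * Φ k w * z ^ (k - 1) :=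
    Summable.of_norm_bounded (summable_mul_half_pow (2 * A)) fun k =>
      norm_natCast_mul_coeff_mul_pow_le hA (hb k).1 hAz
  -- The coefficients of this Cauchy product are the sums in the formal equation, which can
  -- therefore be summed order by order.
  have hmul := tsum_mul_tsum_eq_tsum_sum_range_of_summable_norm hsd hsP
  rw [(hasSum_rhsCoeff hform (p w) (by linarith : ‖z‖ < r)).tsum_eq] at hmul
  have hterm : ∀ n, ∑ k ∈ Finset.range (n + 1), dΦ k w * z ^ k *
      (rhsCoeff P₀ Q (n - k) (p w) * z ^ (n - k))
      = ((n - 1 : ℕ) : ℂ) * Φ (n - 1) w * z ^ n - (Pi.single 1 1 : ℕ → ℂ) n * z ^ n := fun n => by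
    have h1 := h.coeff n w
    have h2 : ∑ k ∈ Finset.range (n + 1), dΦ k w * z ^ k *
        (rhsCoeff P₀ Q (n - k) (p w) * z ^ (n - k))
        = (∑ j ∈ Finset.range (n + 1), rhsCoeff P₀ Q (n - j) (p w) * dΦ j w) * z ^ n := by
      rw [Finset.sum_mul]
      refine Finset.sum_congr rfl fun k hk => ?_
      have hk' := Finset.mem_range.1 hk
      have : z ^ n = z ^ k * z ^ (n - k) := by rw [← pow_add]; congr 1; omega
      rw [this]; ring
    rw [h2]
    linear_combination z ^ n * h1
  have hS1 : HasSum (fun n : ℕ => ((n - 1 : ℕ) : ℂ) * Φ (n - 1) w * z ^ n)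
      (z ^ 2 * ∑' k : ℕ, k * Φ k w * z ^ (k - 1)) := by
    rw [← hasSum_nat_add_iff' 1]
    simp only [Finset.range_one, Finset.sum_singleton, zero_tsub, Nat.cast_zero, zero_mul, sub_zero,
      Nat.add_sub_cancel]
    refine (hs1.hasSum.mul_left (z ^ 2)).congr_fun fun k => ?_
    rcases k with _ | k
    · simp
    · simp only [Nat.add_sub_cancel]; ring
  have hS2 : HasSum (fun n : ℕ => (Pi.single 1 1 : ℕ → ℂ) n * z ^ n) z := by
    have := hasSum_single (f := fun n : ℕ => (Pi.single 1 1 : ℕ → ℂ) n * z ^ n) 1 (fun n hn => by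
      simp [Pi.single_eq_of_ne hn])
    simpa using this
  rw [tsum_congr hterm, (hS1.sub hS2).tsum_eq] at hmul
  linear_combination hmul

end Clock

/-! ### Propagation of flatness over the covering surface -/

section Propagation

variable {P₀ : Polynomial ℂ} {E : Type*} [TopologicalSpace E] {p : E → Punctured P₀}
  {Q : ℂ → ℂ → ℂ} {r : ℝ}

lemma norm_exp_neg (ξ : ℂ) : ‖Complex.exp (-ξ)‖ = Real.exp (-ξ.re) := by
  rw [Complex.norm_exp, Complex.neg_re]

/-- At `z = 0` the right-hand side is `P₀(y) ≠ 0`; the rest is continuity. -/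
lemma exists_rhs_lower_bound (hform : IsNormalForm P₀ Q r) (hp : IsCoveringMap p) (w : E) :
    ∃ V ∈ 𝓝 w, ∃ m : ℝ, 0 < m ∧ ∃ ρ : ℝ, ∀ v ∈ V, ∀ ξ : ℂ, ρ < ξ.re →
      m ≤ ‖rhs P₀ Q (p v) (Complex.exp (-ξ))‖ := by
  have hc := (hform.differentiableAt (p w : ℂ) (z := 0) (by simpa using hform.r_pos)).continuousAt
  have h0 : rhs P₀ Q (p w) 0 ≠ 0 := by
    simpa [rhs, hform.vanish] using eval_coe_ne_zero (p := p) w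
  have h1 : ∀ᶠ q : ℂ × ℂ in 𝓝 ((p w : ℂ), 0), ‖rhs P₀ Q (p w) 0‖ / 2 < ‖rhs P₀ Q q.1 q.2‖ :=
    hc.norm.eventually_const_lt (by have := norm_pos_iff.2 h0; simpa using this)
  rw [nhds_prod_eq, eventually_prod_iff] at h1
  obtain ⟨pa, hpa, pb, hpb, h⟩ := h1
  obtain ⟨δ, hδ, hb⟩ := Metric.eventually_nhds_iff.1 hpb
  refine ⟨_, (continuous_coe hp).continuousAt.eventually hpa, ‖rhs P₀ Q (p w) 0‖ / 2,
    by have := norm_pos_iff.2 h0; positivity, -Real.log δ, fun v hv ξ hξ => ?_⟩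
  refine (h hv (hb ?_)).le
  rw [dist_zero_right, norm_exp_neg, ← Real.lt_log_iff_exp_lt hδ]
  linarith

/-- An approximate first integral that is flat of order `n` at one point of the covering surface is
locally uniformly flat of order `n`. -/
lemma exists_flat_nhds [PreconnectedSpace E] (hform : IsNormalForm P₀ Q r)
    (hp : IsCoveringMap p) {d : ℂ → E → ℂ} {n : ℕ}
    (hloc : ∀ w, ∃ V ∈ 𝓝 w, ∃ ρ M : ℝ, ∀ v ∈ V, ∀ ξ : ℂ, ρ < ξ.re → ‖d ξ v‖ ≤ M ∧
      ∃ a b, HasPD p (fun q => d q.1 q.2) a b (ξ, v) ∧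
        ‖Complex.exp (-ξ) * a + rhs P₀ Q (p v) (Complex.exp (-ξ)) * b‖ ≤ M * Real.exp (-ξ.re) ^ n)
    {w₀ : E} (h₀ : ∃ ρ M : ℝ, ∀ ξ : ℂ, ρ < ξ.re → ‖d ξ w₀‖ ≤ M * Real.exp (-ξ.re) ^ n) (w : E) :
    ∃ V ∈ 𝓝 w, ∃ ρ M : ℝ, ∀ v ∈ V, ∀ ξ : ℂ, ρ < ξ.re → ‖d ξ v‖ ≤ M * Real.exp (-ξ.re) ^ n := by
  have hlocal : ∀ w, ∃ V ∈ 𝓝 w, ∀ v ∈ V,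
      (∃ ρ M : ℝ, ∀ ξ : ℂ, ρ < ξ.re → ‖d ξ v‖ ≤ M * Real.exp (-ξ.re) ^ n) →
      ∃ ρ M : ℝ, ∀ x ∈ V, ∀ ξ : ℂ, ρ < ξ.re → ‖d ξ x‖ ≤ M * Real.exp (-ξ.re) ^ n := by
    intro w
    obtain ⟨V₁, hV₁, ρ₁, M₁, h₁⟩ := hloc w
    obtain ⟨V₂, hV₂, m, hm, ρ₂, h₂⟩ := exists_rhs_lower_bound hform hp w
    obtain ⟨e, r₀, hr₀, hw, he, hb, hbV, hV⟩ := exists_ball_chart hp (inter_mem hV₁ hV₂)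
    refine ⟨_, hV, ?_⟩
    rintro _ ⟨y₂, hy₂, rfl⟩ ⟨ρ₃, M₃, h₃⟩
    -- Flatness improves one order at a time. Cauchy's estimate gives `∂d/∂ξ` the order of `d`; in
    -- the equation along the field it carries a factor `z`, so `∂d/∂y` is one order smaller.
    -- Integrating from `y₂`, where `d` already has order `n`, passes the gain to `d`.
    have key : ∀ k ≤ n, ∃ ρ M : ℝ, 0 ≤ M ∧ ∀ y ∈ Metric.ball (p w : ℂ) r₀, ∀ ξ : ℂ, ρ < ξ.re →
        ‖d ξ (e.symm y)‖ ≤ M * Real.exp (-ξ.re) ^ k := by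
      intro k
      induction k with
      | zero =>
        intro _
        refine ⟨ρ₁, |M₁|, abs_nonneg _, fun y hy ξ hξ => ?_⟩
        simpa using ((h₁ _ (hbV y hy).1 ξ hξ).1).trans (le_abs_self _)
      | succ k ih =>
        intro hk
        obtain ⟨ρ, M, hM, h⟩ := ih (by omega)
        -- The added `1` leaves room for Cauchy discs of radius one in `ξ`.
        set ρ' : ℝ := max (max (ρ + 1) (max ρ₁ 0)) (max ρ₂ ρ₃) + 1 with hρ'
        set K : ℝ := (M * Real.exp 1 ^ k + |M₁|) / m with hK
        have hK0 : 0 ≤ K := by positivity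
        refine ⟨ρ', |M₃| + K * (2 * r₀), by positivity, fun y hy ξ hξ => ?_⟩
        have hb1 : ρ + 1 ≤ max (max (ρ + 1) (max ρ₁ 0)) (max ρ₂ ρ₃) := by simp
        have hb2 : ρ₁ ≤ max (max (ρ + 1) (max ρ₁ 0)) (max ρ₂ ρ₃) := by simp
        have hb3 : 0 ≤ max (max (ρ + 1) (max ρ₁ 0)) (max ρ₂ ρ₃) := by simp
        have hb4 : ρ₂ ≤ max (max (ρ + 1) (max ρ₁ 0)) (max ρ₂ ρ₃) := by simp
        have hb5 : ρ₃ ≤ max (max (ρ + 1) (max ρ₁ 0)) (max ρ₂ ρ₃) := by simp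
        set u := Real.exp (-ξ.re) with hu
        have hu0 : 0 < u := Real.exp_pos _
        have hu1 : u ≤ 1 := Real.exp_le_one_iff.2 (by linarith)
        have hderiv : ∀ x ∈ Metric.ball (p w : ℂ) r₀, ∃ b,
            HasCoverDerivAt p (fun v => d ξ v) b (e.symm x) ∧ ‖b‖ ≤ K * u ^ (k + 1) := by
          intro x hx
          obtain ⟨a, b, hab, hbd⟩ := (h₁ _ (hbV x hx).1 ξ (by linarith)).2
          refine ⟨b, hab.hasCoverDerivAt hp, ?_⟩
          have hball : ∀ ζ ∈ Metric.closedBall ξ 1, ξ.re - 1 ≤ ζ.re := fun ζ hζ => by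
            have h4 := (Complex.abs_re_le_norm (ζ - ξ)).trans (mem_closedBall_iff_norm.1 hζ)
            rw [Complex.sub_re] at h4
            linarith [(abs_le.1 h4).1]
          have hda : ‖a‖ ≤ M * Real.exp 1 ^ k * u ^ k := by
            have hd1 : DiffContOnCl ℂ (fun ζ => d ζ (e.symm x)) (Metric.ball ξ 1) := by
              apply DifferentiableOn.diffContOnCl
              intro ζ hζ
              have h5 := hball ζ (Metric.closure_ball_subset_closedBall hζ)
              obtain ⟨a', b', hab', -⟩ := (h₁ _ (hbV x hx).1 ζ (by linarith)).2
              exact (hab'.hasDerivAt hp).differentiableAt.differentiableWithinAt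
            have h6 := Complex.norm_deriv_le_of_forall_mem_sphere_norm_le one_pos hd1
              (C := M * Real.exp 1 ^ k * u ^ k) (fun ζ hζ => by
                have h5 := hball ζ (Metric.sphere_subset_closedBall hζ)
                refine (h x hx ζ (by linarith)).trans ?_
                rw [mul_assoc, ← mul_pow, hu, ← Real.exp_add]
                gcongr
                linarith)
            rwa [(hab.hasDerivAt hp).deriv, div_one] at h6
          have hrhs := h₂ _ (hbV x hx).2 ξ (by linarith)
          have h7 : ‖b‖ * m ≤ (M * Real.exp 1 ^ k + |M₁|) * u ^ (k + 1) := by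
            calc ‖b‖ * m ≤ ‖rhs P₀ Q (p (e.symm x)) (Complex.exp (-ξ)) * b‖ := by
                  rw [norm_mul, mul_comm]; gcongr
              _ = ‖(Complex.exp (-ξ) * a + rhs P₀ Q (p (e.symm x)) (Complex.exp (-ξ)) * b)
                  - Complex.exp (-ξ) * a‖ := by rw [add_sub_cancel_left]
              _ ≤ M₁ * u ^ n + u * (M * Real.exp 1 ^ k * u ^ k) := by
                  refine (norm_sub_le _ _).trans (add_le_add hbd ?_)
                  rw [norm_mul, norm_exp_neg]
                  gcongr
              _ ≤ |M₁| * u ^ (k + 1) + u * (M * Real.exp 1 ^ k * u ^ k) := by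
                  gcongr ?_ + _
                  refine mul_le_mul (le_abs_self _) ?_ (by positivity) (abs_nonneg _)
                  exact pow_le_pow_of_le_one hu0.le hu1 hk
              _ = _ := by ring
          rw [hK, div_mul_eq_mul_div, le_div_iff₀ hm]
          exact h7
        choose! f' hf' hfb using hderiv
        have hself : ∀ x ∈ Metric.ball (p w : ℂ) r₀, (p (e.symm x) : ℂ) = x := fun x hx =>
          coe_symm_of_mem_target (hb hx) he
        have h8 := norm_le_of_chart_deriv_le he hb (f := fun v => d ξ v) (f' := fun v => f' (p v))
          (fun x hx => by simp only [hself x hx]; exact hf' x hx) hy hy₂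
          (B := fun t => |M₃| * u ^ (k + 1) + K * u ^ (k + 1) * t) (B' := fun _ => K * u ^ (k + 1))
          (by
            rw [mul_zero, add_zero]
            refine (h₃ ξ (by linarith)).trans ?_
            refine mul_le_mul (le_abs_self _) ?_ (by positivity) (abs_nonneg _)
            exact pow_le_pow_of_le_one hu0.le hu1 hk)
          (fun t => by
            simpa using ((hasDerivAt_id t).const_mul (K * u ^ (k + 1))).const_add
              (|M₃| * u ^ (k + 1)))
          (fun x hx => by simp only [hself x hx]; exact hfb x hx)
        have hdist : ‖y - y₂‖ ≤ 2 * r₀ := by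
          rw [← dist_eq_norm]
          linarith [dist_triangle_right y y₂ (p w : ℂ), Metric.mem_ball.1 hy, Metric.mem_ball.1 hy₂]
        refine h8.trans ?_
        rw [add_mul]
        have : K * u ^ (k + 1) * ‖y - y₂‖ ≤ K * u ^ (k + 1) * (2 * r₀) := by gcongr
        linarith
    obtain ⟨ρ, M, -, h⟩ := key n le_rfl
    refine ⟨ρ, M, ?_⟩
    rintro _ ⟨y, hy, rfl⟩ ξ hξ
    exact h y hy ξ hξ
  have hT : w ∈ {w | ∃ ρ M : ℝ, ∀ ξ : ℂ, ρ < ξ.re → ‖d ξ w‖ ≤ M * Real.exp (-ξ.re) ^ n} := by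
    refine forall_mem_of_local_propagation (fun x => ?_) (show w₀ ∈ _ from h₀) w
    obtain ⟨V, hV, hVb⟩ := hlocal x
    refine ⟨V, hV, fun v hv hvT x hx => ?_⟩
    obtain ⟨ρ, M, h⟩ := hVb v hv hvT
    exact ⟨ρ, M, h x hx⟩
  obtain ⟨V, hV, hVb⟩ := hlocal w
  exact ⟨V, hV, hVb w (mem_of_mem_nhds hV) hT⟩

end Propagation

/-! ### Bounds for the clock, uniform on compact sets -/

section ClockBounds

variable {P₀ : Polynomial ℂ} {E : Type*} [TopologicalSpace E] {p : E → Punctured P₀}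
  {Q : ℂ → ℂ → ℂ} {r : ℝ}

/-- On the disc `|z| < 1 / (2 A)` the series `∑ Φ_k(w) z ^ k` converges to a function of size
`O(z)` such that `log x + ∑ Φ_k(w) x ^ (-k)` is a first integral. -/
def ClockBound (Q : ℂ → ℂ → ℂ) (p : E → Punctured P₀) (Φ : ℕ → E → ℂ) (A : ℝ) (v : E) : Prop :=
  ∀ z : ℂ, ‖z‖ < 1 / (2 * A) → ‖seriesSum Φ z v‖ ≤ 2 * A * ‖z‖ ∧
    ∃ a b, HasPD p (fun q => seriesSum Φ q.1 q.2) a b (z, v) ∧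
      z * (1 - z * a) + rhs P₀ Q (p v) z * b = 0

lemma ClockBound.mono {Φ : ℕ → E → ℂ} {A A' : ℝ} {v : E} (h : ClockBound Q p Φ A v) (hA : 0 < A)
    (hAA' : A ≤ A') : ClockBound Q p Φ A' v := fun z hz => by
  obtain ⟨h1, h2⟩ := h z (hz.trans_le (by gcongr))
  exact ⟨h1.trans (by gcongr), h2⟩

/-- A formal solution with source `x⁻¹` that vanishes at the base point `w₀`. -/
structure IsClock (Q : ℂ → ℂ → ℂ) (p : E → Punctured P₀) (w₀ : E) (Φ dΦ : ℕ → E → ℂ) : Prop where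
  formal : IsFormalSolution Q p (Pi.single 1 1) Φ dΦ
  base : ∀ k, Φ k w₀ = 0

/-- The source has no term of order zero, so `dΦ 0 = 0`. This is what makes the clock `log x +
O(1/x)`. -/
lemma IsClock.zero_eq [PreconnectedSpace E] (hform : IsNormalForm P₀ Q r) (hp : IsCoveringMap p)
    {w₀ : E} {Φ dΦ : ℕ → E → ℂ} (h : IsClock Q p w₀ Φ dΦ) (w : E) : Φ 0 w = 0 := by
  rw [← h.base 0]
  refine eq_of_hasCoverDerivAt_zero hp (fun v => ?_) w w₀
  have := deriv_eq_of_coeff hform (h.formal.coeff 0 v)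
  simp only [Nat.cast_zero, zero_tsub, zero_mul, Finset.range_zero, Finset.sum_empty,
    Pi.single_eq_of_ne zero_ne_one, sub_zero, zero_div] at this
  exact this ▸ h.formal.hasDeriv 0 v

lemma IsClock.exists_nhds [PreconnectedSpace E] (hform : IsNormalForm P₀ Q r)
    (hp : IsCoveringMap p) {w₀ : E} {Φ dΦ : ℕ → E → ℂ} (h : IsClock Q p w₀ Φ dΦ) (w : E) :
    ∃ V ∈ 𝓝 w, ∃ A : ℝ, 1 ≤ A ∧ ∀ v ∈ V, ClockBound Q p Φ A v := by
  have hr := hform.r_pos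
  obtain ⟨V, hV, A, hA, hb⟩ := h.formal.exists_local_bound hform hp (by simp) (by simp)
    (fun k hk => Pi.single_eq_of_ne (by omega) _) h.base w
  -- With `2 / r ≤ A'` the disc of radius `1 / (2 A')` lies in `|z| ≤ r / 4`, where the right-hand
  -- side has its power series.
  set A' := max A (2 / r) with hA'
  have hAA' : A ≤ A' := le_max_left _ _
  have hb' : ∀ x ∈ V, ∀ k, ‖Φ k x‖ ≤ A' ^ k ∧ ‖dΦ k x‖ ≤ k * A' ^ (k + 1) := fun x hx k =>
    ⟨(hb x hx k).1.trans (by gcongr), (hb x hx k).2.trans (by gcongr)⟩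
  have hA1 : 1 ≤ A' := hA.trans hAA'
  obtain ⟨V', hV'V, hV'o, hwV'⟩ := mem_nhds_iff.1 hV
  refine ⟨V', hV'o.mem_nhds hwV', A', hA1, fun v hv z hz => ⟨?_, _, _,
    hasPD_seriesSum hp h.formal.hasDeriv hA1 hb' (mem_of_superset (hV'o.mem_nhds hv) hV'V) hz,
    h.formal.clock_relation hform hA1 (hb' v (hV'V hv)) hz ?_⟩⟩
  · have hAz : A' * ‖z‖ ≤ 1 / 2 := by rw [lt_div_iff₀ (by positivity)] at hz; linarith
    have hc : ∀ k, ‖Φ k v‖ ≤ 1 * A' ^ k := fun k => by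
      rw [one_mul]; exact (hb' v (hV'V hv) k).1
    have hs := (summable_norm_coeff_mul_pow (by positivity) zero_le_one hc hAz).of_norm.hasSum
    have := norm_sub_sum_le_of_hasSum (by positivity) hc hAz hs 1
    simp only [Finset.range_one, Finset.sum_singleton, h.zero_eq hform hp v, zero_mul, sub_zero,
      mul_one, pow_one] at this
    rw [seriesSum]; linarith
  · refine hz.le.trans ?_
    have : 2 / r ≤ A' := le_max_right _ _
    rw [div_le_iff₀ hr] at this
    rw [div_le_iff₀ (by positivity)]; nlinarith

lemma IsClock.exists_of_isCompact [PreconnectedSpace E] (hform : IsNormalForm P₀ Q r)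
    (hp : IsCoveringMap p) {w₀ : E} {Φ dΦ : ℕ → E → ℂ} (h : IsClock Q p w₀ Φ dΦ) {K : Set E}
    (hK : IsCompact K) :
    ∃ U, IsOpen U ∧ K ⊆ U ∧ ∃ A : ℝ, 1 ≤ A ∧ ∀ v ∈ U, ClockBound Q p Φ A v := by
  refine hK.induction_on (p := fun K => ∃ U, IsOpen U ∧ K ⊆ U ∧ ∃ A : ℝ, 1 ≤ A ∧
    ∀ v ∈ U, ClockBound Q p Φ A v) ⟨∅, isOpen_empty, subset_rfl, 1, le_rfl, fun v hv => hv.elim⟩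
    ?_ ?_ ?_
  · rintro s t hst ⟨U, hU, htU, h⟩
    exact ⟨U, hU, hst.trans htU, h⟩
  · rintro s t ⟨U, hU, hsU, A, hA, h⟩ ⟨U', hU', hsU', A', hA', h'⟩
    refine ⟨U ∪ U', hU.union hU', union_subset_union hsU hsU', max A A', le_max_of_le_left hA, ?_⟩
    rintro v (hv | hv)
    · exact (h v hv).mono (by linarith) (le_max_left _ _)
    · exact (h' v hv).mono (by linarith) (le_max_right _ _)
  · intro w _
    obtain ⟨V, hV, A, hA, hb⟩ := h.exists_nhds hform hp w
    obtain ⟨V', hV'V, hV'o, hwV'⟩ := mem_nhds_iff.1 hV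
    exact ⟨V', mem_nhdsWithin_of_mem_nhds (hV'o.mem_nhds hwV'), V', hV'o, subset_rfl, A, hA,
      fun v hv => hb v (hV'V hv)⟩

/-- The consequences of a `ClockBound` in the variable `ξ = log x`. -/
lemma ClockBound.clock (hp : IsCoveringMap p) {Φ : ℕ → E → ℂ} {A : ℝ} {v : E} (hA : 1 ≤ A)
    (h : ClockBound Q p Φ A v) {ξ : ℂ} (hξ : Real.log (2 * A) < ξ.re) :
    ‖clock Φ ξ v - ξ‖ ≤ 2 * A * Real.exp (-ξ.re) ∧ ‖clock Φ ξ v - ξ‖ ≤ 1 ∧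
    ∃ a b, HasPD p (fun q => clock Φ q.1 q.2) a b (ξ, v) ∧
      Complex.exp (-ξ) * a + rhs P₀ Q (p v) (Complex.exp (-ξ)) * b = 0 := by
  have hlt : Real.exp (-ξ.re) < 1 / (2 * A) := by
    rw [Real.exp_neg, ← one_div]
    refine one_div_lt_one_div_of_lt (by positivity) ?_
    rwa [← Real.log_lt_iff_lt_exp (by positivity)]
  obtain ⟨h1, a, b, hab, hrel⟩ := h (Complex.exp (-ξ)) (by rwa [norm_exp_neg])
  rw [norm_exp_neg] at h1
  simp only [FormalMotion.clock, add_sub_cancel_left]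
  refine ⟨h1, h1.trans ?_, _, _,
    (hasPD_fst (ξ, v)).add (hab.comp_left hp (φ := fun x => Complex.exp (-x))
      (hasDerivAt_neg ξ).cexp), ?_⟩
  · rw [lt_div_iff₀ (by positivity)] at hlt; linarith
  · linear_combination hrel

end ClockBounds

/-! ### Further rules for partial derivatives -/

section MorePartials

variable {P₀ : Polynomial ℂ} {E : Type*} [TopologicalSpace E] {p : E → Punctured P₀}

lemma HasPD.mul (hp : IsCoveringMap p) {u₁ u₂ : ℂ × E → ℂ} {a₁ b₁ a₂ b₂ : ℂ} {q : ℂ × E}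
    (h₁ : HasPD p u₁ a₁ b₁ q) (h₂ : HasPD p u₂ a₂ b₂ q) :
    HasPD p (fun v => u₁ v * u₂ v) (u₁ q * a₂ + u₂ q * a₁) (u₁ q * b₂ + u₂ q * b₁) q := by
  obtain ⟨e, hw, he⟩ := exists_chart hp q.2
  rw [hasPD_iff hw he] at h₁ h₂ ⊢
  refine (h₁.mul h₂).congr_fderiv ?_
  ext <;> simp [← he, e.left_inv hw]

lemma HasPD.neg {u : ℂ × E → ℂ} {a b : ℂ} {q : ℂ × E} (h : HasPD p u a b q) :
    HasPD p (fun v => -u v) (-a) (-b) q := by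
  refine (Asymptotics.IsLittleO.neg_left h).congr_left fun v => ?_
  ring

lemma HasPD.sub {u₁ u₂ : ℂ × E → ℂ} {a₁ b₁ a₂ b₂ : ℂ} {q : ℂ × E} (h₁ : HasPD p u₁ a₁ b₁ q)
    (h₂ : HasPD p u₂ a₂ b₂ q) : HasPD p (fun v => u₁ v - u₂ v) (a₁ - a₂) (b₁ - b₂) q := by
  simpa only [sub_eq_add_neg] using h₁.add h₂.neg

lemma HasPD.sum {ι : Type*} {u : ι → ℂ × E → ℂ} {a b : ι → ℂ} {q : ℂ × E} {s : Finset ι}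
    (h : ∀ i ∈ s, HasPD p (u i) (a i) (b i) q) :
    HasPD p (fun v => ∑ i ∈ s, u i v) (∑ i ∈ s, a i) (∑ i ∈ s, b i) q := by
  refine (Asymptotics.IsLittleO.sum h).congr_left fun v => ?_
  simp only [Finset.sum_apply, Finset.sum_sub_distrib, Finset.sum_mul]

lemma HasPD.of_fst {φ : ℂ → ℂ} {φ' : ℂ} (hp : IsCoveringMap p) {q : ℂ × E}
    (h : HasDerivAt φ φ' q.1) : HasPD p (fun v => φ v.1) φ' 0 q := by
  simpa using HasPD.comp_deriv hp h (hasPD_fst q)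

lemma HasPD.comp_deck {γ : E ≃ₜ E} (hγ : ∀ w, p (γ w) = p w) {u : ℂ × E → ℂ} {a b ξ : ℂ} {w : E}
    (h : HasPD p u a b (ξ, γ w)) : HasPD p (fun v => u (v.1, γ v.2)) a b (ξ, w) := by
  have hc : Tendsto (fun v : ℂ × E => (v.1, γ v.2)) (𝓝 (ξ, w)) (𝓝 (ξ, γ w)) :=
    (continuous_fst.prodMk (γ.continuous.comp continuous_snd)).tendsto (ξ, w)
  refine (Asymptotics.IsLittleO.comp_tendsto h hc).congr (fun v => ?_) (fun v => ?_)
  · simp [hγ]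
  · simp [hγ]

end MorePartials

/-- Otherwise `f = z ^ n g` with `g(0) ≠ 0`, which is not `O(z ^ (n + 1))`. -/
lemma AnalyticAt.eventually_eq_zero_of_flat {f : ℂ → ℂ} (hf : AnalyticAt ℂ f 0)
    (h : ∀ n : ℕ, ∃ M : ℝ, ∀ᶠ z in 𝓝[≠] 0, ‖f z‖ ≤ M * ‖z‖ ^ n) : ∀ᶠ z in 𝓝 0, f z = 0 := by
  by_contra hne
  obtain ⟨n, g, hg, hg0, hfg⟩ := hf.exists_eventuallyEq_pow_smul_nonzero_iff.2 hne
  obtain ⟨M, hM⟩ := h (n + 1)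
  have h1 : ∀ᶠ z in 𝓝[≠] (0 : ℂ), ‖g z‖ ≤ M * ‖z‖ := by
    filter_upwards [hM, eventually_nhdsWithin_of_eventually_nhds hfg, self_mem_nhdsWithin]
      with z hz hz2 hz0
    rw [hz2, sub_zero, norm_smul, norm_pow, pow_succ] at hz
    have hpos : 0 < ‖z‖ ^ n := by have := norm_pos_iff.2 hz0; positivity
    refine le_of_mul_le_mul_left (hz.trans (le_of_eq ?_)) hpos
    ring
  have h2 : Tendsto (fun z : ℂ => ‖g z‖) (𝓝[≠] 0) (𝓝 ‖g 0‖) :=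
    (hg.continuousAt.norm.tendsto).mono_left nhdsWithin_le_nhds
  have h3 : Tendsto (fun z : ℂ => M * ‖z‖) (𝓝[≠] 0) (𝓝 0) := by
    have : Tendsto (fun z : ℂ => M * ‖z‖) (𝓝 0) (𝓝 (M * ‖(0 : ℂ)‖)) :=
      (continuous_const.mul continuous_norm).tendsto 0
    simpa using this.mono_left nhdsWithin_le_nhds
  have h4 := le_of_tendsto_of_tendsto h2 h3 h1
  exact hg0 (norm_le_zero_iff.1 h4)

/-! ### Deck transformations act through the holonomy -/

section DeckIdentity

variable {P₀ : Polynomial ℂ} {E : Type*} [TopologicalSpace E] {p : E → Punctured P₀}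
  {Q : ℂ → ℂ → ℂ} {r : ℝ}

lemma IsClock.clock_base {w₀ : E} {Φ dΦ : ℕ → E → ℂ} (h : IsClock Q p w₀ Φ dΦ) (ξ : ℂ) :
    clock Φ ξ w₀ = ξ := by
  simp [clock, seriesSum, h.base]

lemma sub_one_le_re_of_norm_sub_le {σ ξ : ℂ} (h : ‖σ - ξ‖ ≤ 1) : ξ.re - 1 ≤ σ.re := by
  have h4 := (Complex.abs_re_le_norm (σ - ξ)).trans h
  rw [Complex.sub_re] at h4
  linarith [(abs_le.1 h4).1]

/-- Both expressions are exact first integrals, bounded distance apart and equal at `w₀`, so the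
propagation of flatness applies at every order. -/
lemma IsClock.flat_deck [PreconnectedSpace E] (hform : IsNormalForm P₀ Q r) (hp : IsCoveringMap p)
    {w₀ : E} {Φ dΦ : ℕ → E → ℂ} (h : IsClock Q p w₀ Φ dΦ) {γ : E ≃ₜ E} (hγ : ∀ w, p (γ w) = p w)
    (n : ℕ) (w : E) : ∃ ρ M : ℝ, ∀ ξ : ℂ, ρ < ξ.re →
      ‖clock Φ ξ (γ w) - clock Φ (clock Φ ξ w) (γ w₀)‖ ≤ M * Real.exp (-ξ.re) ^ n := by
  obtain ⟨V, hV, ρ, M, hb⟩ := exists_flat_nhds hform hp (n := n)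
    (d := fun ξ w => clock Φ ξ (γ w) - clock Φ (clock Φ ξ w) (γ w₀)) (fun w => by
      obtain ⟨V₁, hV₁, A₁, hA₁, h₁⟩ := h.exists_nhds hform hp w
      obtain ⟨V₂, hV₂, A₂, hA₂, h₂⟩ := h.exists_nhds hform hp (γ w)
      obtain ⟨V₃, hV₃, A₃, hA₃, h₃⟩ := h.exists_nhds hform hp (γ w₀)
      refine ⟨V₁ ∩ γ ⁻¹' V₂, inter_mem hV₁ (γ.continuous.continuousAt hV₂),
        max (max (Real.log (2 * A₁)) (Real.log (2 * A₂))) (Real.log (2 * A₃)) + 1, 3,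
        fun v hv ξ hξ => ?_⟩
      have hb1 : Real.log (2 * A₁) ≤
        max (max (Real.log (2 * A₁)) (Real.log (2 * A₂))) (Real.log (2 * A₃)) := by simp
      have hb2 : Real.log (2 * A₂) ≤
        max (max (Real.log (2 * A₁)) (Real.log (2 * A₂))) (Real.log (2 * A₃)) := by simp
      have hb3 : Real.log (2 * A₃) ≤
        max (max (Real.log (2 * A₁)) (Real.log (2 * A₂))) (Real.log (2 * A₃)) := by simp
      obtain ⟨-, hn1, a₁, b₁, hab₁, hr₁⟩ := (h₁ v hv.1).clock hp hA₁ (ξ := ξ) (by linarith)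
      obtain ⟨-, hn2, a₂, b₂, hab₂, hr₂⟩ := (h₂ (γ v) hv.2).clock hp hA₂ (ξ := ξ) (by linarith)
      obtain ⟨-, hn3, a₃, b₃, hab₃, -⟩ := (h₃ (γ w₀) (mem_of_mem_nhds hV₃)).clock hp hA₃
        (ξ := clock Φ ξ v) (by linarith [sub_one_le_re_of_norm_sub_le hn1])
      refine ⟨?_, _, _, (hab₂.comp_deck hγ).sub
        (HasPD.comp_deriv hp (hab₃.hasDerivAt hp) hab₁), ?_⟩
      · have : clock Φ ξ (γ v) - clock Φ (clock Φ ξ v) (γ w₀) = (clock Φ ξ (γ v) - ξ)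
          - (clock Φ ξ v - ξ) - (clock Φ (clock Φ ξ v) (γ w₀) - clock Φ ξ v) := by ring
        rw [this]
        linarith [norm_sub_le ((clock Φ ξ (γ v) - ξ) - (clock Φ ξ v - ξ))
          (clock Φ (clock Φ ξ v) (γ w₀) - clock Φ ξ v),
          norm_sub_le (clock Φ ξ (γ v) - ξ) (clock Φ ξ v - ξ)]
      · rw [hγ] at hr₂
        have : Complex.exp (-ξ) * (a₂ - a₃ * a₁) + rhs P₀ Q (p v) (Complex.exp (-ξ))
          * (b₂ - a₃ * b₁) = 0 := by linear_combination hr₂ - a₃ * hr₁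
        rw [this, norm_zero]
        positivity) (w₀ := w₀) ⟨0, 0, fun ξ _ => by simp [h.clock_base]⟩ w
  exact ⟨ρ, M, hb w (mem_of_mem_nhds hV)⟩

/-- Deck transformations act on the first integral by a change of the constant. -/
lemma IsClock.clock_deck [PreconnectedSpace E] (hform : IsNormalForm P₀ Q r)
    (hp : IsCoveringMap p) {w₀ : E} {Φ dΦ : ℕ → E → ℂ} (h : IsClock Q p w₀ Φ dΦ) {γ : E ≃ₜ E}
    (hγ : ∀ w, p (γ w) = p w) {A : ℝ} (hA : 1 ≤ A) {v : E} (h₁ : ClockBound Q p Φ A v)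
    (h₂ : ClockBound Q p Φ A (γ v)) (h₃ : ClockBound Q p Φ A (γ w₀)) {ξ : ℂ}
    (hξ : Real.log (2 * A) + 1 < ξ.re) :
    clock Φ ξ (γ v) = clock Φ (clock Φ ξ v) (γ w₀) := by
  -- The factor `exp (-1)` is needed because `inner` can enlarge `|z|` by a factor up to `exp 1`.
  set ρ : ℝ := 1 / (2 * A) * Real.exp (-1) with hρ
  have hρ0 : 0 < ρ := by positivity
  have hρA : ρ ≤ 1 / (2 * A) := mul_le_of_le_one_right (by positivity)
    (Real.exp_le_one_iff.2 (by norm_num))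
  let inner : ℂ → ℂ := fun z => z * Complex.exp (-seriesSum Φ z v)
  -- The defect of the identity in the variable `z = exp (-ξ)`: the terms `ξ` cancel, leaving a
  -- function analytic at `z = 0`. Being flat to all orders there, it vanishes.
  let D : ℂ → ℂ := fun z => seriesSum Φ z (γ v) - seriesSum Φ z v - seriesSum Φ (inner z) (γ w₀)
  have hinner : ∀ z : ℂ, ‖z‖ < ρ → ‖inner z‖ < 1 / (2 * A) := fun z hz => by
    have hz' := hz.trans_le hρA
    have h4 := (h₁ z hz').1
    have h5 : ‖seriesSum Φ z v‖ ≤ 1 := by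
      refine h4.trans ?_
      rw [lt_div_iff₀ (by positivity)] at hz'; linarith
    have h6 : Real.exp (-seriesSum Φ z v).re ≤ Real.exp 1 := by
      refine Real.exp_le_exp.2 ((le_abs_self _).trans ((Complex.abs_re_le_norm _).trans ?_))
      rwa [norm_neg]
    calc ‖inner z‖ = ‖z‖ * Real.exp (-seriesSum Φ z v).re := by
          simp only [inner, norm_mul, Complex.norm_exp]
      _ ≤ ‖z‖ * Real.exp 1 := by gcongr
      _ < ρ * Real.exp 1 := by gcongr
      _ = _ := by rw [hρ, mul_assoc, ← Real.exp_add]; simp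
  have hser : ∀ {x : E}, ClockBound Q p Φ A x → ∀ z : ℂ, ‖z‖ < 1 / (2 * A) →
      DifferentiableAt ℂ (fun z => seriesSum Φ z x) z := fun hx z hz => by
    obtain ⟨-, a, b, hab, -⟩ := hx z hz
    exact (hab.hasDerivAt hp).differentiableAt
  have hD : DifferentiableOn ℂ D (Metric.ball 0 ρ) := fun z hz => by
    have hz' : ‖z‖ < ρ := by simpa using hz
    have hi : DifferentiableAt ℂ inner z :=
      differentiableAt_id.mul (hser h₁ z (hz'.trans_le hρA)).neg.cexp
    exact (((hser h₂ z (hz'.trans_le hρA)).sub (hser h₁ z (hz'.trans_le hρA))).sub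
      (DifferentiableAt.comp z (hser h₃ _ (hinner z hz')) hi)).differentiableWithinAt
  have hDξ : ∀ ξ, D (Complex.exp (-ξ)) = clock Φ ξ (γ v) - clock Φ (clock Φ ξ v) (γ w₀) := by
    intro ξ
    simp only [D, inner, clock, ← Complex.exp_add]
    rw [neg_add]
    ring
  have hDan : AnalyticOnNhd ℂ D (Metric.ball 0 ρ) := hD.analyticOnNhd Metric.isOpen_ball
  have hev : ∀ᶠ z in 𝓝 0, D z = 0 := by
    refine AnalyticAt.eventually_eq_zero_of_flat (hDan 0 (Metric.mem_ball_self hρ0)) fun n => ?_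
    obtain ⟨ρ₁, M, hM⟩ := h.flat_deck hform hp hγ n v
    refine ⟨M, ?_⟩
    filter_upwards [eventually_nhdsWithin_of_eventually_nhds
      (Metric.ball_mem_nhds (0 : ℂ) (Real.exp_pos (-ρ₁))), self_mem_nhdsWithin] with z hz hz0
    have hz1 : ‖z‖ < Real.exp (-ρ₁) := by simpa using hz
    have hz2 := norm_pos_iff.2 hz0
    have hre : (-Complex.log z).re = -Real.log ‖z‖ := by simp [Complex.log_re]
    have h7 := hM (-Complex.log z) (by
      rw [hre]
      have := (Real.log_lt_log hz2 hz1)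
      rw [Real.log_exp] at this
      linarith)
    rw [← hDξ, neg_neg, Complex.exp_log hz0, hre, neg_neg, Real.exp_log hz2] at h7
    exact h7
  have hzero := hDan.eqOn_zero_of_preconnected_of_eventuallyEq_zero
    (convex_ball (0 : ℂ) ρ).isPreconnected (Metric.mem_ball_self hρ0) hev
  have hz : Complex.exp (-ξ) ∈ Metric.ball (0 : ℂ) ρ := by
    rw [mem_ball_zero_iff, norm_exp_neg, hρ, ← Real.exp_log (show 0 < 1 / (2 * A) by positivity),
      ← Real.exp_add, one_div, Real.log_inv]
    exact Real.exp_lt_exp.2 (by linarith)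
  have := hzero hz
  rw [hDξ] at this
  exact sub_eq_zero.1 this

end DeckIdentity

/-! ### Truncations of the formal constant along the clock -/

section Truncation

variable {P₀ : Polynomial ℂ} {E : Type*} [TopologicalSpace E] {p : E → Punctured P₀}
  {Q : ℂ → ℂ → ℂ} {r : ℝ}

/-- The coefficients of `D_x (-x + a log x) = -1 + a x⁻¹`. -/
def motionSource (a : ℂ) (k : ℕ) : ℂ := if k = 0 then -1 else if k = 1 then a else 0

lemma truncation_eq {E : Type*} (a : ℂ) (F : ℕ → E → ℂ) (n : ℕ) (q : ℂ × E) : truncation a F n q =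
    (-Complex.exp q.1 + a * q.1) + ∑ k ∈ Finset.range (n + 1), F k q.2 * Complex.exp (-q.1) ^ k := by
  have h : ∀ f : ℕ → ℂ, ∑ k ∈ Finset.range (n + 1), f k = f 0 + ∑ k ∈ Finset.Icc 1 n, f k :=
    fun f => by
      rw [Finset.range_eq_Ico, Finset.sum_eq_sum_Ico_succ_bot (by omega)]
      rfl
  rw [truncation, h]
  simp only [pow_zero, mul_one, Complex.exp_neg, inv_pow, div_eq_mul_inv]
  ring

lemma IsFormalSolution.continuous (hp : IsCoveringMap p) {s : ℕ → ℂ} {Φ dΦ : ℕ → E → ℂ}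
    (h : IsFormalSolution Q p s Φ dΦ) (k : ℕ) : Continuous (Φ k) :=
  continuous_iff_continuousAt.2 fun w => (h.hasDeriv k w).continuousAt hp

lemma IsFormalSolution.continuous_deriv (hform : IsNormalForm P₀ Q r) (hp : IsCoveringMap p)
    {s : ℕ → ℂ} {Φ dΦ : ℕ → E → ℂ} (h : IsFormalSolution Q p s Φ dΦ) (k : ℕ) :
    Continuous (dΦ k) := by
  induction k using Nat.strong_induction_on with
  | _ k ih =>
    have : dΦ k = fun w => (((k - 1 : ℕ) : ℂ) * Φ (k - 1) w - s k
      - ∑ j ∈ Finset.range k, rhsCoeff P₀ Q (k - j) (p w) * dΦ j w) / P₀.eval (p w : ℂ) :=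
      funext fun w => deriv_eq_of_coeff hform (h.coeff k w)
    rw [this]
    refine Continuous.div ?_ (P₀.continuous.comp (continuous_coe hp)) fun w => eval_coe_ne_zero w
    refine ((continuous_const.mul (h.continuous hp _)).sub continuous_const).sub ?_
    exact continuous_finsetSum _ fun j hj =>
      ((differentiable_rhsCoeff hform _).continuous.comp (continuous_coe hp)).mul
        (ih j (Finset.mem_range.1 hj))

lemma IsFormalSolution.hasPD_truncation (hp : IsCoveringMap p) {s : ℕ → ℂ} {Φ dΦ : ℕ → E → ℂ}
    (h : IsFormalSolution Q p s Φ dΦ) (a : ℂ) (n : ℕ) (q : ℂ × E) :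
    HasPD p (truncation a Φ n)
      ((-Complex.exp q.1 + a) - ∑ k ∈ Finset.range (n + 1), k * Φ k q.2 * Complex.exp (-q.1) ^ k)
      (∑ k ∈ Finset.range (n + 1), dΦ k q.2 * Complex.exp (-q.1) ^ k) q := by
  have hfun : truncation a Φ n = fun q : ℂ × E => (-Complex.exp q.1 + a * q.1)
      + ∑ k ∈ Finset.range (n + 1), Φ k q.2 * Complex.exp (-q.1) ^ k :=
    funext fun q => truncation_eq a Φ n q
  have h1 : HasPD p (fun q : ℂ × E => -Complex.exp q.1 + a * q.1) (-Complex.exp q.1 + a) 0 q :=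
    HasPD.of_fst (φ := fun x => -Complex.exp x + a * x) hp
      ((Complex.hasDerivAt_exp q.1).neg.add (hasDerivAt_const_mul a))
  have h2 : ∀ k ∈ Finset.range (n + 1), HasPD p (fun q : ℂ × E => Φ k q.2 * Complex.exp (-q.1) ^ k)
      (Φ k q.2 * (k * Complex.exp (-q.1) ^ (k - 1) * -Complex.exp (-q.1))
        + Complex.exp (-q.1) ^ k * 0)
      (Φ k q.2 * 0 + Complex.exp (-q.1) ^ k * dΦ k q.2) q := fun k _ => by
    refine (HasPD.of_snd (h.hasDeriv k q.2)).mul hp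
      (HasPD.of_fst (φ := fun x => Complex.exp (-x) ^ k) hp ?_)
    have := ((hasDerivAt_neg q.1).cexp).fun_pow k
    refine this.congr_deriv ?_
    ring
  rw [hfun]
  convert h1.add (HasPD.sum h2) using 1
  · rw [sub_eq_add_neg, ← Finset.sum_neg_distrib]
    congr 1
    refine Finset.sum_congr rfl fun k _ => ?_
    rcases k with _ | k
    · simp
    · simp only [Nat.add_sub_cancel]; ring
  · rw [zero_add]
    refine Finset.sum_congr rfl fun k _ => ?_
    ring

/-- After the formal equations are inserted, consecutive terms cancel and only order `n + 1` is
left. For `n = 0` this includes `a z`, which no formal equation up to order `0` has absorbed. -/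
lemma low_order_terms (a z : ℂ) (f : ℕ → ℂ) (n : ℕ) :
    (-1 + a * z - ∑ k ∈ Finset.range (n + 1), k * f k * z ^ (k + 1))
      + ∑ m ∈ Finset.range (n + 1), (((m - 1 : ℕ) : ℂ) * f (m - 1) - motionSource a m) * z ^ m
      = (if n = 0 then a * z else 0) - n * f n * z ^ (n + 1) := by
  induction n with
  | zero => simp [motionSource]
  | succ n ih =>
    rw [Finset.sum_range_succ _ (n + 1), Finset.sum_range_succ _ (n + 1)]
    have h1 : motionSource a (n + 1) * z ^ (n + 1) = if n = 0 then a * z else 0 := by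
      rcases n with _ | n <;> simp [motionSource]
    simp only [Nat.add_sub_cancel, Nat.succ_ne_zero, if_false]
    push_cast at ih ⊢
    linear_combination ih - h1

/-- A change of order `1/|x|` in `log x` moves `x` by a bounded amount. -/
lemma norm_exp_sub_exp_le {ξ σ : ℂ} {A : ℝ} (h1 : ‖σ - ξ‖ ≤ 2 * A * Real.exp (-ξ.re))
    (h2 : ‖σ - ξ‖ ≤ 1) : ‖Complex.exp σ - Complex.exp ξ‖ ≤ 4 * A := by
  have : Complex.exp σ - Complex.exp ξ = Complex.exp ξ * (Complex.exp (σ - ξ) - 1) := by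
    rw [mul_sub, ← Complex.exp_add]; simp
  rw [this, norm_mul, Complex.norm_exp]
  calc Real.exp ξ.re * ‖Complex.exp (σ - ξ) - 1‖ ≤ Real.exp ξ.re * (2 * ‖σ - ξ‖) := by
        gcongr; exact Complex.norm_exp_sub_one_le h2
    _ ≤ Real.exp ξ.re * (2 * (2 * A * Real.exp (-ξ.re))) := by gcongr
    _ = 4 * A * (Real.exp ξ.re * Real.exp (-ξ.re)) := by ring
    _ = 4 * A := by rw [← Real.exp_add]; simp

/-- A bound for the change of a truncation under a small change of `log x`. -/
lemma norm_truncation_sub_le {E : Type*} {a ξ σ : ℂ} {A : ℝ} {Φ : ℕ → E → ℂ} {B : ℕ → ℝ} {n : ℕ}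
    {v w₀ : E} (hξ : 1 ≤ ξ.re) (h1 : ‖σ - ξ‖ ≤ 2 * A * Real.exp (-ξ.re))
    (h2 : ‖σ - ξ‖ ≤ 1) (hB : ∀ k ∈ Finset.range (n + 1), ‖Φ k v‖ ≤ B k) :
    ‖truncation a Φ n (ξ, v) - truncation a Φ n (σ, w₀)‖
      ≤ 4 * A + ‖a‖ + ∑ k ∈ Finset.range (n + 1), (B k + ‖Φ k w₀‖) := by
  have hσ : 0 ≤ σ.re := by linarith [sub_one_le_re_of_norm_sub_le h2]
  have e1 := norm_exp_sub_exp_le h1 h2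
  have e2 : ‖a * (ξ - σ)‖ ≤ ‖a‖ := by
    rw [norm_mul, norm_sub_rev]
    exact mul_le_of_le_one_right (norm_nonneg _) h2
  have e3 : ∀ ζ : ℂ, 0 ≤ ζ.re → ∀ k, ∀ x, ‖Φ k x * Complex.exp (-ζ) ^ k‖ ≤ ‖Φ k x‖ := by
    intro ζ hζ k x
    rw [norm_mul, norm_pow, norm_exp_neg]
    exact mul_le_of_le_one_right (norm_nonneg _)
      (pow_le_one₀ (Real.exp_pos _).le (Real.exp_le_one_iff.2 (by linarith)))
  rw [truncation_eq, truncation_eq]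
  have e4 : (-Complex.exp ξ + a * ξ) + ∑ k ∈ Finset.range (n + 1), Φ k v * Complex.exp (-ξ) ^ k
      - ((-Complex.exp σ + a * σ) + ∑ k ∈ Finset.range (n + 1), Φ k w₀ * Complex.exp (-σ) ^ k)
      = (Complex.exp σ - Complex.exp ξ) + a * (ξ - σ) + ∑ k ∈ Finset.range (n + 1),
        (Φ k v * Complex.exp (-ξ) ^ k - Φ k w₀ * Complex.exp (-σ) ^ k) := by
    rw [Finset.sum_sub_distrib]; ring
  simp only
  rw [e4]
  refine (norm_add_le _ _).trans (add_le_add ((norm_add_le _ _).trans (add_le_add e1 e2))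
    (norm_sum_le_of_le _ fun k hk => (norm_sub_le _ _).trans (add_le_add ?_ ?_)))
  · exact (e3 ξ (by linarith) k v).trans (hB k hk)
  · exact e3 σ hσ k w₀

/-- The derivative of a truncation along the field is of the order of the first omitted term. -/
lemma IsFormalSolution.exists_bound_Dx (hform : IsNormalForm P₀ Q r) (hp : IsCoveringMap p) {a : ℂ}
    {Φ dΦ : ℕ → E → ℂ} (h : IsFormalSolution Q p (motionSource a) Φ dΦ) (n : ℕ) (w : E) :
    ∃ V ∈ 𝓝 w, ∃ M : ℝ, ∀ v ∈ V, ∀ z : ℂ, ‖z‖ ≤ r / 4 → ‖z‖ ≤ 1 →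
      ‖(-1 + a * z - ∑ k ∈ Finset.range (n + 1), k * Φ k v * z ^ (k + 1))
        + rhs P₀ Q (p v) z * ∑ k ∈ Finset.range (n + 1), dΦ k v * z ^ k‖ ≤ M * ‖z‖ ^ (n + 1) := by
  have hr := hform.r_pos
  obtain ⟨M, hM, hMb⟩ := norm_rhs_sub_sum_le hform (‖(p w : ℂ)‖ + 1)
  have hV : ∀ᶠ v in 𝓝 w, ‖(p v : ℂ)‖ < ‖(p w : ℂ)‖ + 1 ∧ (∀ k ∈ Finset.range (n + 1),
      ‖dΦ k v‖ < ‖dΦ k w‖ + 1) ∧ ‖Φ n v‖ < ‖Φ n w‖ + 1 := by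
    refine ((continuous_coe hp).norm.continuousAt.eventually_lt_const (by simp)).and
      (Filter.Eventually.and ?_ ?_)
    · rw [Finset.eventually_all]
      exact fun k _ => (h.continuous_deriv hform hp k).norm.continuousAt.eventually_lt_const (by simp)
    · exact (h.continuous hp n).norm.continuousAt.eventually_lt_const (by simp)
  refine ⟨_, hV, ‖a‖ + n * (‖Φ n w‖ + 1) + ∑ k ∈ Finset.range (n + 1),
    (‖dΦ k w‖ + 1) * (M * (2 / r) ^ (n + 1 - k)), fun v hv z hz hz1 => ?_⟩
  obtain ⟨hv1, hv2, hv3⟩ := hv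
  -- The `k`-th term uses the Taylor polynomial of degree `n - k`: the products then give precisely
  -- the formal equations of orders `0` to `n`, and each remainder has order `n + 1`.
  have hexp : rhs P₀ Q (p v) z * ∑ k ∈ Finset.range (n + 1), dΦ k v * z ^ k
      = (∑ k ∈ Finset.range (n + 1), dΦ k v * z ^ k * (rhs P₀ Q (p v) z
          - ∑ i ∈ Finset.range (n + 1 - k), rhsCoeff P₀ Q i (p v) * z ^ i))
        + ∑ m ∈ Finset.range (n + 1), (((m - 1 : ℕ) : ℂ) * Φ (m - 1) v - motionSource a m) * z ^ m := by
    have h1 : ∑ m ∈ Finset.range (n + 1), (((m - 1 : ℕ) : ℂ) * Φ (m - 1) v - motionSource a m) * z ^ m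
        = ∑ m ∈ Finset.range (n + 1), ∑ k ∈ Finset.range (m + 1),
          (dΦ k v * z ^ k) * (rhsCoeff P₀ Q (m - k) (p v) * z ^ (m - k)) := by
      refine Finset.sum_congr rfl fun m _ => ?_
      have h2 : ((m - 1 : ℕ) : ℂ) * Φ (m - 1) v - motionSource a m
          = ∑ j ∈ Finset.range (m + 1), rhsCoeff P₀ Q (m - j) (p v) * dΦ j v := by
        linear_combination -(h.coeff m v)
      rw [h2, Finset.sum_mul]
      refine Finset.sum_congr rfl fun k hk => ?_
      have hk' := Finset.mem_range.1 hk
      have : z ^ m = z ^ k * z ^ (m - k) := by rw [← pow_add]; congr 1; omega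
      rw [this]; ring
    rw [h1, Finset.sum_range_diag_flip (n + 1)
      (fun k i => (dΦ k v * z ^ k) * (rhsCoeff P₀ Q i (p v) * z ^ i)), ← Finset.sum_add_distrib,
      Finset.mul_sum]
    refine Finset.sum_congr rfl fun k _ => ?_
    rw [← Finset.mul_sum]
    ring
  rw [hexp, add_comm (∑ k ∈ Finset.range (n + 1), dΦ k v * z ^ k * _), ← add_assoc,
    low_order_terms a z (fun k => Φ k v) n, add_mul, add_mul, Finset.sum_mul]
  refine (norm_add_le _ _).trans (add_le_add ((norm_sub_le _ _).trans (add_le_add ?_ ?_)) ?_)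
  · split_ifs with hn
    · simp [hn]
    · rw [norm_zero]; positivity
  · rw [norm_mul, norm_mul, norm_pow, Complex.norm_natCast]
    gcongr
  · refine norm_sum_le_of_le _ fun k hk => ?_
    have hk' := Finset.mem_range.1 hk
    have h3 := hMb _ hv1.le z hz (n + 1 - k)
    rw [norm_mul, norm_mul, norm_pow]
    calc ‖dΦ k v‖ * ‖z‖ ^ k * _ ≤ (‖dΦ k w‖ + 1) * ‖z‖ ^ k * (M * (2 / r * ‖z‖) ^ (n + 1 - k)) := by
          gcongr
          exact (hv2 k hk).le
      _ = (‖dΦ k w‖ + 1) * (M * (2 / r) ^ (n + 1 - k)) * (‖z‖ ^ k * ‖z‖ ^ (n + 1 - k)) := by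
          rw [mul_pow]; ring
      _ = _ := by rw [← pow_add]; congr 2; omega

/-- Along a first integral `σ` close to `log x`, the truncations take the same values as at the base
point, up to the order of the first omitted term. -/
lemma IsFormalSolution.exists_flat_truncation [PreconnectedSpace E] (hform : IsNormalForm P₀ Q r)
    (hp : IsCoveringMap p) {a : ℂ} {Φ dΦ : ℕ → E → ℂ}
    (h : IsFormalSolution Q p (motionSource a) Φ dΦ) {w₀ : E} {S dS : ℕ → E → ℂ}
    (hS : IsClock Q p w₀ S dS) (n : ℕ) (w : E) :
    ∃ V ∈ 𝓝 w, ∃ ρ M : ℝ, ∀ v ∈ V, ∀ ξ : ℂ, ρ < ξ.re →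
      ‖truncation a Φ n (ξ, v) - truncation a Φ n (clock S ξ v, w₀)‖
        ≤ M * Real.exp (-ξ.re) ^ (n + 1) := by
  refine exists_flat_nhds hform hp (w₀ := w₀)
    (d := fun ξ v => truncation a Φ n (ξ, v) - truncation a Φ n (clock S ξ v, w₀)) (fun w => ?_)
    ⟨0, 0, fun ξ _ => by simp [hS.clock_base]⟩ w
  obtain ⟨V₁, hV₁, A, hA, h₁⟩ := hS.exists_nhds hform hp w
  obtain ⟨V₂, hV₂, M₂, h₂⟩ := h.exists_bound_Dx hform hp n w
  have hV₃ : ∀ᶠ v in 𝓝 w, ∀ k ∈ Finset.range (n + 1), ‖Φ k v‖ < ‖Φ k w‖ + 1 := by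
    rw [Finset.eventually_all]
    exact fun k _ => (h.continuous hp k).norm.continuousAt.eventually_lt_const (by simp)
  have hr := hform.r_pos
  refine ⟨V₁ ∩ V₂ ∩ _, inter_mem (inter_mem hV₁ hV₂) hV₃, max (max (Real.log (2 * A)) 1)
    (-Real.log (r / 4)), max M₂ (4 * A + ‖a‖ + ∑ k ∈ Finset.range (n + 1), (‖Φ k w‖ + 1 + ‖Φ k w₀‖)),
    fun v hv ξ hξ => ?_⟩
  rw [max_lt_iff, max_lt_iff] at hξ
  obtain ⟨⟨hξ1, hξ2⟩, hξ3⟩ := hξ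
  obtain ⟨hc1, hc2, b₁, b₂, hb, hrel⟩ := (h₁ v hv.1.1).clock hp hA hξ1
  refine ⟨le_max_of_le_right ?_, _, _, (h.hasPD_truncation hp a n (ξ, v)).sub
    (HasPD.comp_deriv hp (h := fun σ => truncation a Φ n (σ, w₀))
      ((h.hasPD_truncation hp a n (clock S ξ v, w₀)).hasDerivAt hp) hb), ?_⟩
  · exact norm_truncation_sub_le hξ2.le hc1 hc2 fun k hk => (hv.2 k hk).le
  · set T := (-Complex.exp (clock S ξ v) + a) - ∑ k ∈ Finset.range (n + 1),
      k * Φ k w₀ * Complex.exp (-clock S ξ v) ^ k with hT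
    have h4 := h₂ v hv.1.2 (Complex.exp (-ξ)) (by
      rw [norm_exp_neg, ← Real.le_log_iff_exp_le (by positivity)]; linarith) (by
      rw [norm_exp_neg, Real.exp_le_one_iff]; linarith)
    rw [norm_exp_neg] at h4
    have h5 : Complex.exp (-ξ) * Complex.exp ξ = 1 := by rw [← Complex.exp_add]; simp
    have h6 : ∑ k ∈ Finset.range (n + 1), k * Φ k v * Complex.exp (-ξ) ^ (k + 1)
        = Complex.exp (-ξ) * ∑ k ∈ Finset.range (n + 1), k * Φ k v * Complex.exp (-ξ) ^ k := by
      rw [Finset.mul_sum]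
      refine Finset.sum_congr rfl fun k _ => by ring
    rw [h6] at h4
    refine (le_of_eq ?_).trans (h4.trans (mul_le_mul_of_nonneg_right (le_max_left _ _)
      (by positivity)))
    congr 1
    linear_combination -h5 - T * hrel

/-- `exists_flat_truncation` on compact sets, on the whole domain of convergence. -/
lemma IsFormalSolution.exists_flat_truncation_of_isCompact [PreconnectedSpace E]
    (hform : IsNormalForm P₀ Q r) (hp : IsCoveringMap p) {a : ℂ} {Φ dΦ : ℕ → E → ℂ}
    (h : IsFormalSolution Q p (motionSource a) Φ dΦ) {w₀ : E} {S dS : ℕ → E → ℂ}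
    (hS : IsClock Q p w₀ S dS) {K : Set E} (hK : IsCompact K) {A : ℝ} (hA : 1 ≤ A)
    (hKA : ∀ v ∈ K, ClockBound Q p S A v) (n : ℕ) :
    ∃ M : ℝ, 0 ≤ M ∧ ∀ v ∈ K, ∀ ξ : ℂ, max (Real.log (2 * A)) 1 < ξ.re →
      ‖truncation a Φ n (ξ, v) - truncation a Φ n (clock S ξ v, w₀)‖
        ≤ M * Real.exp (-ξ.re) ^ (n + 1) := by
  obtain ⟨ρ, M, hM⟩ : ∃ ρ M : ℝ, ∀ v ∈ K, ∀ ξ : ℂ, ρ < ξ.re →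
      ‖truncation a Φ n (ξ, v) - truncation a Φ n (clock S ξ v, w₀)‖
        ≤ M * Real.exp (-ξ.re) ^ (n + 1) := by
    refine hK.induction_on (p := fun K => ∃ ρ M : ℝ, ∀ v ∈ K, ∀ ξ : ℂ, ρ < ξ.re →
      ‖truncation a Φ n (ξ, v) - truncation a Φ n (clock S ξ v, w₀)‖
        ≤ M * Real.exp (-ξ.re) ^ (n + 1)) ⟨0, 0, fun v hv => hv.elim⟩ ?_ ?_ ?_
    · rintro s t hst ⟨ρ, M, h⟩
      exact ⟨ρ, M, fun v hv => h v (hst hv)⟩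
    · rintro s t ⟨ρ, M, h⟩ ⟨ρ', M', h'⟩
      refine ⟨max ρ ρ', max M M', ?_⟩
      rintro v (hv | hv) ξ hξ
      · exact (h v hv ξ ((le_max_left _ _).trans_lt hξ)).trans (by gcongr; exact le_max_left _ _)
      · exact (h' v hv ξ ((le_max_right _ _).trans_lt hξ)).trans (by gcongr; exact le_max_right _ _)
    · intro w _
      obtain ⟨V, hV, h⟩ := h.exists_flat_truncation hform hp hS n w
      exact ⟨V, mem_nhdsWithin_of_mem_nhds hV, h⟩
  choose B hB using fun k => hK.exists_bound_of_continuousOn (h.continuous hp k).continuousOn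
  set C := 4 * A + ‖a‖ + ∑ k ∈ Finset.range (n + 1), (B k + ‖Φ k w₀‖) with hC
  -- In the remaining range `ξ.re ≤ ρ` a mere bound suffices, since `exp (ρ - ξ.re) ≥ 1` there.
  refine ⟨max |M| (|C| * Real.exp ρ ^ (n + 1)), by positivity, fun v hv ξ hξ => ?_⟩
  rw [max_lt_iff] at hξ
  by_cases hρ : ρ < ξ.re
  · refine (hM v hv ξ hρ).trans ?_
    gcongr
    exact (le_abs_self _).trans (le_max_left _ _)
  · obtain ⟨hc1, hc2, -⟩ := (hKA v hv).clock hp hA hξ.1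
    have h1 := norm_truncation_sub_le (a := a) (n := n) (w₀ := w₀) hξ.2.le hc1 hc2
      fun k _ => hB k v hv
    calc _ ≤ |C| * 1 := by rw [mul_one]; exact h1.trans (le_abs_self _)
      _ ≤ |C| * (Real.exp ρ * Real.exp (-ξ.re)) ^ (n + 1) := by
          gcongr
          refine one_le_pow₀ ?_
          rw [← Real.exp_add]
          exact Real.one_le_exp (by linarith)
      _ = |C| * Real.exp ρ ^ (n + 1) * Real.exp (-ξ.re) ^ (n + 1) := by rw [mul_pow]; ring
      _ ≤ _ := by gcongr; exact le_max_right _ _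

end Truncation

/-! ### The region and its admissible curves -/

section Curves

variable {P₀ : Polynomial ℂ} {E : Type*} [TopologicalSpace E] {p : E → Punctured P₀}
  {Q : ℂ → ℂ → ℂ} {r : ℝ}

/-- The part of the covering surface over the domain is covered by forward translates of a compact
set. -/
lemma exists_compact_cover {g : E ≃ₜ E} {S : Set E} (hS : IsRegularDomain p g S)
    {M₀ ε R₀ : ℝ} (hε : 0 < ε) {D : Set (ℂ × E)} (hD : D ⊆ domainOne p S M₀ ε R₀) :
    ∃ B : Set E, IsCompact B ∧ ∀ q ∈ D, ∃ N : ℕ, ∃ b ∈ B, g^[N] b = q.2 := by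
  -- The strict inequalities of the domain are closed up. Keeping a distance `ε > 0` from the roots
  -- makes this set compact inside the punctured plane.
  let Z : Set (Punctured P₀) := {y | ‖(y : ℂ)‖ ≤ M₀ ∧ ∀ c : ℂ, P₀.IsRoot c → ε ≤ ‖(y : ℂ) - c‖}
  have himg : Subtype.val '' Z = Metric.closedBall (0 : ℂ) M₀ ∩
      ⋂ c ∈ {c : ℂ | P₀.IsRoot c}, {y | ε ≤ ‖y - c‖} := by
    ext y
    simp only [mem_image, mem_inter_iff, mem_closedBall_zero_iff, mem_iInter]
    constructor
    · rintro ⟨y, ⟨h1, h2⟩, rfl⟩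
      exact ⟨h1, h2⟩
    · rintro ⟨h1, h2⟩
      refine ⟨⟨y, fun h0 => ?_⟩, ⟨h1, h2⟩, rfl⟩
      have h3 : ε ≤ ‖y - y‖ := h2 y h0
      simp only [sub_self, norm_zero] at h3
      linarith
  have hZ' : IsCompact (Subtype.val '' Z) := by
    rw [himg]
    refine (isCompact_closedBall _ _).inter_right (isClosed_biInter fun c _ => ?_)
    exact isClosed_le continuous_const (continuous_id.sub continuous_const).norm
  have hZ : IsCompact Z := Topology.IsInducing.subtypeVal.isCompact_iff.2 hZ'
  obtain ⟨B, hB, hcov⟩ := hS.forward Z hZ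
  refine ⟨B, hB, fun q hq => ?_⟩
  obtain ⟨-, h2, h3, h4⟩ := hD hq
  obtain ⟨N, b, hb, hbq⟩ := mem_iUnion.1 (hcov ⟨h2, h3.le, fun c hc => (h4 c hc).le⟩)
  exact ⟨N, b, hb, hbq⟩

variable {a : ℂ} {F : ℕ → E → ℂ} {D : Set (ℂ × E)} {b L : ℝ} {n : ℕ} {γ : ℝ → ℂ} {η : ℝ → E}

lemma IsAdmissibleCurve.continuousOn (h : IsAdmissibleCurve Q p a F D b L n γ η) (T : ℝ) :
    ContinuousOn γ (Icc 0 T) := by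
  obtain ⟨τ, hτ, h0, hlim, hd⟩ := h.piecewise
  obtain ⟨m, hm⟩ := (hlim.eventually_ge_atTop T).exists
  have : ∀ m : ℕ, ContinuousOn γ (Icc (τ 0) (τ m)) := fun m => by
    induction m with
    | zero => simp
    | succ m ih =>
      rw [← Icc_union_Icc_eq_Icc (hτ.monotone m.zero_le) (hτ.monotone m.le_succ)]
      exact ih.union_of_isClosed (hd m).continuousOn isClosed_Icc isClosed_Icc
  refine (this m).mono ?_
  rw [h0]
  exact Icc_subset_Icc_right hm

/-- Since `γ = log x`, the integral of `|dx| / |x|` is the length of `γ`. The fundamental theorem is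
applied off the countable set of break points. -/
lemma IsAdmissibleCurve.norm_sub_le (h : IsAdmissibleCurve Q p a F D b L n γ η) {t : ℝ}
    (ht : 0 ≤ t) :
    ‖γ t - γ 0‖ ≤ max L 0 * Real.log (‖Complex.exp (γ t) / Complex.exp (γ 0)‖ + 1) := by
  have hlog : 0 ≤ Real.log (‖Complex.exp (γ t) / Complex.exp (γ 0)‖ + 1) :=
    Real.log_nonneg (by linarith [norm_nonneg (Complex.exp (γ t) / Complex.exp (γ 0))])
  rcases ht.eq_or_lt with rfl | ht
  · rw [sub_self, norm_zero]; positivity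
  obtain ⟨τ, hτ, h0, hlim, hd⟩ := h.piecewise
  obtain ⟨m, hm⟩ := (hlim.eventually_ge_atTop t).exists
  have hderiv : ∀ i, ∀ s ∈ Ioo (τ i) (τ (i + 1)), DifferentiableAt ℝ γ s := fun i s hs =>
    ((hd i).differentiableOn one_ne_zero).differentiableAt (Icc_mem_nhds hs.1 hs.2)
  have hint : ∀ i, IntervalIntegrable (deriv γ) MeasureTheory.volume (τ i) (τ (i + 1)) := fun i => by
    have hlt := hτ (Nat.lt_succ_self i)
    have hc := (hd i).continuousOn_derivWithin (uniqueDiffOn_Icc hlt) le_rfl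
    rw [← uIcc_of_le hlt.le] at hc
    refine (hc.intervalIntegrable (μ := MeasureTheory.volume)).congr_ae ?_
    rw [uIoc_of_le hlt.le, ← MeasureTheory.restrict_Ioo_eq_restrict_Ioc]
    filter_upwards [MeasureTheory.ae_restrict_mem measurableSet_Ioo] with s hs
    rw [uIcc_of_le hlt.le]
    exact derivWithin_of_mem_nhds (Icc_mem_nhds hs.1 hs.2)
  have hint' : IntervalIntegrable (deriv γ) MeasureTheory.volume 0 t := by
    have h1 := IntervalIntegrable.trans_iterate (a := τ) (n := m) fun i _ => hint i
    rw [h0] at h1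
    refine h1.mono_set ?_
    rw [uIcc_of_le ht.le, uIcc_of_le (ht.le.trans hm)]
    exact Icc_subset_Icc_right hm
  have hftc : ∫ s in (0 : ℝ)..t, deriv γ s = γ t - γ 0 := by
    refine MeasureTheory.integral_eq_of_hasDerivAt_off_countable_of_le γ (deriv γ) ht.le
      (countable_range τ) (h.continuousOn t) (fun s hs => ?_) hint'
    have hex : ∃ i, s < τ i := ((hlim.eventually_gt_atTop s)).exists
    have hfind := Nat.find_spec hex
    have hne : Nat.find hex ≠ 0 := fun h1 => by
      rw [h1, h0] at hfind; exact absurd hs.1.1 (not_lt.2 hfind.le)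
    obtain ⟨i, hi⟩ := Nat.exists_eq_succ_of_ne_zero hne
    have hmin := Nat.find_min hex (m := i) (by omega)
    refine (hderiv i s ⟨lt_of_le_of_ne (not_lt.1 hmin) fun h2 => hs.2 ⟨i, h2⟩, ?_⟩).hasDerivAt
    rw [hi] at hfind
    exact hfind
  rw [← hftc]
  refine (intervalIntegral.norm_integral_le_integral_norm ht.le).trans ((h.length 0 t le_rfl ht).trans ?_)
  exact mul_le_mul_of_nonneg_right (le_max_left _ _) hlog

lemma IsAdmissibleCurve.norm_sub_le_mul (h : IsAdmissibleCurve Q p a F D b L n γ η) {t : ℝ}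
    (ht : 0 ≤ t) : ‖γ t - γ 0‖ ≤ max L 0 * ‖Complex.exp (γ t) / Complex.exp (γ 0)‖ := by
  refine (h.norm_sub_le ht).trans (mul_le_mul_of_nonneg_left ?_ (le_max_right _ _))
  have := Real.log_le_sub_one_of_pos
    (show 0 < ‖Complex.exp (γ t) / Complex.exp (γ 0)‖ + 1 by positivity)
  linarith

/-- `log (c x + 1)` is negligible against `x`. -/
lemma eventually_mul_log_lt (A B : ℝ) {c : ℝ} (hc : 0 < c) :
    ∀ᶠ x : ℝ in atTop, A + B * Real.log (c * x + 1) < x := by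
  have ht : Tendsto (fun x : ℝ => c * x + 1) atTop atTop :=
    tendsto_atTop_add_const_right _ _ (tendsto_id.const_mul_atTop hc)
  have h1 := (Real.isLittleO_log_id_atTop.comp_tendsto ht).def
    (show (0 : ℝ) < 1 / (2 * c * (|B| + 1)) by positivity)
  filter_upwards [h1, eventually_gt_atTop (2 * A + 1 / c), eventually_ge_atTop 0] with x hx hxA hx0
  simp only [Function.comp_apply, id, Real.norm_eq_abs] at hx
  rw [abs_of_nonneg (show 0 ≤ c * x + 1 by positivity)] at hx
  have h2 : B * Real.log (c * x + 1) ≤ (|B| + 1) * |Real.log (c * x + 1)| := by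
    refine (le_abs_self _).trans ?_
    rw [abs_mul]
    gcongr
    linarith
  have h3 : (|B| + 1) * (1 / (2 * c * (|B| + 1)) * (c * x + 1)) = x / 2 + 1 / c / 2 := by
    field_simp
  have h4 : (|B| + 1) * |Real.log (c * x + 1)| ≤ x / 2 + 1 / c / 2 := by
    rw [← h3]; gcongr
  linarith

/-- Along an admissible curve `F₀` is unbounded. -/
lemma IsAdmissibleCurve.exists_lt_norm (h : IsAdmissibleCurve Q p a F D b L 0 γ η) (C : ℝ) :
    ∃ t, 0 ≤ t ∧ C < ‖F 0 (η t)‖ := by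
  by_contra! hcon
  set x₀ := ‖Complex.exp (γ 0)‖ with hx₀
  have hx₀pos : 0 < x₀ := by simp [hx₀]
  have hev := h.escape.eventually (eventually_mul_log_lt
    (C + ‖truncation a F 0 (γ 0, η 0)‖ + ‖a‖ * ‖γ 0‖) (‖a‖ * max L 0) (inv_pos.2 hx₀pos))
  obtain ⟨t, ht, ht0⟩ := (hev.and (eventually_ge_atTop 0)).exists
  have hlev := h.level t ht0
  -- The level set of `C_0` expresses `x` by `log x` and `F₀`; with `F₀` bounded, `x` would grow at
  -- most logarithmically in itself.
  have h1 : Complex.exp (γ t) = a * γ 0 + a * (γ t - γ 0) + F 0 (η t)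
      - truncation a F 0 (γ 0, η 0) := by
    rw [← hlev]; simp [truncation]; ring
  have h2 := h.norm_sub_le ht0
  rw [norm_div, div_eq_inv_mul] at h2
  have h3 : ‖Complex.exp (γ t)‖ ≤ ‖a‖ * ‖γ 0‖ + ‖a‖ * (max L 0 * Real.log (x₀⁻¹ *
      ‖Complex.exp (γ t)‖ + 1)) + C + ‖truncation a F 0 (γ 0, η 0)‖ := by
    conv_lhs => rw [h1]
    refine (_root_.norm_sub_le _ _).trans (add_le_add_left ((norm_add₃_le).trans ?_) _)
    rw [norm_mul, norm_mul]
    gcongr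
    exact hcon t ht0
  linarith

/-- A function with vanishing derivative is constant on connected open sets. -/
lemma eqOn_const_of_hasCoverDerivAt_zero (hp : IsCoveringMap p) {V : Set E}
    (hV : IsOpen V) (hVc : IsPreconnected V) {f : E → ℂ}
    (hf : ∀ v ∈ V, HasCoverDerivAt p f 0 v) {v w : E} (hv : v ∈ V) (hw : w ∈ V) : f v = f w := by
  have : PreconnectedSpace V := isPreconnected_iff_preconnectedSpace.1 hVc
  have hloc : IsLocallyConstant fun v : V => f v := by
    rw [IsLocallyConstant.iff_eventually_eq]
    intro v
    have h1 : ∀ᶠ u in 𝓝 (v : E), HasCoverDerivAt p f 0 u := by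
      filter_upwards [hV.mem_nhds v.2] with u hu using hf u hu
    exact continuous_subtype_val.continuousAt.eventually
      (eventually_eq_of_hasCoverDerivAt_zero hp h1)
  exact hloc.apply_eq_of_preconnectedSpace ⟨v, hv⟩ ⟨w, hw⟩

lemma mem_connectedComponentIn_of_curve {W : Set E} (hη : ContinuousOn η (Ici 0))
    (hW : ∀ t, 0 ≤ t → η t ∈ W) {t : ℝ} (ht : 0 ≤ t) : η t ∈ connectedComponentIn W (η 0) :=
  (isPreconnected_Ici.image η hη).subset_connectedComponentIn (mem_image_of_mem η self_mem_Ici)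
    (image_subset_iff.2 hW) (mem_image_of_mem η ht)

end Curves

/-! ### Global extension of the formal constant and its deck invariance -/

lemma apply_iterate_deck {E : Type*} {g : E → E} {f : E → ℂ} {κ : ℂ} (hf : ∀ w, f (g w) = f w + κ) (N : ℕ)
    (w : E) : f (g^[N] w) = f w + N * κ := by
  induction N with
  | zero => simp
  | succ N ih => rw [Function.iterate_succ_apply', hf, ih]; push_cast; ring

/-- The first coefficient in which the derivatives of two formal solutions differ. -/
lemma deriv_sub_deriv_eq {P₀ : Polynomial ℂ} {E : Type*} {p : E → Punctured P₀}
    {Q : ℂ → ℂ → ℂ} {r : ℝ} {a : ℂ} {F dF G dG : ℕ → E → ℂ} (hform : IsNormalForm P₀ Q r) {k : ℕ} {w : E}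
    (hF : ∀ k, formalDxCoeff Q p a F dF k w = 0) (hG : ∀ k, formalDxCoeff Q p a G dG k w = 0)
    (h : ∀ j < k, dF j w = dG j w) :
    dF k w - dG k w = ((k - 1 : ℕ) : ℂ) * (F (k - 1) w - G (k - 1) w) * dG 0 w := by
  rw [deriv_eq_of_coeff hform (hF k), deriv_eq_of_coeff hform (hG k),
    deriv_eq_of_coeff hform (hG 0), Finset.sum_congr rfl fun j hj => by
      rw [h j (Finset.mem_range.1 hj)]]
  simp
  ring

/-- Two formal solutions have the same derivatives if their coefficients agree as soon as the
derivatives of the preceding ones do. -/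
lemma eqOn_deriv_of_step {P₀ : Polynomial ℂ} {E : Type*} {p : E → Punctured P₀}
    {Q : ℂ → ℂ → ℂ} {r : ℝ} {a : ℂ} {F dF G dG : ℕ → E → ℂ} (hform : IsNormalForm P₀ Q r) {V : Set E}
    (hF : ∀ k, ∀ w ∈ V, formalDxCoeff Q p a F dF k w = 0)
    (hG : ∀ k, ∀ w ∈ V, formalDxCoeff Q p a G dG k w = 0)
    (step : ∀ k : ℕ, (∀ j < k + 1, ∀ v ∈ V, dF j v = dG j v) → ∀ v ∈ V, (k : ℂ) * (F k v - G k v) = 0)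
    (k : ℕ) : ∀ v ∈ V, dF k v = dG k v := by
  induction k using Nat.strong_induction_on with
  | _ k ih =>
    intro v hv
    have h1 := deriv_sub_deriv_eq hform (fun k => hF k v hv) (fun k => hG k v hv)
      (k := k) fun j hj => ih j hj v hv
    rw [← sub_eq_zero, h1]
    rcases k with _ | k
    · simp
    · rw [Nat.add_sub_cancel, step k ih v hv, zero_mul]

section Invariance

variable {P₀ : Polynomial ℂ} {E : Type*} [TopologicalSpace E] {p : E → Punctured P₀}
  {Q : ℂ → ℂ → ℂ} {r : ℝ} {a : ℂ} {F dF : ℕ → E → ℂ}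

/-- On a set that is covered by the forward translates of a compact set and in every component of
which `F₀` is unbounded, a formal constant of motion extends, up to locally constant functions in
`F₀`, to a global one that is invariant under the deck transformation up to a constant in `Φ₀`. -/
lemma exists_invariant_solution [SimplyConnectedSpace E] (hform : IsNormalForm P₀ Q r)
    (hp : IsCoveringMap p) {g : E ≃ₜ E} (hg : ∀ w, p (g w) = p w) {W : Set E} (hW : IsOpen W)
    (hWne : W.Nonempty) (hd : ∀ k, ∀ w ∈ W, HasCoverDerivAt p (F k) (dF k w) w)
    (hc : ∀ k, ∀ w ∈ W, formalDxCoeff Q p a F dF k w = 0)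
    (hbd : ∀ k, 1 ≤ k → ∃ M : ℝ, ∀ w ∈ W, ‖F k w‖ ≤ M)
    (hunb : ∀ w ∈ W, ∀ C : ℝ, ∃ v ∈ connectedComponentIn W w, C < ‖F 0 v‖)
    {B : Set E} (hB : IsCompact B) (hcov : ∀ w ∈ W, ∃ N : ℕ, ∃ b ∈ B, g^[N] b = w) :
    ∃ (Φ dΦ : ℕ → E → ℂ) (κ : ℂ), IsFormalSolution Q p (motionSource a) Φ dΦ ∧ κ ≠ 0 ∧
      (∀ w, Φ 0 (g w) = Φ 0 w + κ) ∧ (∀ k, 1 ≤ k → ∀ w, Φ k (g w) = Φ k w) ∧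
      (∀ k, 1 ≤ k → ∀ w ∈ W, F k w = Φ k w) ∧
      ∀ w ∈ W, HasCoverDerivAt p (fun v => F 0 v - Φ 0 v) 0 w := by
  have := locallyPathConnectedSpace_of_isCoveringMap hp
  obtain ⟨w₀, hw₀⟩ := hWne
  obtain ⟨Φ, dΦ, hΦ, hΦ₀⟩ := exists_isFormalSolution hform hp w₀ (motionSource a) fun k => F k w₀
  have hΦc : ∀ k w, formalDxCoeff Q p a Φ dΦ k w = 0 := fun k w => hΦ.coeff k w
  have hcomp : ∀ w ∈ W, IsOpen (connectedComponentIn W w) ∧ IsPreconnected (connectedComponentIn W w)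
      ∧ connectedComponentIn W w ⊆ W ∧ w ∈ connectedComponentIn W w := fun w hw =>
    ⟨hW.connectedComponentIn, isPreconnected_connectedComponentIn, connectedComponentIn_subset W w,
      mem_connectedComponentIn hw⟩
  have hconst : ∀ k, ∀ w ∈ W, (∀ v ∈ connectedComponentIn W w, dF k v = dΦ k v) →
      ∀ v ∈ connectedComponentIn W w, F k v - Φ k v = F k w - Φ k w := by
    intro k w hw h v hv
    obtain ⟨h1, h2, h3, h4⟩ := hcomp w hw
    refine eqOn_const_of_hasCoverDerivAt_zero hp h1 h2 (f := fun v => F k v - Φ k v)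
      (fun u hu => ?_) hv h4
    have := (hd k u (h3 hu)).sub hp (hΦ.hasDeriv k u)
    rwa [h u hu, sub_self] at this
  -- the two solutions agree in the component of the base point
  have hV₀ : ∀ k, ∀ v ∈ connectedComponentIn W w₀, F k v = Φ k v := by
    obtain ⟨-, -, h3, h4⟩ := hcomp w₀ hw₀
    have key : ∀ k, (∀ v ∈ connectedComponentIn W w₀, dF k v = dΦ k v) →
        ∀ v ∈ connectedComponentIn W w₀, F k v = Φ k v := fun k h v hv => by
      have := hconst k w₀ hw₀ h v hv
      rwa [hΦ₀, sub_self, sub_eq_zero] at this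
    exact fun k => key k (eqOn_deriv_of_step hform (fun k w hw => hc k w (h3 hw))
      (fun k w _ => hΦc k w) (fun k h v hv => by
        rw [key k (h k k.lt_succ_self) v hv, sub_self, mul_zero]) k)
  choose MB hMB using fun k => hB.exists_bound_of_continuousOn (hΦ.continuous hp k).continuousOn
  have hgc : ∀ k w, formalDxCoeff Q p a (fun k w => Φ k (g w)) (fun k w => dΦ k (g w)) k w = 0 :=
    fun k w => by
      have := hΦc k (g w)
      rw [formalDxCoeff, hg] at this
      exact this
  have hgconst : ∀ k, (∀ v, dΦ k (g v) = dΦ k v) → ∃ c, ∀ w, Φ k (g w) = Φ k w + c := by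
    intro k h
    refine ⟨Φ k (g w₀) - Φ k w₀, fun w => ?_⟩
    have := eq_of_hasCoverDerivAt_zero hp (f := fun v => Φ k (g v) - Φ k v) (fun v => by
      have := ((hΦ.hasDeriv k (g v)).comp_deck hg).sub hp (hΦ.hasDeriv k v)
      rwa [h v, sub_self] at this) w w₀
    rw [← this]; ring
  have hg0 : ∀ v, dΦ 0 (g v) = dΦ 0 v := fun v => by
    have := deriv_sub_deriv_eq hform (fun k => hgc k v) (fun k => hΦc k v) (k := 0)
      fun j hj => absurd hj (Nat.not_lt_zero j)
    simpa [sub_eq_zero] using this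
  obtain ⟨κ, hκ⟩ := hgconst 0 hg0
  -- `Φ₀` agrees with the unbounded `F₀` here and equals a bounded term plus `N κ`, so arbitrarily
  -- large translates meet the component.
  have hlarge : ∀ T : ℝ, ∃ (N : ℕ) (b : E), b ∈ B ∧ g^[N] b ∈ connectedComponentIn W w₀ ∧
      T < ‖(N : ℂ) * κ‖ := fun T => by
    obtain ⟨v, hv, hT⟩ := hunb w₀ hw₀ (MB 0 + T)
    obtain ⟨N, b, hb, rfl⟩ := hcov v ((hcomp w₀ hw₀).2.2.1 hv)
    rw [hV₀ 0 _ hv, apply_iterate_deck hκ] at hT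
    exact ⟨N, b, hb, hv, by linarith [norm_add_le (Φ 0 b) (N * κ), hMB 0 b hb]⟩
  have hκ0 : κ ≠ 0 := by
    rintro rfl
    obtain ⟨N, b, -, -, h⟩ := hlarge 0
    simp at h
  have hginv : ∀ k, 1 ≤ k → (∀ v, dΦ k (g v) = dΦ k v) → ∀ w, Φ k (g w) = Φ k w := by
    intro k hk h
    obtain ⟨c, hcc⟩ := hgconst k h
    obtain ⟨M, hM⟩ := hbd k hk
    -- A nonzero period would make `Φ_k`, equal to the bounded `F_k` in this component, grow like `N
    -- c`.
    suffices c = 0 by simpa [this] using hcc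
    by_contra hc0
    obtain ⟨N, b, hb, hN, hT⟩ := hlarge ((M + MB k) * ‖κ‖ / ‖c‖)
    have h1 := hM _ ((hcomp w₀ hw₀).2.2.1 hN)
    rw [hV₀ k _ hN, apply_iterate_deck hcc] at h1
    have h2 := norm_sub_le (Φ k b + N * c) (Φ k b)
    rw [add_sub_cancel_left, norm_mul] at h2
    rw [norm_mul, div_lt_iff₀ (norm_pos_iff.2 hc0)] at hT
    have h3 : ‖(N : ℂ)‖ * ‖c‖ ≤ M + MB k := by linarith [hMB k b hb]
    have h4 := mul_le_mul_of_nonneg_right h3 (norm_nonneg κ)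
    linarith
  have hgd : ∀ k v, dΦ k (g v) = dΦ k v := fun k v =>
    eqOn_deriv_of_step hform (V := univ) (dF := fun k w => dΦ k (g w)) (fun k w _ => hgc k w)
      (fun k w _ => hΦc k w) (fun k h v _ => by
        rcases k.eq_zero_or_pos with rfl | hk
        · simp
        · rw [hginv k hk (fun v => h k k.lt_succ_self v (mem_univ v)) v, sub_self, mul_zero])
      k v (mem_univ v)
  have hΦbd : ∀ k, 1 ≤ k → ∀ w ∈ W, ‖Φ k w‖ ≤ MB k := fun k hk w hw => by
    obtain ⟨N, b, hb, rfl⟩ := hcov w hw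
    rw [apply_iterate_deck (κ := 0) (f := Φ k) (fun w => by rw [hginv k hk (hgd k), add_zero]),
      mul_zero, add_zero]
    exact hMB k b hb
  -- in every component, the difference is constant, and zero from the second coefficient on
  have hstep : ∀ w ∈ W, ∀ k : ℕ, (∀ j < k + 1, ∀ v ∈ connectedComponentIn W w, dF j v = dΦ j v) →
      ∀ v ∈ connectedComponentIn W w, (k : ℂ) * (F k v - Φ k v) = 0 := by
    intro w hw k h v hv
    obtain ⟨h1, h2, h3, h4⟩ := hcomp w hw
    set c := F k w - Φ k w with hcdef
    have hk := hconst k w hw (h k k.lt_succ_self)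
    rw [hk v hv]
    by_contra hne
    -- A constant discrepancy `c` at order `k` forces the discrepancy `k c Φ₀` plus a constant at
    -- order `k + 1`, because `dΦ 0 = 1 / P₀`. That is unbounded unless `k c = 0`.
    have h5 : ∀ u ∈ connectedComponentIn W w,
        (F (k + 1) u - Φ (k + 1) u) - k * c * Φ 0 u = (F (k + 1) w - Φ (k + 1) w) - k * c * Φ 0 w :=
      fun u hu => eqOn_const_of_hasCoverDerivAt_zero hp h1 h2
        (f := fun u => (F (k + 1) u - Φ (k + 1) u) - k * c * Φ 0 u) (fun u hu => by
          have h6 := ((hd (k + 1) u (h3 hu)).sub hp (hΦ.hasDeriv (k + 1) u)).sub hp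
            ((hΦ.hasDeriv 0 u).const_mul hp (k * c))
          have h7 := deriv_sub_deriv_eq hform (fun k => hc k u (h3 hu)) (fun k => hΦc k u)
            (k := k + 1) fun j hj => h j hj u hu
          rwa [h7, Nat.add_sub_cancel, hk u hu, sub_self] at h6) hu h4
    obtain ⟨M, hM⟩ := hbd (k + 1) (by omega)
    set C := ‖(F (k + 1) w - Φ (k + 1) w) - k * c * Φ 0 w‖ with hC
    obtain ⟨u, hu, hlt⟩ := hunb w hw (‖F 0 w - Φ 0 w‖ + (M + MB (k + 1) + C) / ‖(k : ℂ) * c‖)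
    have h8 := hconst 0 w hw (h 0 k.succ_pos) u hu
    have h9 : F 0 u = (F 0 w - Φ 0 w) + Φ 0 u := by rw [← h8]; ring
    rw [h9] at hlt
    have h10 : (M + MB (k + 1) + C) / ‖(k : ℂ) * c‖ < ‖Φ 0 u‖ := by
      linarith [norm_add_le (F 0 w - Φ 0 w) (Φ 0 u)]
    rw [div_lt_iff₀ (norm_pos_iff.2 hne)] at h10
    have h11 : k * c * Φ 0 u = F (k + 1) u - Φ (k + 1) u
        - ((F (k + 1) w - Φ (k + 1) w) - k * c * Φ 0 w) := by rw [← h5 u hu]; ring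
    have h12 : ‖Φ 0 u‖ * ‖(k : ℂ) * c‖ ≤ M + MB (k + 1) + C := by
      rw [mul_comm, ← norm_mul, h11]
      refine (norm_sub_le _ _).trans (add_le_add ((norm_sub_le _ _).trans (add_le_add ?_ ?_)) le_rfl)
      · exact hM u (h3 hu)
      · exact hΦbd (k + 1) (by omega) u (h3 hu)
    linarith
  have hderiv : ∀ k, ∀ w ∈ W, ∀ v ∈ connectedComponentIn W w, dF k v = dΦ k v := fun k w hw =>
    eqOn_deriv_of_step hform (fun k v hv => hc k v ((hcomp w hw).2.2.1 hv))
      (fun k v _ => hΦc k v) (hstep w hw) k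
  refine ⟨Φ, dΦ, κ, hΦ, hκ0, hκ, fun k hk => hginv k hk (hgd k), fun k hk w hw => ?_,
    fun w hw => ?_⟩
  · have := hstep w hw k (fun j _ => hderiv j w hw) w (hcomp w hw).2.2.2
    rw [mul_eq_zero, or_iff_right (by exact_mod_cast (by omega : k ≠ 0))] at this
    exact sub_eq_zero.1 this
  · have := (hd 0 w hw).sub hp (hΦ.hasDeriv 0 w)
    rwa [hderiv 0 w hw w (hcomp w hw).2.2.2, sub_self] at this

end Invariance

/-! ### Fatou coordinates of the return map -/

section Fatou

/-- In the variable `ξ = log s`, the map `Λ` is `s ↦ s + κ + O(1/s)`, and the functions `c n` solve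
the Abel equation `c (Λ ξ) = c ξ - κ` up to an error `O(s ^ (-n-1))`. -/
structure FatouData (Λ : ℂ → ℂ) (c : ℕ → ℂ → ℂ) (κ : ℂ) (ρ K : ℝ) : Prop where
  ne_zero : κ ≠ 0
  nonneg : 0 ≤ K
  step : ∀ ξ : ℂ, ρ < ξ.re → ‖Complex.exp (Λ ξ) - Complex.exp ξ - κ‖ ≤ K * Real.exp (-ξ.re)
  diff : ∀ ξ : ℂ, ρ < ξ.re → DifferentiableAt ℂ Λ ξ
  diff_coord : ∀ n, Differentiable ℂ (c n)
  abel : ∀ n, ∃ M : ℝ, 0 ≤ M ∧ ∀ ξ : ℂ, ρ < ξ.re →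
    ‖c n (Λ ξ) + κ - c n ξ‖ ≤ M * Real.exp (-ξ.re) ^ (n + 1)
  succ : ∀ n, ∃ B : ℝ, ∀ ξ : ℂ, ‖c (n + 1) ξ - c n ξ‖ ≤ B * Real.exp (-ξ.re) ^ (n + 1)

/-- The points `ξ = log s` with `|s| > R` for which the direction of `s` stays away from `-κ`. -/
def sector (κ : ℂ) (δ R : ℝ) : Set ℂ :=
  {ξ | R < ‖Complex.exp ξ‖ ∧
    -((1 - δ) * ‖Complex.exp ξ‖ * ‖κ‖) < (Complex.exp ξ * (starRingEnd ℂ) κ).re}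

lemma isOpen_sector (κ : ℂ) (δ R : ℝ) : IsOpen (sector κ δ R) := by
  refine (isOpen_lt continuous_const Complex.continuous_exp.norm).inter
    (t := {ξ | -((1 - δ) * ‖Complex.exp ξ‖ * ‖κ‖) < (Complex.exp ξ * (starRingEnd ℂ) κ).re})
    (isOpen_lt ?_ ?_)
  · exact ((continuous_const.mul Complex.continuous_exp.norm).mul continuous_const).neg
  · exact Complex.continuous_re.comp (Complex.continuous_exp.mul continuous_const)

/-- By the angle condition `s` and `τ κ` cannot cancel: the square of the sum is compared with `(δ /
2) (‖s‖ + τ ‖κ‖) ^ 2`. -/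
lemma norm_add_mul_ge {s κ : ℂ} {δ τ : ℝ} (hδ0 : 0 ≤ δ) (hδ1 : δ ≤ 1) (hτ : 0 ≤ τ)
    (h : -((1 - δ) * ‖s‖ * ‖κ‖) ≤ (s * (starRingEnd ℂ) κ).re) :
    Real.sqrt (δ / 2) * (‖s‖ + τ * ‖κ‖) ≤ ‖s + τ * κ‖ := by
  have h1 : ‖s + τ * κ‖ ^ 2 = ‖s‖ ^ 2 + 2 * τ * (s * (starRingEnd ℂ) κ).re + (τ * ‖κ‖) ^ 2 := by
    rw [mul_pow, Complex.sq_norm, Complex.sq_norm, Complex.sq_norm]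
    simp [Complex.normSq_apply]
    ring
  refine le_of_sq_le_sq ?_ (norm_nonneg _)
  rw [h1, mul_pow, Real.sq_sqrt (by positivity)]
  have h2 : 2 * τ * -((1 - δ) * ‖s‖ * ‖κ‖) ≤ 2 * τ * (s * (starRingEnd ℂ) κ).re := by gcongr
  nlinarith [sq_nonneg (‖s‖ - τ * ‖κ‖), mul_nonneg hδ0 (sq_nonneg (‖s‖ - τ * ‖κ‖)),
    mul_nonneg (sub_nonneg.2 hδ1) (sq_nonneg (‖s‖ - τ * ‖κ‖))]

variable {Λ : ℂ → ℂ} {c : ℕ → ℂ → ℂ} {κ : ℂ} {ρ K : ℝ}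

/-- The orbits of `Λ` that start in a sector escape to infinity linearly. -/
lemma FatouData.exists_growth (h : FatouData Λ c κ ρ K) {δ : ℝ} (hδ : 0 < δ) (hδ1 : δ ≤ 1) :
    ∃ R b : ℝ, 1 ≤ R ∧ ‖κ‖ ≤ R ∧ 0 < b ∧ ∀ ξ ∈ sector κ δ R, ∀ N : ℕ,
      ρ < (Λ^[N] ξ).re ∧ b * (‖Complex.exp ξ‖ + N * ‖κ‖) ≤ ‖Complex.exp (Λ^[N] ξ)‖ := by
  have hκ := norm_pos_iff.2 h.ne_zero
  set b := Real.sqrt (δ / 2) / 2 with hb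
  have hb0 : 0 < b := by positivity
  -- `exp ρ / b` keeps the orbit in the domain of `Λ`; `K / (b ^ 2 ‖κ‖)` makes the error of each
  -- step at most `b ‖κ‖`.
  obtain ⟨R, hR1, hR2, hR3, hR4⟩ : ∃ R : ℝ, 1 ≤ R ∧ ‖κ‖ ≤ R ∧ Real.exp ρ / b ≤ R ∧
      K / (b ^ 2 * ‖κ‖) ≤ R :=
    ⟨max (max 1 ‖κ‖) (max (Real.exp ρ / b) (K / (b ^ 2 * ‖κ‖))), by simp, by simp, by simp, by simp⟩
  refine ⟨R, b, hR1, hR2, hb0, fun ξ hξ N => ?_⟩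
  -- An error of `b ‖κ‖` per step uses only half of the lower bound `2 b (‖s‖ + N ‖κ‖)` for the
  -- straight orbit, so closeness to that orbit still gives linear growth.
  have hgrow : ∀ N : ℕ, ‖Complex.exp (Λ^[N] ξ) - (Complex.exp ξ + N * κ)‖ ≤ N * (b * ‖κ‖) →
      ρ < (Λ^[N] ξ).re ∧ b * (‖Complex.exp ξ‖ + N * ‖κ‖) ≤ ‖Complex.exp (Λ^[N] ξ)‖ := by
    intro N hN
    have h1 := norm_add_mul_ge (s := Complex.exp ξ) (κ := κ) hδ.le hδ1 N.cast_nonneg hξ.2.le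
    rw [Complex.ofReal_natCast, show Real.sqrt (δ / 2) = 2 * b by rw [hb]; ring] at h1
    have h2 := norm_sub_norm_le (Complex.exp ξ + N * κ) (Complex.exp (Λ^[N] ξ))
    rw [norm_sub_rev] at h2
    have h3 : 0 ≤ b * ‖Complex.exp ξ‖ := by positivity
    have h5 : b * (‖Complex.exp ξ‖ + N * ‖κ‖) ≤ ‖Complex.exp (Λ^[N] ξ)‖ := by nlinarith
    refine ⟨?_, h5⟩
    rw [← Real.exp_lt_exp, ← Complex.norm_exp]
    rw [div_le_iff₀ hb0] at hR3
    have h4 : 0 ≤ (N : ℝ) * ‖κ‖ := by positivity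
    nlinarith [hξ.1]
  have hind : ∀ N : ℕ, ‖Complex.exp (Λ^[N] ξ) - (Complex.exp ξ + N * κ)‖ ≤ N * (b * ‖κ‖) := by
    intro N
    induction N with
    | zero => simp
    | succ N ih =>
      obtain ⟨h1, h2⟩ := hgrow N ih
      have h3 := h.step _ h1
      rw [← Function.iterate_succ_apply' Λ N ξ] at h3
      have h4 : K * Real.exp (-(Λ^[N] ξ).re) ≤ b * ‖κ‖ := by
        have h5 : b * R ≤ ‖Complex.exp (Λ^[N] ξ)‖ := by
          have h6 : 0 ≤ (N : ℝ) * ‖κ‖ := by positivity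
          nlinarith [hξ.1]
        rw [Real.exp_neg, ← Complex.norm_exp, ← div_eq_mul_inv, div_le_iff₀ (by
          have : 0 < b * R := by positivity
          linarith)]
        rw [div_le_iff₀ (by positivity)] at hR4
        have h7 : b * ‖κ‖ * (b * R) ≤ b * ‖κ‖ * ‖Complex.exp (Λ^[N] ξ)‖ := by gcongr
        linarith
      have h8 : Complex.exp (Λ^[N + 1] ξ) - (Complex.exp ξ + ((N + 1 : ℕ) : ℂ) * κ)
          = (Complex.exp (Λ^[N + 1] ξ) - Complex.exp (Λ^[N] ξ) - κ)
            + (Complex.exp (Λ^[N] ξ) - (Complex.exp ξ + N * κ)) := by push_cast; ring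
      rw [h8]
      refine (norm_add_le _ _).trans ?_
      push_cast
      linarith
  exact hgrow N (hind N)

/-- The Fatou coordinate: the limit of `c 1 (Λ^N ξ) + N κ`. -/
noncomputable def fatouCoord (Λ : ℂ → ℂ) (c : ℕ → ℂ → ℂ) (κ ξ : ℂ) : ℂ :=
  limUnder atTop fun N : ℕ => c 1 (Λ^[N] ξ) + N * κ

/-- Linear escape makes the Abel errors summable. Every truncation from index one on has the same
limit, so higher truncations give the higher terms of the asymptotics. -/
lemma FatouData.exists_sector (h : FatouData Λ c κ ρ K) {δ : ℝ} (hδ : 0 < δ) (hδ1 : δ ≤ 1) :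
    ∃ R : ℝ, 1 ≤ R ∧ DifferentiableOn ℂ (fatouCoord Λ c κ) (sector κ δ R) ∧
      (∀ ξ ∈ sector κ δ R, fatouCoord Λ c κ (Λ ξ) = fatouCoord Λ c κ ξ - κ) ∧
      ∀ n, ∃ M : ℝ, 0 ≤ M ∧ ∀ ξ ∈ sector κ δ R,
        ‖fatouCoord Λ c κ ξ - c n ξ‖ ≤ M * Real.exp (-ξ.re) ^ (n + 1) := by
  have hκ := norm_pos_iff.2 h.ne_zero
  obtain ⟨R, b, hR1, hR2, hb, hgr⟩ := h.exists_growth hδ hδ1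
  choose M hM0 hM using h.abel
  choose B hB using h.succ
  have hexp : ∀ ξ : ℂ, Real.exp (-ξ.re) = ‖Complex.exp ξ‖⁻¹ := fun ξ => by
    rw [Real.exp_neg, Complex.norm_exp]
  have hlow : ∀ ξ ∈ sector κ δ R, ∀ N : ℕ, b * ‖Complex.exp ξ‖ ≤ ‖Complex.exp (Λ^[N] ξ)‖ ∧
      b * ‖κ‖ * (N + 1) ≤ ‖Complex.exp (Λ^[N] ξ)‖ := fun ξ hξ N => by
    have h1 := (hgr ξ hξ N).2
    have h2 : 0 ≤ b * (N * ‖κ‖) := by positivity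
    have h3 : b * ‖κ‖ ≤ b * ‖Complex.exp ξ‖ := by have := hξ.1; gcongr; linarith
    constructor <;> nlinarith
  let u : ℕ → ℂ → ℕ → ℂ := fun n ξ N => c n (Λ^[N] ξ) + N * κ
  let e : ℕ → ℝ := fun N => 1 / ((N : ℝ) + 1) ^ 2
  have he : Summable e := by
    have := (summable_nat_add_iff 1).2 (Real.summable_one_div_nat_pow.2 one_lt_two)
    simpa [e] using this
  -- Of the `m + 2` powers of decay, two are spent on summability in `N` and `m` remain as decay in
  -- the starting point.
  have hu : ∀ m, ∀ ξ ∈ sector κ δ R, ∀ N, dist (u (m + 1) ξ N) (u (m + 1) ξ N.succ)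
      ≤ (M (m + 1) * (b * ‖Complex.exp ξ‖)⁻¹ ^ m * (b * ‖κ‖)⁻¹ ^ 2) * e N := by
    intro m ξ hξ N
    have h1 := hM (m + 1) _ (hgr ξ hξ N).1
    have hs : 0 < ‖Complex.exp ξ‖ := by simp
    obtain ⟨h2, h3⟩ := hlow ξ hξ N
    have h4 : ‖Complex.exp (Λ^[N] ξ)‖⁻¹ ≤ (b * ‖Complex.exp ξ‖)⁻¹ := by gcongr
    have h5 : ‖Complex.exp (Λ^[N] ξ)‖⁻¹ ≤ (b * ‖κ‖ * (N + 1))⁻¹ := by gcongr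
    rw [dist_comm, dist_eq_norm]
    have h6 : u (m + 1) ξ N.succ - u (m + 1) ξ N
        = c (m + 1) (Λ (Λ^[N] ξ)) + κ - c (m + 1) (Λ^[N] ξ) := by
      simp only [u, Function.iterate_succ_apply', Nat.succ_eq_add_one]
      push_cast; ring
    rw [h6]
    refine h1.trans ?_
    rw [hexp]
    calc M (m + 1) * ‖Complex.exp (Λ^[N] ξ)‖⁻¹ ^ (m + 1 + 1)
        = M (m + 1) * (‖Complex.exp (Λ^[N] ξ)‖⁻¹ ^ m * ‖Complex.exp (Λ^[N] ξ)‖⁻¹ ^ 2) := by ring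
      _ ≤ M (m + 1) * ((b * ‖Complex.exp ξ‖)⁻¹ ^ m * (b * ‖κ‖ * (N + 1))⁻¹ ^ 2) := by
          have := hM0 (m + 1)
          gcongr
      _ = _ := by
          simp only [e]
          rw [mul_inv (b * ‖κ‖), mul_pow, one_div, inv_pow ((N : ℝ) + 1)]; ring
  have hlim : ∀ m, ∀ ξ ∈ sector κ δ R, Tendsto (u (m + 1) ξ) atTop (𝓝 (fatouCoord Λ c κ ξ)) := by
    intro m
    induction m with
    | zero =>
      intro ξ hξ
      have hc := cauchySeq_of_dist_le_of_summable _ (hu 0 ξ hξ) (he.mul_left _)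
      exact (cauchySeq_tendsto_of_complete hc).choose_spec |> fun h => by
        rw [fatouCoord]; exact tendsto_nhds_limUnder ⟨_, h⟩
    | succ m ih =>
      intro ξ hξ
      have h1 : Tendsto (fun N : ℕ => c (m + 1 + 1) (Λ^[N] ξ) - c (m + 1) (Λ^[N] ξ)) atTop (𝓝 0) := by
        have h2 : Tendsto (fun N : ℕ => ‖Complex.exp (Λ^[N] ξ)‖) atTop atTop := by
          refine tendsto_atTop_mono (fun N => (hlow ξ hξ N).2) ?_
          exact (tendsto_atTop_add_const_right _ _ tendsto_natCast_atTop_atTop).const_mul_atTop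
            (by positivity)
        have h3 : Tendsto (fun N : ℕ => B (m + 1) * Real.exp (-(Λ^[N] ξ).re) ^ (m + 1 + 1))
            atTop (𝓝 0) := by
          simp only [hexp]
          have := ((tendsto_inv_atTop_zero.comp h2).pow (m + 1 + 1)).const_mul (B (m + 1))
          simpa using this
        exact squeeze_zero_norm (fun N => hB (m + 1) _) h3
      have h4 := h1.add (ih ξ hξ)
      rw [zero_add] at h4
      refine h4.congr fun N => ?_
      simp only [u]; ring
  refine ⟨R, hR1, ?_, fun ξ hξ => ?_, fun n => ?_⟩
  · have hT : TendstoUniformlyOn (fun N ξ => u 1 ξ N) (fatouCoord Λ c κ) atTop (sector κ δ R) := by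
      rw [Metric.tendstoUniformlyOn_iff]
      intro ε hε
      have ht := tendsto_sum_nat_add fun N => (M (0 + 1) * (b * ‖κ‖)⁻¹ ^ 2) * e N
      filter_upwards [ht.eventually_lt_const hε] with N hN ξ hξ
      have h1 := dist_le_tsum_of_dist_le_of_tendsto _ (hu 0 ξ hξ) (he.mul_left _) (hlim 0 ξ hξ) N
      rw [dist_comm]
      refine h1.trans_lt ((le_of_eq ?_).trans_lt hN)
      refine tsum_congr fun k => ?_
      rw [pow_zero, mul_one, add_comm N k]
    refine hT.tendstoLocallyUniformlyOn.differentiableOn (Eventually.of_forall fun N ξ hξ => ?_)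
      (isOpen_sector κ δ R)
    have hd : ∀ N : ℕ, DifferentiableAt ℂ (Λ^[N]) ξ := fun N => by
      induction N with
      | zero => exact differentiableAt_id
      | succ N ih =>
        rw [Function.iterate_succ']
        exact (h.diff _ (hgr ξ hξ N).1).comp ξ ih
    exact (((h.diff_coord 1 _).comp ξ (hd N)).add_const _).differentiableWithinAt
  · have h1 := ((tendsto_add_atTop_iff_nat 1).2 (hlim 0 ξ hξ)).sub_const κ
    rw [fatouCoord]
    refine Tendsto.limUnder_eq (h1.congr fun N => ?_)
    simp only [u, Function.iterate_succ_apply]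
    push_cast; ring
  · refine ⟨M (n + 2 + 1) * b⁻¹ ^ (n + 2) * (b * ‖κ‖)⁻¹ ^ 2 * (∑' N, e N)
      + (|B (n + 2)| + |B (n + 1)| + |B n|), ?_, fun ξ hξ => ?_⟩
    · have := hM0 (n + 2 + 1)
      have : 0 ≤ ∑' N, e N := tsum_nonneg fun N => by positivity
      positivity
    · have hs : 1 ≤ ‖Complex.exp ξ‖ := hR1.trans hξ.1.le
      have hs' : ‖Complex.exp ξ‖⁻¹ ≤ 1 := inv_le_one_of_one_le₀ hs
      -- The coordinate of index `n + 3` approximates the limit to order `n + 2`, which is enough;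
      -- the three differences leading down to index `n` have order at least `n + 1`.
      have h1 := dist_le_tsum_of_dist_le_of_tendsto₀ _ (hu (n + 2) ξ hξ) (he.mul_left _)
        (hlim (n + 2) ξ hξ)
      rw [tsum_mul_left, dist_comm, dist_eq_norm] at h1
      simp only [u, Function.iterate_zero, id, Nat.cast_zero, zero_mul, add_zero] at h1
      have hBn : ∀ j, n ≤ j → ‖c (j + 1) ξ - c j ξ‖ ≤ |B j| * ‖Complex.exp ξ‖⁻¹ ^ (n + 1) :=
          fun j hj => by
        refine (hB j ξ).trans ?_
        rw [hexp]
        refine mul_le_mul (le_abs_self _) ?_ (by positivity) (abs_nonneg _)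
        exact pow_le_pow_of_le_one (by positivity) hs' (by omega)
      have h2 := hBn n le_rfl
      have h3 := hBn (n + 1) (by omega)
      have h4 := hBn (n + 2) (by omega)
      have h5 : M (n + 2 + 1) * (b * ‖Complex.exp ξ‖)⁻¹ ^ (n + 2) * (b * ‖κ‖)⁻¹ ^ 2 * (∑' N, e N)
          ≤ M (n + 2 + 1) * b⁻¹ ^ (n + 2) * (b * ‖κ‖)⁻¹ ^ 2 * (∑' N, e N)
            * ‖Complex.exp ξ‖⁻¹ ^ (n + 1) := by
        have hM' := hM0 (n + 2 + 1)
        have he' : 0 ≤ ∑' N, e N := tsum_nonneg fun N => by positivity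
        rw [mul_inv, mul_pow]
        calc _ = M (n + 2 + 1) * b⁻¹ ^ (n + 2) * (b * ‖κ‖)⁻¹ ^ 2 * (∑' N, e N)
              * ‖Complex.exp ξ‖⁻¹ ^ (n + 2) := by ring
          _ ≤ _ := by
            gcongr ?_ * ?_
            exact pow_le_pow_of_le_one (by positivity) hs' (by omega)
      have h6 : fatouCoord Λ c κ ξ - c n ξ = (fatouCoord Λ c κ ξ - c (n + 2 + 1) ξ)
          + (c (n + 2 + 1) ξ - c (n + 2) ξ) + (c (n + 1 + 1) ξ - c (n + 1) ξ)
          + (c (n + 1) ξ - c n ξ) := by ring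
      rw [h6, hexp]
      have h7 := norm_add₃_le (a := (fatouCoord Λ c κ ξ - c (n + 2 + 1) ξ)
        + (c (n + 2 + 1) ξ - c (n + 2) ξ)) (b := c (n + 1 + 1) ξ - c (n + 1) ξ)
        (c := c (n + 1) ξ - c n ξ)
      have h8 := norm_add_le (fatouCoord Λ c κ ξ - c (n + 2 + 1) ξ)
        (c (n + 2 + 1) ξ - c (n + 2) ξ)
      linarith

end Fatou

/-! ### The region avoids the direction opposite to `κ` -/

section Direction

/-- A curve that reaches the right half-plane, while its imaginary part varies slowly and it stays
away from the origin, cannot start near the negative axis. -/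
lemma neg_lt_re_of_curve {X : ℝ → ℂ} {T C₁ C₂ c : ℝ} (hT : 0 ≤ T) (hX : ContinuousOn X (Icc 0 T))
    (hXT : 0 < (X T).re) (hC₁ : 0 ≤ C₁) (hc : 0 < c) (hc1 : c ≤ 1)
    (him : ∀ t ∈ Icc 0 T, |(X t).im - (X 0).im| ≤ C₁ + C₂ * (‖X t‖ / ‖X 0‖))
    (hlow : ∀ t ∈ Icc 0 T, c * ‖X 0‖ ≤ ‖X t‖) (h₁ : 4 * C₁ / c < ‖X 0‖) (h₂ : 2 * C₂ ≤ ‖X 0‖) :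
    -((1 - c ^ 2 / 32) * ‖X 0‖) < (X 0).re := by
  by_contra! hre
  have h0 : 0 < ‖X 0‖ := lt_of_le_of_lt (by positivity) h₁
  have hre0 : (X 0).re ≤ 0 := hre.trans (neg_nonpos.2 (mul_nonneg (by nlinarith) h0.le))
  -- The curve must cross the imaginary axis. There its modulus is its imaginary part, which is too
  -- small for the lower bound `c ‖X 0‖`.
  obtain ⟨t, ht, ht0⟩ : ∃ t ∈ Icc 0 T, (X t).re = 0 := by
    have h := intermediate_value_Icc hT (Complex.continuous_re.comp_continuousOn hX)
    exact h ⟨hre0, hXT.le⟩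
  have hsq : (X 0).im ^ 2 ≤ (c / 4 * ‖X 0‖) ^ 2 := by
    have h1 : ‖X 0‖ ^ 2 = (X 0).re ^ 2 + (X 0).im ^ 2 := by
      rw [Complex.sq_norm, Complex.normSq_apply]; ring
    have h2 : ((1 - c ^ 2 / 32) * ‖X 0‖) ^ 2 ≤ (X 0).re ^ 2 := by
      rw [← neg_sq (X 0).re]
      exact pow_le_pow_left₀ (mul_nonneg (by nlinarith) h0.le) (by linarith) 2
    nlinarith [mul_nonneg (sq_nonneg (c ^ 2)) (sq_nonneg ‖X 0‖)]
  have hi0 : |(X 0).im| ≤ c / 4 * ‖X 0‖ := abs_le_of_sq_le_sq hsq (by positivity)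
  have ht1 : ‖X t‖ = |(X t).im| := by
    rw [← Complex.abs_im_eq_norm.2 ht0]
  have h3 : C₂ * (‖X t‖ / ‖X 0‖) ≤ ‖X t‖ / 2 := by
    rw [← mul_div_assoc, div_le_iff₀ h0]
    nlinarith [norm_nonneg (X t)]
  have h4 : |(X t).im| ≤ |(X 0).im| + |(X t).im - (X 0).im| := by
    have := abs_add_le (X 0).im ((X t).im - (X 0).im)
    simpa using this
  have h5 := him t ht
  have h6 := hlow t ht
  rw [div_lt_iff₀ hc] at h₁
  linarith

variable {P₀ : Polynomial ℂ} {E : Type*} [TopologicalSpace E] {p : E → Punctured P₀}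
  {Q : ℂ → ℂ → ℂ} {a : ℂ} {F : ℕ → E → ℂ} {D : Set (ℂ × E)} {b L : ℝ} {n : ℕ}
  {γ : ℝ → ℂ} {η : ℝ → E}

/-- While `|x|` is below its initial value, `log x` has moved by at most `max L 0`. -/
lemma IsAdmissibleCurve.exp_mul_le (h : IsAdmissibleCurve Q p a F D b L n γ η) {t : ℝ}
    (ht : 0 ≤ t) :
    Real.exp (-max L 0) * ‖Complex.exp (γ 0)‖ ≤ ‖Complex.exp (γ t)‖ := by
  have hL := le_max_right L 0
  by_cases hle : ‖Complex.exp (γ 0)‖ ≤ ‖Complex.exp (γ t)‖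
  · exact (mul_le_of_le_one_left (norm_nonneg _) (Real.exp_le_one_iff.2 (by linarith))).trans hle
  · push Not at hle
    have h1 := h.norm_sub_le_mul ht
    have h2 : ‖Complex.exp (γ t) / Complex.exp (γ 0)‖ ≤ 1 := by
      rw [norm_div]
      exact div_le_one_of_le₀ hle.le (norm_nonneg _)
    have h3 : -max L 0 ≤ (γ t - γ 0).re := by
      have h4 := neg_le_of_abs_le ((Complex.abs_re_le_norm (γ t - γ 0)).trans h1)
      nlinarith
    rw [Complex.sub_re] at h3
    rw [Complex.norm_exp, Complex.norm_exp, ← Real.exp_add, Real.exp_le_exp]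
    linarith

/-- The curves of the region, which must go around with the deck transformation, do not start in
the direction that is opposite to the constant `κ` of the deck transformation. -/
lemma exists_mem_sector_of_curves (hp : IsCoveringMap p) {g : E ≃ₜ E} {φ : E → ℂ} {κ : ℂ}
    (hκ : κ ≠ 0) (hφ : Continuous φ) (hφg : ∀ w, φ (g w) = φ w + κ) {B : Set E} (hB : IsCompact B)
    (hDopen : IsOpen D) (hcov : ∀ q ∈ D, ∃ N : ℕ, ∃ b ∈ B, g^[N] b = q.2)
    (hFφ : ∀ w ∈ Prod.snd '' D, HasCoverDerivAt p (fun v => F 0 v - φ v) 0 w)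
    (hcurves : ∀ q ∈ D, ∃ (γ : ℝ → ℂ) (η : ℝ → E), γ 0 = q.1 ∧ η 0 = q.2 ∧
      IsAdmissibleCurve Q p a F D b L 0 γ η) :
    ∃ δ : ℝ, 0 < δ ∧ δ ≤ 1 ∧ ∃ R : ℝ, ∀ q ∈ D, R < ‖Complex.exp q.1‖ → q.1 ∈ sector κ δ R := by
  have := locallyPathConnectedSpace_of_isCoveringMap hp
  obtain ⟨M, hM⟩ := hB.exists_bound_of_continuousOn hφ.continuousOn
  have hκ' := norm_pos_iff.2 hκ
  set ℓ := max L 0 with hℓ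
  have hℓ0 : 0 ≤ ℓ := le_max_right _ _
  set c := Real.exp (-ℓ) with hc
  have hc0 : 0 < c := Real.exp_pos _
  have hc1 : c ≤ 1 := Real.exp_le_one_iff.2 (by linarith)
  set C₁ := 2 * |M| / ‖κ‖ with hC₁
  set C₂ := ‖a‖ * ℓ / ‖κ‖ with hC₂
  refine ⟨c ^ 2 / 32, by positivity, by nlinarith, ‖κ‖ * max (4 * C₁ / c) (2 * C₂),
    fun q hq hR => ⟨hR, ?_⟩⟩
  obtain ⟨γ, η, hγ0, hη0, h⟩ := hcurves q hq
  set X : ℝ → ℂ := fun t => Complex.exp (γ t) / κ with hX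
  have hXn : ∀ t, ‖X t‖ = ‖Complex.exp (γ t)‖ / ‖κ‖ := fun t => norm_div _ _
  obtain ⟨N₀, v₀, hv₀, hvN₀⟩ := hcov _ (h.mem 0 le_rfl)
  -- On a level curve of `C_0` the variation of `x` is that of `a log x + F₀`. Up to a constant `F₀`
  -- is `φ`, and the natural number `N` counts the translates of the compact set.
  have hvar : ∀ t, 0 ≤ t → ∃ (N : ℕ) (e : ℂ), ‖e‖ ≤ C₁ ∧
      X t - X 0 = a * (γ t - γ 0) / κ + ((N : ℝ) - N₀ : ℝ) + e := by
    intro t ht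
    have hlev := h.level t ht
    have hdiff : F 0 (η t) - φ (η t) = F 0 (η 0) - φ (η 0) := by
      have hW : IsOpen (Prod.snd '' D) := isOpenMap_snd D hDopen
      have hmem : ∀ t, 0 ≤ t → η t ∈ Prod.snd '' D := fun t ht => ⟨_, h.mem t ht, rfl⟩
      exact eqOn_const_of_hasCoverDerivAt_zero hp (hW.connectedComponentIn (x := η 0))
        isPreconnected_connectedComponentIn (f := fun v => F 0 v - φ v)
        (fun v hv => hFφ v (connectedComponentIn_subset _ _ hv))
        (mem_connectedComponentIn_of_curve h.continuous_y hmem ht)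
        (mem_connectedComponentIn_of_curve h.continuous_y hmem le_rfl)
    obtain ⟨N, v, hv, hvN⟩ := hcov _ (h.mem t ht)
    simp only at hvN hvN₀
    have h1 := apply_iterate_deck hφg N v
    have h2 := apply_iterate_deck hφg N₀ v₀
    rw [hvN] at h1
    rw [hvN₀] at h2
    refine ⟨N, (φ v - φ v₀) / κ, ?_, ?_⟩
    · rw [norm_div, hC₁]
      gcongr
      linarith [norm_sub_le (φ v) (φ v₀), hM v hv, hM v₀ hv₀, le_abs_self M]
    · simp only [truncation, Finset.Icc_eq_empty_of_lt zero_lt_one, Finset.sum_empty, add_zero]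
        at hlev
      simp only [hX]
      push_cast
      field_simp
      linear_combination -hlev + hdiff + h1 - h2
  have hlin : ∀ t, 0 ≤ t → ‖a * (γ t - γ 0) / κ‖ ≤ C₂ * (‖X t‖ / ‖X 0‖) := by
    intro t ht
    have h1 := h.norm_sub_le_mul ht
    rw [norm_div, norm_mul, hC₂, hXn, hXn, div_div_div_cancel_right₀ hκ'.ne', ← norm_div,
      div_mul_eq_mul_div, mul_assoc]
    gcongr
  -- Once `|x|` dominates the logarithmic terms, `X` is within half its modulus of some `N ≥ 0`,
  -- hence in the right half-plane. The absence of backward translates is essential here.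
  obtain ⟨T, hT, hXT⟩ : ∃ T, 0 ≤ T ∧ 0 < (X T).re := by
    have hx₀ : 0 < ‖Complex.exp (γ 0)‖ := by simp
    obtain ⟨t, ht, ht0⟩ := ((h.escape.eventually (eventually_mul_log_lt
      (2 * ‖κ‖ * (‖X 0 - N₀‖ + C₁)) (2 * ‖κ‖ * C₂) (inv_pos.2 hx₀))).and
      (eventually_ge_atTop 0)).exists
    refine ⟨t, ht0, ?_⟩
    obtain ⟨N, e, he, hXe⟩ := hvar t ht0
    have h1 : X t - N = (X 0 - N₀) + a * (γ t - γ 0) / κ + e := by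
      push_cast at hXe
      linear_combination hXe
    have h2 := h.norm_sub_le ht0
    rw [norm_div, div_eq_inv_mul] at h2
    have h3 : ‖a * (γ t - γ 0) / κ‖
        ≤ C₂ * Real.log (‖Complex.exp (γ 0)‖⁻¹ * ‖Complex.exp (γ t)‖ + 1) := by
      rw [norm_div, norm_mul, hC₂, div_mul_eq_mul_div, mul_assoc]
      gcongr
    have h4 : ‖X t - N‖ < ‖X t‖ / 2 := by
      have h5 : ‖X t - N‖ ≤ ‖X 0 - N₀‖
          + C₂ * Real.log (‖Complex.exp (γ 0)‖⁻¹ * ‖Complex.exp (γ t)‖ + 1) + C₁ := by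
        rw [h1]
        exact norm_add₃_le.trans (by linarith)
      rw [hXn, div_div, lt_div_iff₀ (by positivity)]
      have h6 := mul_le_mul_of_nonneg_right h5 (show 0 ≤ ‖κ‖ * 2 by positivity)
      linarith
    have h7 := norm_le_norm_add_norm_sub' (X t) N
    rw [Complex.norm_natCast] at h7
    have h8 := neg_le_of_abs_le (Complex.abs_re_le_norm (X t - N))
    rw [Complex.sub_re, Complex.natCast_re] at h8
    linarith
  have hmain := neg_lt_re_of_curve (X := X) (T := T) (C₁ := C₁) (C₂ := C₂) (c := c) hT
    ((Complex.continuous_exp.comp_continuousOn (h.continuousOn T)).div_const κ) hXT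
    (by positivity) hc0 hc1 (fun t ht => ?_) (fun t ht => ?_) ?_ ?_
  · have h1 : (Complex.exp q.1 * (starRingEnd ℂ) κ) = X 0 * (‖κ‖ ^ 2 : ℝ) := by
      rw [← Complex.normSq_eq_norm_sq, ← Complex.mul_conj]
      simp only [hX, hγ0]
      field_simp
    rw [h1, Complex.re_mul_ofReal, ← hγ0, show ‖Complex.exp (γ 0)‖ = ‖X 0‖ * ‖κ‖ by
      rw [hXn]; field_simp]
    nlinarith [mul_lt_mul_of_pos_right hmain (pow_pos hκ' 2)]
  · obtain ⟨N, e, he, hXe⟩ := hvar t ht.1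
    have h1 : (X t).im - (X 0).im = (a * (γ t - γ 0) / κ).im + e.im := by
      rw [← Complex.sub_im, hXe]; simp
    rw [h1]
    refine (abs_add_le _ _).trans ?_
    linarith [Complex.abs_im_le_norm e, Complex.abs_im_le_norm (a * (γ t - γ 0) / κ), hlin t ht.1]
  · have := h.exp_mul_le ht.1
    rw [hXn, hXn, ← mul_div_assoc]
    gcongr
  · rw [hXn, hγ0, lt_div_iff₀ hκ', mul_comm]
    exact lt_of_le_of_lt (by gcongr; exact le_max_left _ _) hR
  · rw [hXn, hγ0, le_div_iff₀ hκ', mul_comm]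
    exact le_of_lt (lt_of_le_of_lt (by gcongr; exact le_max_right _ _) hR)

end Direction

/-! ### Construction of the actual constant of motion -/

section Assembly

variable {P₀ : Polynomial ℂ} {E : Type*} [TopologicalSpace E] {p : E → Punctured P₀}
  {Q : ℂ → ℂ → ℂ} {r : ℝ} {a κ : ℂ} {Φ dΦ S dS : ℕ → E → ℂ} {w₀ w₁ : E}

lemma truncation_add_of_shift {E : Type*} {a c : ℂ} {F G : ℕ → E → ℂ} {v w : E}
    (h0 : F 0 v = G 0 w + c) (h : ∀ k, 1 ≤ k → F k v = G k w) (n : ℕ) (ξ : ℂ) :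
    truncation a F n (ξ, v) = truncation a G n (ξ, w) + c := by
  simp only [truncation, h0]
  rw [Finset.sum_congr rfl fun k hk => by rw [h k (Finset.mem_Icc.1 hk).1]]
  ring

/-- A formal constant of motion provides approximate Fatou coordinates for the return map. -/
lemma IsFormalSolution.exists_fatouData [PreconnectedSpace E] (hform : IsNormalForm P₀ Q r)
    (hp : IsCoveringMap p) (hΦ : IsFormalSolution Q p (motionSource a) Φ dΦ) (hκ : κ ≠ 0)
    (hS : IsClock Q p w₀ S dS) (h0 : Φ 0 w₀ = Φ 0 w₁ + κ) (h : ∀ k, 1 ≤ k → Φ k w₀ = Φ k w₁) :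
    ∃ ρ K, FatouData (fun ξ => clock S ξ w₁) (fun n ξ => truncation a Φ n (ξ, w₀)) κ ρ K := by
  obtain ⟨U, -, hU, A, hA, hb⟩ := hS.exists_of_isCompact hform hp (isCompact_singleton (x := w₁))
  have hb₁ := hb w₁ (hU rfl)
  choose M hM0 hM using hΦ.exists_flat_truncation_of_isCompact hform hp hS
    (isCompact_singleton (x := w₁)) hA fun v hv => hb v (hU hv)
  have habel : ∀ n, ∀ ξ : ℂ, max (Real.log (2 * A)) 1 < ξ.re →
      ‖truncation a Φ n (clock S ξ w₁, w₀) + κ - truncation a Φ n (ξ, w₀)‖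
        ≤ M n * Real.exp (-ξ.re) ^ (n + 1) := fun n ξ hξ => by
    refine (le_of_eq ?_).trans (hM n w₁ rfl ξ hξ)
    rw [norm_sub_rev, truncation_add_of_shift h0 h n ξ]
    congr 1
    ring
  refine ⟨max (Real.log (2 * A)) 1, M 0 + ‖a‖ * (2 * A), hκ, ?_, fun ξ hξ => ?_, fun ξ hξ => ?_,
    fun n ξ => ?_, fun n => ⟨M n, hM0 n, habel n⟩, fun n => ⟨‖Φ (n + 1) w₀‖, fun ξ => ?_⟩⟩
  · have := hM0 0
    positivity
  · have h1 := habel 0 ξ hξ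
    obtain ⟨h2, -, -⟩ := hb₁.clock hp hA ((le_max_left _ _).trans_lt hξ)
    have h3 : Complex.exp (clock S ξ w₁) - Complex.exp ξ - κ
        = a * (clock S ξ w₁ - ξ)
          - (truncation a Φ 0 (clock S ξ w₁, w₀) + κ - truncation a Φ 0 (ξ, w₀)) := by
      simp [truncation]; ring
    rw [h3]
    refine (norm_sub_le _ _).trans ?_
    rw [norm_mul, zero_add, pow_one] at *
    have h4 := mul_le_mul_of_nonneg_left h2 (norm_nonneg a)
    linarith
  · obtain ⟨-, -, b₁, b₂, h2, -⟩ := hb₁.clock hp hA ((le_max_left _ _).trans_lt hξ)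
    exact (h2.hasDerivAt hp).differentiableAt
  · exact ((hΦ.hasPD_truncation hp a n (ξ, w₀)).hasDerivAt hp).differentiableAt
  · rw [truncation_eq, truncation_eq, Finset.sum_range_succ _ (n + 1), ← norm_exp_neg, ← norm_pow,
      ← norm_mul]
    refine le_of_eq (congrArg _ ?_)
    ring

/-- A bounded displacement of `x` changes its direction by `O(1/|x|)`; halving `δ` absorbs this when
`|x|` is large. -/
lemma mem_sector_of_norm_sub_le {ξ σ : ℂ} {δ R R' K : ℝ} (hδ : 0 < δ) (hδ1 : δ ≤ 1)
    (hξ : ξ ∈ sector κ δ R') (hσ : ‖Complex.exp σ - Complex.exp ξ‖ ≤ K)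
    (hR : R + K < ‖Complex.exp ξ‖) (hK : 4 * K / δ < ‖Complex.exp ξ‖) (hκ : κ ≠ 0) :
    σ ∈ sector κ (δ / 2) R := by
  have hκ' := norm_pos_iff.2 hκ
  have h1 := norm_sub_norm_le (Complex.exp ξ) (Complex.exp σ)
  rw [norm_sub_rev] at h1
  refine ⟨by linarith, ?_⟩
  have h2 : -(K * ‖κ‖) ≤ ((Complex.exp σ - Complex.exp ξ) * (starRingEnd ℂ) κ).re := by
    refine neg_le_of_abs_le ((Complex.abs_re_le_norm _).trans ?_)
    rw [norm_mul, RCLike.norm_conj]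
    gcongr
  rw [sub_mul, Complex.sub_re] at h2
  rw [div_lt_iff₀ hδ] at hK
  have h3 : (1 - δ) * ‖Complex.exp ξ‖ + K ≤ (1 - δ / 2) * ‖Complex.exp σ‖ := by
    nlinarith [mul_le_mul_of_nonneg_left (h1.trans hσ) (show 0 ≤ 1 - δ / 2 by linarith),
      (norm_nonneg _).trans hσ]
  nlinarith [mul_le_mul_of_nonneg_right h3 hκ'.le, hξ.2]

lemma HasPD.comp_deck_iterate {γ : E ≃ₜ E} (hγ : ∀ w, p (γ w) = p w) {u : ℂ × E → ℂ} {a b ξ : ℂ}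
    (m : ℕ) {w : E} (h : HasPD p u a b (ξ, γ^[m] w)) :
    HasPD p (fun v => u (v.1, γ^[m] v.2)) a b (ξ, w) := by
  induction m generalizing w with
  | zero => exact h
  | succ m ih => exact HasPD.comp_deck hγ (ih h)

/-- Each deck step applies the holonomy to the clock value, and the Abel equation turns this into
subtracting `κ`. -/
lemma IsClock.fatouCoord_deck_iterate [PreconnectedSpace E] (hform : IsNormalForm P₀ Q r)
    (hp : IsCoveringMap p) (hS : IsClock Q p w₀ S dS) {γ : E ≃ₜ E} (hγ : ∀ w, p (γ w) = p w)
    {A : ℝ} (hA : 1 ≤ A) (hw : ClockBound Q p S A (γ w₀)) {f : ℂ → ℂ} {G : Set ℂ}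
    (hf : ∀ σ ∈ G, f (clock S σ (γ w₀)) = f σ - κ) {ξ : ℂ} (hξ : Real.log (2 * A) + 1 < ξ.re)
    {v : E} (j : ℕ) (hv : ∀ i ≤ j, ClockBound Q p S A (γ^[i] v) ∧ clock S ξ (γ^[i] v) ∈ G) :
    f (clock S ξ (γ^[j] v)) = f (clock S ξ v) - j * κ := by
  induction j with
  | zero => simp
  | succ j ih =>
    have h1 := hv j (by omega)
    have h2 := (hv (j + 1) le_rfl).1
    rw [Function.iterate_succ_apply'] at h2 ⊢
    rw [hS.clock_deck hform hp hγ hA h1.1 h2 hw hξ, hf _ h1.2, ih fun i hi => hv i (by omega)]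
    push_cast; ring

/-- The actual constant of motion, from a solution that is invariant under the deck
transformation, in a region that is covered by the translates of a compact set. -/
lemma exists_isActualConstant [SimplyConnectedSpace E] (hform : IsNormalForm P₀ Q r)
    (hp : IsCoveringMap p) {g : E ≃ₜ E} (hg : ∀ w, p (g w) = p w)
    (hΦ : IsFormalSolution Q p (motionSource a) Φ dΦ) (hκ : κ ≠ 0)
    (h0 : ∀ w, Φ 0 (g w) = Φ 0 w + κ) (h1 : ∀ k, 1 ≤ k → ∀ w, Φ k (g w) = Φ k w)
    {F : ℕ → E → ℂ} {D : Set (ℂ × E)} (hDopen : IsOpen D) (hF : ∀ k, 1 ≤ k → ∀ q ∈ D, F k q.2 = Φ k q.2)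
    (hF0 : ∀ q ∈ D, HasCoverDerivAt p (fun v => F 0 v - Φ 0 v) 0 q.2)
    {B : Set E} (hB : IsCompact B) (hcov : ∀ q ∈ D, ∃ N : ℕ, ∃ b ∈ B, g^[N] b = q.2)
    {δ R : ℝ} (hδ : 0 < δ) (hδ1 : δ ≤ 1)
    (hdir : ∀ q ∈ D, R < ‖Complex.exp q.1‖ → q.1 ∈ sector κ δ R) (w₀ : E) (R₀ : ℝ) :
    ∃ R₁ : ℝ, R₀ ≤ R₁ ∧ ∃ C : ℂ × E → ℂ,
      IsActualConstant Q p a F (D ∩ {q | R₁ < ‖Complex.exp q.1‖}) C := by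
  classical
  have hκ' := norm_pos_iff.2 hκ
  have hγ : ∀ w, p (g.symm w) = p w := fun w => by rw [← hg (g.symm w), g.apply_symm_apply]
  have hinv : ∀ m w, g.symm^[m] (g^[m] w) = w := fun m w =>
    (Function.LeftInverse.iterate g.symm_apply_apply m) w
  obtain ⟨S, dS, hS, hS0⟩ := exists_isFormalSolution hform hp w₀ (Pi.single 1 1) fun _ => 0
  have hS : IsClock Q p w₀ S dS := ⟨hS, hS0⟩
  obtain ⟨ρ, K, hfatou⟩ := hΦ.exists_fatouData hform hp hκ hS (w₁ := g.symm w₀)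
    (by rw [← h0, g.apply_symm_apply]) (fun k hk => by rw [← h1 k hk (g.symm w₀), g.apply_symm_apply])
  obtain ⟨R₂, -, hdiff, habel, hasymp⟩ := hfatou.exists_sector (δ := δ / 2) (by positivity)
    (by linarith)
  set f := fatouCoord (fun ξ => clock S ξ (g.symm w₀)) (fun n ξ => truncation a Φ n (ξ, w₀)) κ with hf
  -- a neighbourhood of `B` on whose first translates the clock converges
  obtain ⟨M, hM⟩ := hB.exists_bound_of_continuousOn (hΦ.continuous hp 0).continuousOn
  -- Two representations of one point by translates of points with `‖Φ 0‖ < M + 1` have exponents at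
  -- most `2 (M + 1) / ‖κ‖` apart, since `Φ 0` grows by `κ` per translate. Finitely many translates
  -- thus settle consistency.
  obtain ⟨J, hJ⟩ := exists_nat_gt (2 * (M + 1) / ‖κ‖)
  have hcompact : IsCompact (insert (g.symm w₀) (⋃ i ∈ Finset.range (J + 1), g.symm^[i] '' B)) :=
    ((Finset.range (J + 1)).isCompact_biUnion fun i _ =>
      hB.image (g.symm.continuous.iterate i)).insert _
  obtain ⟨U₁, hU₁, hKU₁, A, hA, hclock⟩ := hS.exists_of_isCompact hform hp hcompact
  set U : Set E := {v | ‖Φ 0 v‖ < M + 1} ∩ ⋂ i ∈ Finset.range (J + 1), (g.symm^[i]) ⁻¹' U₁ with hU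
  have hUopen : IsOpen U := (isOpen_lt (hΦ.continuous hp 0).norm continuous_const).inter
    (isOpen_biInter_finset fun i _ => hU₁.preimage (g.symm.continuous.iterate i))
  have hBU : B ⊆ U := fun v hv => ⟨lt_of_le_of_lt (hM v hv) (lt_add_one M),
    mem_iInter₂.2 fun i hi => hKU₁ (mem_insert_of_mem _ (mem_iUnion₂.2 ⟨i, hi, v, hv, rfl⟩))⟩
  have hUclock : ∀ v ∈ U, ∀ i ≤ J, ClockBound Q p S A (g.symm^[i] v) := fun v hv i hi =>
    hclock _ (mem_iInter₂.1 hv.2 i (Finset.mem_range.2 (by omega)))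
  have hw₁ : ClockBound Q p S A (g.symm w₀) := hclock _ (hKU₁ (mem_insert _ _))
  -- The bounds serve, in turn, the given domain, convergence of the clock with the deck identity,
  -- the direction of the region, and the modulus and direction of the clock values.
  obtain ⟨R₁, hR₁⟩ : ∃ R₁, R₀ ≤ R₁ ∧ Real.exp (Real.log (2 * A) + 1) ≤ R₁ ∧ R ≤ R₁ ∧
      R₂ + 4 * A ≤ R₁ ∧ 4 * (4 * A) / δ ≤ R₁ := by
    refine ⟨max R₀ (max (Real.exp (Real.log (2 * A) + 1)) (max R (max (R₂ + 4 * A)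
      (4 * (4 * A) / δ)))), ?_⟩
    simp
  obtain ⟨hR₁0, hR₁1, hR₁2, hR₁3, hR₁4⟩ := hR₁
  have hre : ∀ q ∈ D ∩ {q | R₁ < ‖Complex.exp q.1‖}, Real.log (2 * A) + 1 < q.1.re := fun q hq => by
    have := hR₁1.trans_lt hq.2
    rwa [Complex.norm_exp, Real.exp_lt_exp] at this
  have hsector : ∀ q ∈ D ∩ {q | R₁ < ‖Complex.exp q.1‖}, ∀ v, ClockBound Q p S A v →
      clock S q.1 v ∈ sector κ (δ / 2) R₂ := fun q hq v hv => by
    obtain ⟨hc1, hc2, -⟩ := hv.clock hp hA (ξ := q.1) (by linarith [hre q hq])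
    have hq2 : R₁ < ‖Complex.exp q.1‖ := hq.2
    exact mem_sector_of_norm_sub_le hδ hδ1 (hdir q hq.1 (hR₁2.trans_lt hq2))
      (norm_exp_sub_exp_le hc1 hc2) (hR₁3.trans_lt hq2) (hR₁4.trans_lt hq2) hκ
  have hcons_le : ∀ q ∈ D ∩ {q | R₁ < ‖Complex.exp q.1‖}, ∀ m m' : ℕ, m' ≤ m → ∀ v ∈ U, ∀ v' ∈ U,
      g^[m] v = g^[m'] v' → f (clock S q.1 v) + m * κ = f (clock S q.1 v') + m' * κ := by
    intro q hq m m' hmm v hv v' hv' h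
    obtain ⟨j, rfl⟩ := Nat.exists_eq_add_of_le hmm
    rw [Function.iterate_add_apply] at h
    have hv'j : v' = g^[j] v := ((g.injective.iterate m') h).symm
    have hjJ : j ≤ J := by
      have h2 := apply_iterate_deck h0 j v
      rw [← hv'j] at h2
      have h3 : ‖(j : ℂ) * κ‖ ≤ 2 * (M + 1) := by
        rw [show (j : ℂ) * κ = Φ 0 v' - Φ 0 v by rw [h2]; ring]
        have h4 : ‖Φ 0 v‖ < M + 1 := hv.1
        have h5 : ‖Φ 0 v'‖ < M + 1 := hv'.1
        linarith [norm_sub_le (Φ 0 v') (Φ 0 v)]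
      rw [norm_mul, Complex.norm_natCast, ← le_div_iff₀ hκ'] at h3
      exact_mod_cast (h3.trans_lt hJ).le
    have hvj : v = g.symm^[j] v' := by rw [hv'j, hinv]
    have h6 := hS.fatouCoord_deck_iterate hform hp hγ hA hw₁ habel (hre q hq) (v := v') j
      fun i hi => ⟨hUclock v' hv' i (hi.trans hjJ),
        hsector q hq _ (hUclock v' hv' i (hi.trans hjJ))⟩
    rw [← hvj] at h6
    rw [h6]
    push_cast; ring
  have hcons : ∀ q ∈ D ∩ {q | R₁ < ‖Complex.exp q.1‖}, ∀ m m' : ℕ, ∀ v ∈ U, ∀ v' ∈ U,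
      g^[m] v = g^[m'] v' → f (clock S q.1 v) + m * κ = f (clock S q.1 v') + m' * κ := by
    intro q hq m m' v hv v' hv' h
    rcases le_total m' m with hm | hm
    · exact hcons_le q hq m m' hm v hv v' hv' h
    · exact (hcons_le q hq m' m hm v' hv' v hv h.symm).symm
  have hchoice : ∀ w, ∃ (N : ℕ) (b : E), w ∈ Prod.snd '' D → b ∈ B ∧ g^[N] b = w := fun w => by
    by_cases hw : w ∈ Prod.snd '' D
    · obtain ⟨q, hq, rfl⟩ := hw
      obtain ⟨N, b, hb, h⟩ := hcov q hq
      exact ⟨N, b, fun _ => ⟨hb, h⟩⟩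
    · exact ⟨0, w, fun h => absurd h hw⟩
  choose μ β hβ using hchoice
  have hD₁ : IsOpen (D ∩ {q | R₁ < ‖Complex.exp q.1‖}) :=
    hDopen.inter (isOpen_lt continuous_const (Complex.continuous_exp.comp continuous_fst).norm)
  refine ⟨R₁, hR₁0, fun q => f (clock S q.1 (β q.2)) + μ q.2 * κ + (F 0 q.2 - Φ 0 q.2),
    fun q hq => ?_, fun n => ?_⟩
  · obtain ⟨hb, hbq⟩ := hβ q.2 ⟨q, hq.1, rfl⟩
    set m := μ q.2 with hm
    have hmb : g.symm^[m] q.2 = β q.2 :=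
      (congrArg _ hbq.symm).trans (hinv m _)
    -- The choices `μ` and `β` need not be continuous. By consistency they may be replaced near `q`
    -- by the fixed exponent `m`, which makes the function holomorphic there.
    have hev : (fun v : ℂ × E => f (clock S v.1 (β v.2)) + μ v.2 * κ + (F 0 v.2 - Φ 0 v.2)) =ᶠ[𝓝 q]
        fun v => f (clock S v.1 (g.symm^[m] v.2)) + (m * κ) + (F 0 v.2 - Φ 0 v.2) := by
      have hnear : ∀ᶠ v : ℂ × E in 𝓝 q, g.symm^[m] v.2 ∈ U := by
        refine ((g.symm.continuous.iterate m).comp continuous_snd).continuousAt ?_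
        exact hUopen.mem_nhds (by rw [Function.comp_apply, hmb]; exact hBU hb)
      filter_upwards [hnear, hD₁.mem_nhds hq] with v hv hvD
      obtain ⟨hb', hbv⟩ := hβ v.2 ⟨v, hvD.1, rfl⟩
      rw [hcons v hvD (μ v.2) m (β v.2) (hBU hb') _ hv]
      rw [hbv, Function.LeftInverse.iterate g.apply_symm_apply m]
    have hbc : ClockBound Q p S A (g.symm^[m] q.2) := by
      rw [hmb]; exact hUclock _ (hBU hb) 0 (Nat.zero_le _)
    obtain ⟨-, -, b₁, b₂, hPD, hrel⟩ := hbc.clock hp hA (ξ := q.1) (by linarith [hre q hq])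
    have hfd := (hdiff.differentiableAt ((isOpen_sector _ _ _).mem_nhds
      (hsector q hq _ hbc))).hasDerivAt
    have h2 : HasPD p (fun v : ℂ × E => f (clock S v.1 (g.symm^[m] v.2))) _ _ q :=
      HasPD.comp_deriv hp (u := fun v : ℂ × E => clock S v.1 (g.symm^[m] v.2)) hfd
        (hPD.comp_deck_iterate hγ m)
    have h3 := ((h2.add (HasPD.of_fst (φ := fun _ => m * κ) hp (hasDerivAt_const q.1 _))).add
      (HasPD.of_snd (hF0 q hq.1))).congr_of_eventuallyEq hev
    refine ⟨_, _, h3.hasPartialsAt, ?_⟩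
    have hpm : p (g.symm^[m] q.2) = p q.2 := by
      have : ∀ m w, p (g.symm^[m] w) = p w := fun m w => by
        induction m with
        | zero => rfl
        | succ m ih => rw [Function.iterate_succ_apply', hγ, ih]
      exact this m q.2
    rw [hpm] at hrel
    rw [← Complex.exp_neg, div_eq_mul_inv, ← Complex.exp_neg]
    linear_combination (deriv f (clock S q.1 (g.symm^[m] q.2))) * hrel
  · obtain ⟨M₁, hM₁, hb₁⟩ := hasymp n
    obtain ⟨M₂, hM₂, hb₂⟩ := hΦ.exists_flat_truncation_of_isCompact hform hp hS hB hA
      (fun v hv => hUclock v (hBU hv) 0 (Nat.zero_le _)) n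
    -- The clock may lower `ξ.re` by up to one, which costs the factor `exp 1 ^ (n + 1)`.
    refine ⟨M₁ * Real.exp 1 ^ (n + 1) + M₂, fun q hq => ?_⟩
    obtain ⟨hb, hbq⟩ := hβ q.2 ⟨q, hq.1, rfl⟩
    have hbc : ClockBound Q p S A (β q.2) := hUclock _ (hBU hb) 0 (Nat.zero_le _)
    obtain ⟨-, hc2, -⟩ := hbc.clock hp hA (ξ := q.1) (by linarith [hre q hq])
    have hlog : 0 ≤ Real.log (2 * A) := Real.log_nonneg (by linarith)
    have h2 := hb₁ _ (hsector q hq _ hbc)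
    have h3 := hb₂ _ hb q.1 (max_lt (by linarith [hre q hq]) (by linarith [hre q hq]))
    have h4 : truncation a F n q = truncation a Φ n (q.1, β q.2)
        + (μ q.2 * κ + (F 0 q.2 - Φ 0 q.2)) := by
      refine truncation_add_of_shift (ξ := q.1) ?_ (fun k hk => ?_) n
      · have := apply_iterate_deck h0 (μ q.2) (β q.2)
        rw [hbq] at this
        rw [this]; ring
      · have := apply_iterate_deck (κ := 0) (f := Φ k) (fun w => by rw [h1 k hk, add_zero])
          (μ q.2) (β q.2)
        rw [hbq, mul_zero, add_zero] at this
        rw [hF k hk q hq.1, this]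
    have h5 : Real.exp (-(clock S q.1 (β q.2)).re) ≤ Real.exp 1 * Real.exp (-q.1.re) := by
      rw [← Real.exp_add, Real.exp_le_exp]
      linarith [sub_one_le_re_of_norm_sub_le hc2]
    have h6 : M₁ * Real.exp (-(clock S q.1 (β q.2)).re) ^ (n + 1)
        ≤ M₁ * Real.exp 1 ^ (n + 1) * Real.exp (-q.1.re) ^ (n + 1) := by
      rw [mul_assoc, ← mul_pow]
      gcongr
    rw [div_eq_mul_inv, ← inv_pow, Complex.norm_exp, ← Real.exp_neg, h4]
    rw [norm_sub_rev] at h3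
    have h7 := norm_add_le (f (clock S q.1 (β q.2)) - truncation a Φ n (clock S q.1 (β q.2), w₀))
      (truncation a Φ n (clock S q.1 (β q.2), w₀) - truncation a Φ n (q.1, β q.2))
    rw [show f (clock S q.1 (β q.2)) + μ q.2 * κ + (F 0 q.2 - Φ 0 q.2)
      - (truncation a Φ n (q.1, β q.2) + (μ q.2 * κ + (F 0 q.2 - Φ 0 q.2)))
      = (f (clock S q.1 (β q.2)) - truncation a Φ n (clock S q.1 (β q.2), w₀))
        + (truncation a Φ n (clock S q.1 (β q.2), w₀) - truncation a Φ n (q.1, β q.2)) by ring]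
    linarith

end Assembly

end FormalMotion

theorem theorem2p2 (P₀ : Polynomial ℂ) (Q : ℂ → ℂ → ℂ) (r : ℝ)
    (hform : FormalMotion.IsNormalForm P₀ Q r)
    {E : Type*} [TopologicalSpace E] [SimplyConnectedSpace E]
    (p : E → FormalMotion.Punctured P₀) (hp : IsCoveringMap p)
    (g : E ≃ₜ E) (hg : ∀ w, p (g w) = p w)
    (S : Set E) (hS : FormalMotion.IsRegularDomain p g S)
    (M₀ ε R₀ : ℝ) (hM₀ : 0 < M₀) (hε : 0 < ε) (hR₀ : 1 / r ≤ R₀)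
    (a : ℂ) (F : ℕ → E → ℂ) (D : Set (ℂ × E)) (hDopen : IsOpen D)
    (hD : D ⊆ FormalMotion.domainOne p S M₀ ε R₀)
    (hF : FormalMotion.IsFormalConstant Q p a F D)
    (b L : ℝ) (hb : 0 < b)
    (hcurves : ∀ q ∈ D, ∀ n : ℕ, n ≤ 1 → ∃ (γ : ℝ → ℂ) (η : ℝ → E), γ 0 = q.1 ∧ η 0 = q.2 ∧
      FormalMotion.IsAdmissibleCurve Q p a F D b L n γ η) :
    ∃ R₁ : ℝ, R₀ ≤ R₁ ∧ ∃ C : ℂ × E → ℂ,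
      FormalMotion.IsActualConstant Q p a F (D ∩ {q | R₁ < ‖Complex.exp q.1‖}) C := by
  rcases D.eq_empty_or_nonempty with rfl | hne
  · exact ⟨R₀, le_rfl, 0, by simp [FormalMotion.IsActualConstant]⟩
  obtain ⟨dF, hd, hc, hbd, -⟩ := hF
  obtain ⟨B, hB, hcov⟩ := FormalMotion.exists_compact_cover hS hε hD
  have hc0 := fun q hq => hcurves q hq 0 zero_le_one
  obtain ⟨Φ, dΦ, κ, hΦ, hκ, h0, h1, hF1, hF0⟩ :=
    FormalMotion.exists_invariant_solution (dF := dF) hform hp hg (isOpenMap_snd D hDopen)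
      (hne.image _) (by rintro k _ ⟨q, hq, rfl⟩; exact hd k q hq)
      (by rintro k _ ⟨q, hq, rfl⟩; exact hc k q hq)
      (fun k hk => by
        obtain ⟨M, hM⟩ := hbd k hk
        exact ⟨M, by rintro _ ⟨q, hq, rfl⟩; exact hM q hq⟩)
      (by
        rintro _ ⟨q, hq, rfl⟩ C
        obtain ⟨γ, η, -, hη, h⟩ := hc0 q hq
        obtain ⟨t, ht, hlt⟩ := h.exists_lt_norm C
        rw [← hη]
        exact ⟨η t, FormalMotion.mem_connectedComponentIn_of_curve h.continuous_y
          (fun t ht => mem_image_of_mem Prod.snd (h.mem t ht)) ht, hlt⟩)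
      hB (by rintro _ ⟨q, hq, rfl⟩; exact hcov q hq)
  obtain ⟨δ, hδ, hδ1, R, hdir⟩ := FormalMotion.exists_mem_sector_of_curves hp hκ
    (hΦ.continuous hp 0) h0 hB hDopen hcov hF0 hc0
  -- Any point of the covering surface can serve as the base point of the clock.
  obtain ⟨q₀, -⟩ := hne
  exact FormalMotion.exists_isActualConstant hform hp hg hΦ hκ h0 h1 hDopen
    (fun k hk q hq => hF1 k hk q.2 (mem_image_of_mem _ hq))
    (fun q hq => hF0 q.2 (mem_image_of_mem _ hq)) hB hcov hδ hδ1
    hdir q₀.2 R₀
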